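/- Let $k$ be an algebraically closed field of characteristic zero and $A$ a basic connected finite dimensional $k$-algebra. Fix a decomposition $1=\sum_{x}e_x$ into primitive orthogonal idempotents and regard $A$ as a $k$-category with objects the $e_x$ and morphism spaces $e_yAe_x$ from $e_x$ to $e_y$. Let $Q$ be its ordinary quiver, with $Q_0=\{e_x\}$. Assume that $Q$ has no double bypass: there are no arrows $\alpha,\beta$ and oriented paths $u\neq\alpha$ parallel to $\alpha$, $v\neq\beta$ parallel to $\beta$, such that $\beta$ appears in $u$. A presentation of $A$ is an isomorphism of $k$-categories $kQ/I\xrightarrow{\sim}A$ with $I$ an admissible ideal of $kQ$, equal to the identity on objects. For an admissible ideal $I$, a minimal relation is a nonzero $r=\sum_i t_iu_i\in I$ ($t_i\in k^*$, $u_i$ distinct parallel paths) no nonempty proper partial sum of which is in $I$, and $\sim_I$ denotes the homotopy relation on walks in $Q$: the smallest equivalence relation compatible with concatenation such that $\alpha\alpha^{-1}$ and $\alpha^{-1}\alpha$ are trivial for every arrow $\alpha$ and the paths occurring in a common minimal relation of $I$ are equivalent. Let $\Gamma$ be the quiver whose vertices are the relations $\sim_I$ for the presentations $kQ/I\simeq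 A$, with an arrow $\sim\,\to\,\sim'$ if there are admissible ideals $I,J$ and a transvection $\varphi$ of $kQ$ (an automorphism fixing the vertices, sending one arrow $\alpha$ to $\alpha+\tau u$ with $\tau\in k$ and $u\neq\alpha$ a path parallel to $\alpha$, and fixing all other arrows) such that $\sim\,=\,\sim_I$, $\sim'\,=\,\sim_J$, $J=\varphi(I)$, $\alpha\not\sim_I u$ and $\alpha\sim_J u$. Then $\Gamma$ has a unique source. Let $\varphi_0\colon kQ/I_0\xrightarrow{\sim}A$ be any presentation such that $\sim_{I_0}$ is the source of $\Gamma$ (a privileged presentation), let $x_0\in Q_0$, let $\pi_1(Q,I_0)$ be the group of $\sim_{I_0}$-classes of closed walks at $x_0$, and let $\bar p_0\colon k\tilde Q/\tilde I_0\to kQ/I_0$ be the functor induced by the universal cover $(\tilde Q,\tilde I_0)\to(Q,I_0)$: the vertices of $\tilde Q$ are the classes $[w]$ of walks starting at $x_0$, its arrows are the $(\alpha,[w])\colon[w]\to[\alpha w]$, $\tilde I_0$ is the inverse image of $I_0$, and $[\gamma]\in\pi_1(Q,I_0)$ acts by $[w]\mapsto[w\gamma^{-1}]$. Then for every Galois covering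 $F\colon\mathcal C'\to A$ with group $G$, where $\mathcal C'$ is a connected locally bounded $k$-category, there exist an isomorphism of $k$-categories $\theta\colon kQ/I_0\xrightarrow{\sim}A$ equal to $\varphi_0$ on objects, a normal subgroup $N$ of $\pi_1(Q,I_0)$ and a Galois covering $F'\colon k\tilde Q/\tilde I_0\to\mathcal C'$ with group $N$ (acting by restriction of the action of $\pi_1(Q,I_0)$) such that $$F\circ F'=\theta\circ\bar p_0,$$ and there is an exact sequence of groups $1\to N\to\pi_1(Q,I_0)\to G\to1$ whose first map is the inclusion. Here a Galois covering $F\colon\mathcal E\to\mathcal B$ with group $G$ is a $k$-linear functor together with an action of $G$ on $\mathcal E$ by $k$-linear automorphisms, free on objects, such that $F$ induces an isomorphism $\mathcal E/G\xrightarrow{\sim}\mathcal B$; equivalently, $F$ is a covering functor, $F\circ g=F$ for all $g\in G$, and $G$ acts transitively on the fibres of $F$ on objects. -/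

import Mathlib

open CategoryTheory

universe w v u

noncomputable section

/-! ### `k`-categories, covering functors, Galois coverings -/

section Categories

variable (k : Type*) [Field k]

/-- A `k`-category is connected if it has an object and any two objects are joined by a finite
sequence of objects in which any two consecutive ones have a nonzero morphism between them, in one
direction or the other. -/
def IsConnectedKCat (C : Type*) [Category* C] [Preadditive C] : Prop :=
  Nonempty C ∧ ∀ x y : C,
    Relation.ReflTransGen (fun a b : C => (∃ f : a ⟶ b, f ≠ 0) ∨ (∃ f : b ⟶ a, f ≠ 0)) x y

/-- Locally bounded `k`-categories. -/
structure IsLocallyBounded (C : Type*) [Category* C] [Preadditive C] [Linear k C] : Prop where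
  eq_of_iso : ∀ x y : C, Nonempty (x ≅ y) → x = y
  local_end : ∀ x : C, IsLocalRing (End x)
  finite_from : ∀ x : C, Module.Finite k (DirectSum C fun y => (x ⟶ y))
  finite_to : ∀ y : C, Module.Finite k (DirectSum C fun x => (x ⟶ y))

/-- The radical: the span of the non-invertible morphisms (in a locally bounded category the
non-invertible morphisms already form a subspace). -/
def radHom (C : Type*) [Category* C] [Preadditive C] [Linear k C] (x y : C) :
    Submodule k (x ⟶ y) :=
  Submodule.span k {f | ¬ IsIso f}

/-- The square of the radical. -/
def radSqHom (C : Type*) [Category* C] [Preadditive C] [Linear k C] (x y : C) :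
    Submodule k (x ⟶ y) :=
  Submodule.span k {h | ∃ (z : C) (f : x ⟶ z) (g : z ⟶ y),
    f ∈ radHom k C x z ∧ g ∈ radHom k C z y ∧ h = f ≫ g}

/-- The quiver `Q` on `V` is the ordinary quiver of the `k`-category `C`, the vertices being
identified with the objects through the bijection `ob`: the number of arrows `x ⟶ y` is the
dimension of the radical modulo its square. -/
def IsOrdinaryQuiver (V : Type*) [Quiver V] (C : Type*) [Category* C] [Preadditive C]
    [Linear k C] (ob : V ≃ C) : Prop :=
  ∀ x y : V, Finite (x ⟶ y) ∧
    Nat.card (x ⟶ y) = Module.finrank k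
      (radHom k C (ob x) (ob y) ⧸ (radSqHom k C (ob x) (ob y)).submoduleOf (radHom k C (ob x) (ob y)))

variable {E B : Type*} [Category* E] [Category* B] [Preadditive E] [Preadditive B]

open Classical in
/-- The map `⨁_{F y = b} E(x, y) → B(F x, b)` induced by `F`. -/
def coverMapFrom (F : E ⥤ B) [F.Additive] (x : E) (b : B) :
    (DirectSum {y : E // F.obj y = b} fun y => (x ⟶ y.1)) →+ (F.obj x ⟶ b) :=
  DirectSum.toAddMonoid fun y =>
    AddMonoidHom.mk' (fun f : x ⟶ y.1 => F.map f ≫ eqToHom y.2)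
      (fun f g => by rw [F.map_add, Preadditive.add_comp])

open Classical in
/-- The map `⨁_{F x = b} E(x, y) → B(b, F y)` induced by `F`. -/
def coverMapTo (F : E ⥤ B) [F.Additive] (b : B) (y : E) :
    (DirectSum {x : E // F.obj x = b} fun x => (x.1 ⟶ y)) →+ (b ⟶ F.obj y) :=
  DirectSum.toAddMonoid fun x =>
    AddMonoidHom.mk' (fun f : x.1 ⟶ y => eqToHom x.2.symm ≫ F.map f)
      (fun f g => by rw [F.map_add, Preadditive.comp_add])

/-- Covering functors. -/
structure IsCovering (F : E ⥤ B) [F.Additive] : Prop where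
  fibre_nonempty : ∀ b : B, ∃ x : E, F.obj x = b
  bijective_from : ∀ (x : E) (b : B), Function.Bijective (coverMapFrom F x b)
  bijective_to : ∀ (b : B) (y : E), Function.Bijective (coverMapTo F b y)

/-- `F : E ⥤ B` is a Galois covering with group `G`, where `g : G` acts on `E` as `act g`: the
`act g` form an action of `G` on `E` by `k`-linear automorphisms, free on objects, and `F` is a
`k`-linear covering functor, invariant under `G`, whose fibres are the `G`-orbits. -/
structure IsGaloisCovering {G : Type*} [Group G] [Linear k E] [Linear k B]
    (act : G → E ⥤ E) (F : E ⥤ B) [F.Additive] : Prop where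
  linear : F.Linear k
  act_additive : ∀ g, (act g).Additive
  act_linear : ∀ g, (act g).Linear k
  act_one : act 1 = 𝟭 E
  act_mul : ∀ g h, act (g * h) = act h ⋙ act g
  free : ∀ (g : G) (x : E), (act g).obj x = x → g = 1
  covering : IsCovering F
  invariant : ∀ g, act g ⋙ F = F
  transitive : ∀ x y : E, F.obj x = F.obj y → ∃ g, (act g).obj x = y

end Categories

/-! ### A basic algebra as a `k`-category -/

section Peirce

variable {V : Type*} [Fintype V] {A : Type*} [Ring A]

/-- `1 = ∑ e x` is a decomposition of the unit of `A` into primitive orthogonal idempotents such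
that the (indecomposable projective) left ideals `A e x` are pairwise non-isomorphic; that `A`
has such a decomposition means that `A` is basic. -/
structure IsBasicDecomposition (e : V → A) : Prop extends CompleteOrthogonalIdempotents e where
  ne_zero : ∀ x, e x ≠ 0
  primitive : ∀ x (f g : A), IsIdempotentElem f → IsIdempotentElem g → f * g = 0 → g * f = 0 →
    f + g = e x → f = 0 ∨ g = 0
  not_iso : ∀ x y, x ≠ y →
    IsEmpty ((Ideal.span {e x} : Ideal A) ≃ₗ[A] (Ideal.span {e y} : Ideal A))

variable (k : Type*) [Field k] [Algebra k A]

/-- The subspace `b A a` of `A`, for idempotents `a` and `b`. -/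
def peirceSpace (b a : A) : Submodule k A where
  carrier := {r | b * r = r ∧ r * a = r}
  add_mem' := by
    rintro r s ⟨h1, h2⟩ ⟨h3, h4⟩
    exact ⟨by rw [mul_add, h1, h3], by rw [add_mul, h2, h4]⟩
  zero_mem' := ⟨mul_zero _, zero_mul _⟩
  smul_mem' := by
    rintro c r ⟨h1, h2⟩
    exact ⟨by rw [mul_smul_comm, h1], by rw [smul_mul_assoc, h2]⟩

/-- `A` seen as a `k`-category: the objects are the idempotents `e x`, the morphisms
`e x ⟶ e y` are the elements of `e y A e x`, and the composition is the product of `A`. -/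
@[ext]
structure IdemCat (k : Type*) [Field k] [Algebra k A] {e : V → A} (he : IsBasicDecomposition e) where
  vertex : V

variable {k} {e : V → A} {he : IsBasicDecomposition e}

/-- The vertices as objects of `A`. -/
def IdemCat.ob (k : Type*) [Field k] [Algebra k A] (he : IsBasicDecomposition e) :
    V ≃ IdemCat k he where
  toFun x := ⟨x⟩
  invFun x := x.vertex
  left_inv _ := rfl
  right_inv _ := rfl

instance : Category (IdemCat k he) where
  Hom x y := peirceSpace k (e y.vertex) (e x.vertex)
  id x := ⟨e x.vertex, he.idem x.vertex, he.idem x.vertex⟩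
  comp f g := ⟨g.1 * f.1, by rw [← mul_assoc, g.2.1], by rw [mul_assoc, f.2.2]⟩
  id_comp f := Subtype.ext f.2.2
  comp_id f := Subtype.ext f.2.1
  assoc f g h := Subtype.ext (mul_assoc h.1 g.1 f.1).symm

instance : Preadditive (IdemCat k he) where
  homGroup x y := inferInstanceAs (AddCommGroup (peirceSpace k (e y.vertex) (e x.vertex)))
  add_comp _ _ _ f f' g := Subtype.ext (mul_add g.1 f.1 f'.1)
  comp_add _ _ _ f g g' := Subtype.ext (add_mul g.1 g'.1 f.1)

instance : Linear k (IdemCat k he) where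
  homModule x y := inferInstanceAs (Module k (peirceSpace k (e y.vertex) (e x.vertex)))
  smul_comp _ _ _ c f g := Subtype.ext (mul_smul_comm c g.1 f.1)
  comp_smul _ _ _ f c g := Subtype.ext (smul_mul_assoc c g.1 f.1)

end Peirce

/-! ### Path categories, ideals, bound quivers -/

section Bound

variable (k : Type w) [Field k] {V : Type u} [Quiver.{v} V]

/-- The morphism space of the path category `kQ` from `x` to `y`: the vector space with basis
the oriented paths from `x` to `y`. -/
abbrev PathSpace (x y : V) : Type max w u v := Quiver.Path x y →₀ k

/-- The composition of `kQ` (first argument first), induced by the concatenation of paths. -/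
def pathMul (x y z : V) : PathSpace k x y →ₗ[k] PathSpace k y z →ₗ[k] PathSpace k x z :=
  Finsupp.lsum ℕ fun p => LinearMap.toSpanSingleton k _
    (Finsupp.lmapDomain k k fun q : Quiver.Path y z => p.comp q)

theorem pathMul_single_single {x y z : V} (p : Quiver.Path x y) (q : Quiver.Path y z) (a b : k) :
    pathMul k x y z (Finsupp.single p a) (Finsupp.single q b) =
      Finsupp.single (p.comp q) (a * b) := by
  simp [pathMul]

theorem pathMul_assoc {x y z t : V} (f : PathSpace k x y) (g : PathSpace k y z)
    (h : PathSpace k z t) :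
    pathMul k x z t (pathMul k x y z f g) h = pathMul k x y t f (pathMul k y z t g h) := by
  induction f using Finsupp.induction_linear with
  | zero => simp
  | add f₁ f₂ h₁ h₂ => simp only [map_add, LinearMap.add_apply, h₁, h₂]
  | single p a =>
    induction g using Finsupp.induction_linear with
    | zero => simp
    | add f₁ f₂ h₁ h₂ => simp only [map_add, LinearMap.add_apply, h₁, h₂]
    | single q b =>
      induction h using Finsupp.induction_linear with
      | zero => simp
      | add f₁ f₂ h₁ h₂ => simp only [map_add, h₁, h₂]
      | single r c => simp only [pathMul_single_single, Quiver.Path.comp_assoc, mul_assoc]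

theorem nil_pathMul {x y : V} (f : PathSpace k x y) :
    pathMul k x x y (Finsupp.single Quiver.Path.nil 1) f = f := by
  induction f using Finsupp.induction_linear with
  | zero => simp
  | add f₁ f₂ h₁ h₂ => simp only [map_add, h₁, h₂]
  | single p a => simp only [pathMul_single_single, Quiver.Path.nil_comp, one_mul]

theorem pathMul_nil {x y : V} (f : PathSpace k x y) :
    pathMul k x y y f (Finsupp.single Quiver.Path.nil 1) = f := by
  induction f using Finsupp.induction_linear with
  | zero => simp
  | add f₁ f₂ h₁ h₂ => simp only [map_add, LinearMap.add_apply, h₁, h₂]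
  | single p a => simp only [pathMul_single_single, Quiver.Path.comp_nil, mul_one]

variable (V) in
/-- Ideals of the path category `kQ`. -/
@[ext]
structure PathIdeal where
  sub : ∀ x y : V, Submodule k (PathSpace k x y)
  mul_left : ∀ {x y z : V} (f : PathSpace k x y) (g : PathSpace k y z),
    g ∈ sub y z → pathMul k x y z f g ∈ sub x z
  mul_right : ∀ {x y z : V} (f : PathSpace k x y) (g : PathSpace k y z),
    f ∈ sub x y → pathMul k x y z f g ∈ sub x z

variable {k}

/-- Admissible ideals: every element is a combination of paths of length at least two, and for
each vertex `x` all sufficiently long paths with source or target `x` are in the ideal. -/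
structure PathIdeal.IsAdmissible (I : PathIdeal k V) : Prop where
  length_ge_two : ∀ (x y : V) (f : PathSpace k x y), f ∈ I.sub x y →
    ∀ p ∈ f.support, 2 ≤ p.length
  long_mem : ∀ x : V, ∃ n : ℕ, 2 ≤ n ∧
    (∀ (y : V) (p : Quiver.Path x y), n ≤ p.length → Finsupp.single p 1 ∈ I.sub x y) ∧
    (∀ (y : V) (p : Quiver.Path y x), n ≤ p.length → Finsupp.single p 1 ∈ I.sub y x)

/-- The objects of the quotient category `kQ/I`. -/
@[ext]
structure BoundCat (I : PathIdeal k V) where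
  vertex : V

/-- The composition of `kQ/I`. -/
def PathIdeal.quotMul (I : PathIdeal k V) (x y z : V) :
    (PathSpace k x y ⧸ I.sub x y) →ₗ[k] (PathSpace k y z ⧸ I.sub y z) →ₗ[k]
      (PathSpace k x z ⧸ I.sub x z) :=
  (I.sub x y).liftQ
    { toFun := fun f => (I.sub y z).mapQ (I.sub x z) (pathMul k x y z f)
        (fun g hg => I.mul_left f g hg)
      map_add' := fun f f' => by
        apply Submodule.linearMap_qext
        refine LinearMap.ext fun g => ?_
        simp
      map_smul' := fun c f => by
        apply Submodule.linearMap_qext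
        refine LinearMap.ext fun g => ?_
        simp }
    (fun f hf => by
      rw [LinearMap.mem_ker]
      apply Submodule.linearMap_qext
      refine LinearMap.ext fun g => ?_
      simpa using I.mul_right f g hf)

theorem PathIdeal.quotMul_mk (I : PathIdeal k V) {x y z : V} (f : PathSpace k x y)
    (g : PathSpace k y z) :
    I.quotMul x y z ((I.sub x y).mkQ f) ((I.sub y z).mkQ g) =
      (I.sub x z).mkQ (pathMul k x y z f g) := rfl

instance (I : PathIdeal k V) : Category (BoundCat I) where
  Hom x y := PathSpace k x.vertex y.vertex ⧸ I.sub x.vertex y.vertex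
  id x := (I.sub x.vertex x.vertex).mkQ (Finsupp.single Quiver.Path.nil 1)
  comp {x y z} f g := I.quotMul x.vertex y.vertex z.vertex f g
  id_comp f := by
    obtain ⟨f, rfl⟩ := Submodule.mkQ_surjective _ f
    rw [I.quotMul_mk, nil_pathMul]
  comp_id f := by
    obtain ⟨f, rfl⟩ := Submodule.mkQ_surjective _ f
    rw [I.quotMul_mk, pathMul_nil]
  assoc f g h := by
    obtain ⟨f, rfl⟩ := Submodule.mkQ_surjective _ f
    obtain ⟨g, rfl⟩ := Submodule.mkQ_surjective _ g
    obtain ⟨h, rfl⟩ := Submodule.mkQ_surjective _ h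
    rw [I.quotMul_mk, I.quotMul_mk, I.quotMul_mk, I.quotMul_mk, pathMul_assoc]

instance (I : PathIdeal k V) : Preadditive (BoundCat I) where
  homGroup x y :=
    inferInstanceAs (AddCommGroup (PathSpace k x.vertex y.vertex ⧸ I.sub x.vertex y.vertex))
  add_comp x y z f f' g :=
    LinearMap.map_add₂ (I.quotMul x.vertex y.vertex z.vertex) f f' g
  comp_add x y z f g g' :=
    (I.quotMul x.vertex y.vertex z.vertex f).map_add g g'

instance (I : PathIdeal k V) : Linear k (BoundCat I) where
  homModule x y :=
    inferInstanceAs (Module k (PathSpace k x.vertex y.vertex ⧸ I.sub x.vertex y.vertex))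
  smul_comp x y z c f g :=
    LinearMap.map_smul₂ (I.quotMul x.vertex y.vertex z.vertex) c f g
  comp_smul x y z f c g :=
    (I.quotMul x.vertex y.vertex z.vertex f).map_smul c g

variable {W : Type*} [Quiver W]

variable (k) in
/-- The linear map on path spaces induced by a morphism of quivers. -/
def pathPush (F : V ⥤q W) (x y : V) :
    PathSpace k x y →ₗ[k] PathSpace k (F.obj x) (F.obj y) :=
  Finsupp.lmapDomain k k fun p : Quiver.Path x y => F.mapPath p

theorem pathPush_pathMul (F : V ⥤q W) {x y z : V} (f : PathSpace k x y) (g : PathSpace k y z) :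
    pathPush k F x z (pathMul k x y z f g) =
      pathMul k _ _ _ (pathPush k F x y f) (pathPush k F y z g) := by
  induction f using Finsupp.induction_linear with
  | zero => simp
  | add f₁ f₂ h₁ h₂ => simp only [map_add, LinearMap.add_apply, h₁, h₂]
  | single p a =>
    induction g using Finsupp.induction_linear with
    | zero => simp
    | add f₁ f₂ h₁ h₂ => simp only [map_add, h₁, h₂]
    | single q b =>
      simp only [pathPush, pathMul_single_single, Finsupp.lmapDomain_apply,
        Finsupp.mapDomain_single, Prefunctor.mapPath_comp]

/-- The inverse image of an ideal under a morphism of quivers. -/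
def PathIdeal.pullback (F : V ⥤q W) (I : PathIdeal k W) : PathIdeal k V where
  sub x y := (I.sub (F.obj x) (F.obj y)).comap (pathPush k F x y)
  mul_left f g hg := by
    rw [Submodule.mem_comap] at hg ⊢
    rw [pathPush_pathMul]
    exact I.mul_left _ _ hg
  mul_right f g hf := by
    rw [Submodule.mem_comap] at hf ⊢
    rw [pathPush_pathMul]
    exact I.mul_right _ _ hf

/-- The functor `kQ/I ⥤ kQ'/J` induced by a morphism of quivers that maps `I` into `J`. -/
def boundFunctor (F : V ⥤q W) (I : PathIdeal k V) (J : PathIdeal k W)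
    (h : ∀ x y : V, I.sub x y ≤ (J.pullback F).sub x y) : BoundCat I ⥤ BoundCat J where
  obj x := ⟨F.obj x.vertex⟩
  map {x y} f := (I.sub x.vertex y.vertex).mapQ (J.sub (F.obj x.vertex) (F.obj y.vertex))
    (pathPush k F x.vertex y.vertex) (h x.vertex y.vertex) f
  map_id x := congrArg (J.sub (F.obj x.vertex) (F.obj x.vertex)).mkQ
    (Finsupp.mapDomain_single (f := fun p : Quiver.Path x.vertex x.vertex => F.mapPath p)
      (a := Quiver.Path.nil) (b := (1 : k)))
  map_comp {x y z} f g := by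
    obtain ⟨f, rfl⟩ := Submodule.mkQ_surjective _ f
    obtain ⟨g, rfl⟩ := Submodule.mkQ_surjective _ g
    exact congrArg (J.sub (F.obj x.vertex) (F.obj z.vertex)).mkQ (pathPush_pathMul F f g)

end Bound

/-! ### The homotopy relation and the fundamental group -/

section Homotopy

variable {k : Type w} [Field k] {V : Type u} [Quiver.{v} V]

/-- Walks: formal composites of arrows (`cons`) and of formal inverses of arrows (`consInv`). -/
inductive Walk (x : V) : V → Type max u v
  | nil : Walk x x
  | cons {y z : V} : Walk x y → (y ⟶ z) → Walk x z
  | consInv {y z : V} : Walk x y → (z ⟶ y) → Walk x z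

namespace Walk

/-- Concatenation of walks, first argument first. -/
def comp {x y : V} (c : Walk x y) : ∀ {z : V}, Walk y z → Walk x z
  | _, nil => c
  | _, cons d a => (c.comp d).cons a
  | _, consInv d a => (c.comp d).consInv a

/-- The inverse walk. -/
def inv {x : V} : ∀ {y : V}, Walk x y → Walk y x
  | _, nil => nil
  | _, cons c a => ((nil : Walk _ _).consInv a).comp c.inv
  | _, consInv c a => ((nil : Walk _ _).cons a).comp c.inv

/-- An oriented path as a walk. -/
def ofPath {x : V} : ∀ {y : V}, Quiver.Path x y → Walk x y
  | _, .nil => nil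
  | _, .cons p a => (ofPath p).cons a

theorem comp_assoc {x y z t : V} (c : Walk x y) (d : Walk y z) (d' : Walk z t) :
    (c.comp d).comp d' = c.comp (d.comp d') := by
  induction d' with
  | nil => rfl
  | cons _ a ih => exact congrArg (fun w => cons w a) ih
  | consInv _ a ih => exact congrArg (fun w => consInv w a) ih

theorem nil_comp {x y : V} (c : Walk x y) : (nil : Walk x x).comp c = c := by
  induction c with
  | nil => rfl
  | cons _ a ih => exact congrArg (fun w => cons w a) ih
  | consInv _ a ih => exact congrArg (fun w => consInv w a) ih

end Walk

/-- Minimal relations: nonzero elements `t₁u₁ + ⋯ + tₙuₙ` of the ideal (with distinct paths `uᵢ`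
and nonzero `tᵢ`) no nonempty proper partial sum of which is in the ideal. -/
structure PathIdeal.IsMinimalRelation (I : PathIdeal k V) {x y : V} (r : PathSpace k x y) :
    Prop where
  mem : r ∈ I.sub x y
  ne_zero : r ≠ 0
  minimal : ∀ s : Finset (Quiver.Path x y), s.Nonempty → s ⊂ r.support →
    ∑ p ∈ s, Finsupp.single p (r p) ∉ I.sub x y

/-- The homotopy relation of `(Q, I)`: the smallest equivalence relation on walks compatible with
concatenation such that `a a⁻¹` and `a⁻¹ a` are trivial for every arrow `a` and the paths of a
minimal relation are equivalent. -/
inductive PathIdeal.Homotopic (I : PathIdeal k V) : ∀ {x y : V}, Walk x y → Walk x y → Prop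
  | refl {x y : V} (c : Walk x y) : Homotopic I c c
  | symm {x y : V} {c d : Walk x y} : Homotopic I c d → Homotopic I d c
  | trans {x y : V} {c d d' : Walk x y} :
      Homotopic I c d → Homotopic I d d' → Homotopic I c d'
  | comp {x y z : V} {c c' : Walk x y} {d d' : Walk y z} :
      Homotopic I c c' → Homotopic I d d' → Homotopic I (c.comp d) (c'.comp d')
  | cons_consInv {x y : V} (a : x ⟶ y) : Homotopic I ((Walk.nil.cons a).consInv a) Walk.nil
  | consInv_cons {x y : V} (a : x ⟶ y) : Homotopic I ((Walk.nil.consInv a).cons a) Walk.nil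
  | relation {x y : V} (r : PathSpace k x y) (hr : I.IsMinimalRelation r)
      (p q : Quiver.Path x y) (hp : p ∈ r.support) (hq : q ∈ r.support) :
      Homotopic I (Walk.ofPath p) (Walk.ofPath q)

theorem PathIdeal.Homotopic.comp_inv (I : PathIdeal k V) {x y : V} (c : Walk x y) :
    I.Homotopic (c.comp c.inv) Walk.nil := by
  induction c with
  | nil => exact .refl _
  | cons c a ih =>
    have h : (c.cons a).comp (c.cons a).inv = (c.comp ((Walk.nil.cons a).consInv a)).comp c.inv := by
      simp only [Walk.inv, ← Walk.comp_assoc]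
      rfl
    rw [h]
    exact .trans (.comp (.comp (.refl c) (.cons_consInv a)) (.refl _)) ih
  | consInv c a ih =>
    have h : (c.consInv a).comp (c.consInv a).inv =
        (c.comp ((Walk.nil.consInv a).cons a)).comp c.inv := by
      simp only [Walk.inv, ← Walk.comp_assoc]
      rfl
    rw [h]
    exact .trans (.comp (.comp (.refl c) (.consInv_cons a)) (.refl _)) ih

theorem PathIdeal.Homotopic.inv_comp (I : PathIdeal k V) {x y : V} (c : Walk x y) :
    I.Homotopic (c.inv.comp c) Walk.nil := by
  induction c with
  | nil => exact .refl _
  | cons c a ih =>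
    have h : (c.cons a).inv.comp (c.cons a) =
        ((Walk.nil.consInv a).comp (c.inv.comp c)).comp (Walk.nil.cons a) := by
      simp only [Walk.inv, Walk.comp_assoc]
      rfl
    rw [h]
    exact .trans (.comp (.comp (.refl _) ih) (.refl _)) (.consInv_cons a)
  | consInv c a ih =>
    have h : (c.consInv a).inv.comp (c.consInv a) =
        ((Walk.nil.cons a).comp (c.inv.comp c)).comp (Walk.nil.consInv a) := by
      simp only [Walk.inv, Walk.comp_assoc]
      rfl
    rw [h]
    exact .trans (.comp (.comp (.refl _) ih) (.refl _)) (.cons_consInv a)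

theorem PathIdeal.Homotopic.inv {I : PathIdeal k V} {x y : V} {c d : Walk x y}
    (h : I.Homotopic c d) : I.Homotopic c.inv d.inv := by
  have h₁ : I.Homotopic (c.inv.comp (d.comp d.inv)) c.inv :=
    .comp (.refl c.inv) (.comp_inv I d)
  have h₂ : I.Homotopic (c.inv.comp (d.comp d.inv)) d.inv := by
    rw [← Walk.comp_assoc]
    have h₃ := Homotopic.comp (.trans (.comp (.refl c.inv) (.symm h)) (.inv_comp I c))
      (.refl d.inv)
    rwa [Walk.nil_comp] at h₃
  exact .trans (.symm h₁) h₂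

/-- Homotopy as a setoid on the walks with given end points. -/
def PathIdeal.homotopySetoid (I : PathIdeal k V) (x y : V) : Setoid (Walk x y) where
  r := I.Homotopic
  iseqv := ⟨.refl, .symm, .trans⟩

/-- Homotopy classes of walks from `x` to `y`. -/
def WalkClass (I : PathIdeal k V) (x y : V) : Type max u v :=
  _root_.Quotient (I.homotopySetoid x y)

namespace WalkClass

variable {I : PathIdeal k V} {x y z t : V}

/-- The class of a walk. -/
def mk (I : PathIdeal k V) (c : Walk x y) : WalkClass I x y :=
  Quotient.mk (I.homotopySetoid x y) c

/-- Concatenation of classes, first argument first. -/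
def comp (c : WalkClass I x y) (d : WalkClass I y z) : WalkClass I x z :=
  Quotient.liftOn₂ c d (fun c d => mk I (c.comp d)) fun _ _ _ _ h h' =>
    Quotient.sound (s := I.homotopySetoid x z) (PathIdeal.Homotopic.comp h h')

/-- The class of the inverse walk. -/
def inv (c : WalkClass I x y) : WalkClass I y x :=
  Quotient.liftOn c (fun c => mk I c.inv) fun _ _ h =>
    Quotient.sound (s := I.homotopySetoid y x) (PathIdeal.Homotopic.inv h)

theorem comp_assoc (c : WalkClass I x y) (d : WalkClass I y z) (d' : WalkClass I z t) :
    (c.comp d).comp d' = c.comp (d.comp d') := by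
  obtain ⟨c, rfl⟩ := Quotient.exists_rep c
  obtain ⟨d, rfl⟩ := Quotient.exists_rep d
  obtain ⟨d', rfl⟩ := Quotient.exists_rep d'
  exact congrArg (mk I) (Walk.comp_assoc c d d')

theorem nil_comp (c : WalkClass I x y) : (mk I Walk.nil).comp c = c := by
  obtain ⟨c, rfl⟩ := Quotient.exists_rep c
  exact congrArg (mk I) (Walk.nil_comp c)

theorem comp_nil (c : WalkClass I x y) : c.comp (mk I Walk.nil) = c := by
  obtain ⟨c, rfl⟩ := Quotient.exists_rep c
  rfl

theorem comp_inv (c : WalkClass I x y) : c.comp c.inv = mk I Walk.nil := by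
  obtain ⟨c, rfl⟩ := Quotient.exists_rep c
  exact Quotient.sound (s := I.homotopySetoid x x) (PathIdeal.Homotopic.comp_inv I c)

end WalkClass

/-- The fundamental group `π₁(Q, I, x₀)`: the homotopy classes of closed walks at `x₀`. -/
structure FundGroup (I : PathIdeal k V) (x₀ : V) where
  cls : WalkClass I x₀ x₀

/-- The product `g * h` is the class of the walk that runs through `h` first and `g` second. -/
instance (I : PathIdeal k V) (x₀ : V) : Group (FundGroup I x₀) where
  mul g h := ⟨h.cls.comp g.cls⟩
  one := ⟨WalkClass.mk I Walk.nil⟩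
  inv g := ⟨g.cls.inv⟩
  mul_assoc g h l := congrArg FundGroup.mk (WalkClass.comp_assoc l.cls h.cls g.cls).symm
  one_mul g := congrArg FundGroup.mk (WalkClass.comp_nil g.cls)
  mul_one g := congrArg FundGroup.mk (WalkClass.nil_comp g.cls)
  inv_mul_cancel g := congrArg FundGroup.mk (WalkClass.comp_inv g.cls)

/-! ### The universal cover of a bound quiver -/

/-- The vertices of the universal cover: the homotopy classes of walks starting at `x₀`. -/
@[ext]
structure UnivCover (I : PathIdeal k V) (x₀ : V) where
  target : V
  cls : WalkClass I x₀ target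

/-- The arrows `[c] ⟶ [d]` of the universal cover are the arrows `a` of `Q` that start at the
target of `c` and satisfy `[a c] = [d]`. -/
instance (I : PathIdeal k V) (x₀ : V) : Quiver (UnivCover I x₀) where
  Hom c d := {a : c.target ⟶ d.target // c.cls.comp (WalkClass.mk I (Walk.nil.cons a)) = d.cls}

/-- The projection of the universal cover onto `Q`. -/
def univProj (I : PathIdeal k V) (x₀ : V) : UnivCover I x₀ ⥤q V where
  obj c := c.target
  map a := a.1

/-- The ideal of the universal cover. -/
def univIdeal (I : PathIdeal k V) (x₀ : V) : PathIdeal k (UnivCover I x₀) :=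
  I.pullback (univProj I x₀)

/-- The functor from the universal cover to `kQ/I` induced by the projection. -/
def univFunctor (I : PathIdeal k V) (x₀ : V) : BoundCat (univIdeal I x₀) ⥤ BoundCat I :=
  boundFunctor (univProj I x₀) (univIdeal I x₀) I (fun _ _ => le_rfl)

/-- The action of the class of a closed walk `γ` on the quiver of the universal cover: `[c]` goes
to `[c γ⁻¹]` (the walk `γ⁻¹` followed by `c`). -/
def deckQuiver (I : PathIdeal k V) (x₀ : V) (g : FundGroup I x₀) :
    UnivCover I x₀ ⥤q UnivCover I x₀ where
  obj c := ⟨c.target, g.cls.inv.comp c.cls⟩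
  map a := ⟨a.1, by rw [WalkClass.comp_assoc, a.2]⟩

theorem univIdeal_le_pullback_deck (I : PathIdeal k V) (x₀ : V) (g : FundGroup I x₀)
    (c d : UnivCover I x₀) :
    (univIdeal I x₀).sub c d ≤ ((univIdeal I x₀).pullback (deckQuiver I x₀ g)).sub c d := by
  intro f hf
  change pathPush k (univProj I x₀) _ _ (pathPush k (deckQuiver I x₀ g) c d f) ∈ I.sub _ _
  have h : pathPush k (univProj I x₀) _ _ (pathPush k (deckQuiver I x₀ g) c d f) =
      pathPush k (univProj I x₀) c d f := by
    simp only [pathPush, Finsupp.lmapDomain_apply, ← Finsupp.mapDomain_comp]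
    congr 1
    funext p
    exact (Prefunctor.mapPath_comp_apply (deckQuiver I x₀ g) (univProj I x₀) p).symm
  rw [h]
  exact hf

/-- The action of the fundamental group on the category of the universal cover. -/
def deckFunctor (I : PathIdeal k V) (x₀ : V) (g : FundGroup I x₀) :
    BoundCat (univIdeal I x₀) ⥤ BoundCat (univIdeal I x₀) :=
  boundFunctor (deckQuiver I x₀ g) (univIdeal I x₀) (univIdeal I x₀)
    (univIdeal_le_pullback_deck I x₀ g)

end Homotopy

/-! ### Bypasses, transvections, and the quiver of homotopy relations -/

section Gamma

/-- `(a, p)` is a bypass: `p` is a path parallel to the arrow `a` and different from it. -/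
def IsBypass {V : Type*} [Quiver V] {x y : V} (a : x ⟶ y) (p : Quiver.Path x y) : Prop :=
  p ≠ a.toPath

/-- There is no double bypass, that is, no two bypasses `(a, p)` and `(b, q)` such that the
arrow `b` appears in the path `p`. -/
def HasNoDoubleBypass (V : Type*) [Quiver V] : Prop :=
  ∀ (x y z t : V) (a : x ⟶ y) (p : Quiver.Path x y) (b : z ⟶ t) (q : Quiver.Path z t),
    IsBypass a p → IsBypass b q →
      ¬ ∃ (p₁ : Quiver.Path x z) (p₂ : Quiver.Path t y), p = (p₁.cons b).comp p₂

variable (k : Type w) [Field k] (V : Type u) [Quiver.{v} V]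

/-- The automorphisms of the `k`-category `kQ` that fix the vertices. -/
structure PathAut where
  map : ∀ x y : V, PathSpace k x y ≃ₗ[k] PathSpace k x y
  map_nil : ∀ x : V, map x x (Finsupp.single Quiver.Path.nil 1) = Finsupp.single Quiver.Path.nil 1
  map_mul : ∀ {x y z : V} (f : PathSpace k x y) (g : PathSpace k y z),
    map x z (pathMul k x y z f g) = pathMul k x y z (map x y f) (map y z g)

variable {k V}

/-- `φ` is the transvection that maps the arrow `a` to `a + τ p` and fixes all other arrows. -/
def PathAut.IsTransvection (φ : PathAut k V) {x y : V} (a : x ⟶ y) (p : Quiver.Path x y)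
    (τ : k) : Prop :=
  IsBypass a p ∧
  φ.map x y (Finsupp.single a.toPath 1) = Finsupp.single a.toPath 1 + τ • Finsupp.single p 1 ∧
  ∀ (z t : V) (b : z ⟶ t), (⟨z, t, b⟩ : Σ z t : V, (z ⟶ t)) ≠ ⟨x, y, a⟩ →
    φ.map z t (Finsupp.single b.toPath 1) = Finsupp.single b.toPath 1

variable (V) in
/-- Relations on the walks of the quiver. -/
abbrev WalkRel : Type max u v := ∀ x y : V, Walk x y → Walk x y → Prop

/-- The homotopy relation as a relation on walks. -/
def PathIdeal.homotopyRel (I : PathIdeal k V) : WalkRel V := fun _ _ c d => I.Homotopic c d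

variable (k) in
/-- The relation `R'` is a direct successor of `R`. -/
def IsDirectSuccessor (R R' : WalkRel V) : Prop :=
  ∃ (I J : PathIdeal k V) (φ : PathAut k V) (x y : V) (a : x ⟶ y) (p : Quiver.Path x y) (τ : k),
    I.IsAdmissible ∧ J.IsAdmissible ∧ R = I.homotopyRel ∧ R' = J.homotopyRel ∧
    φ.IsTransvection a p τ ∧
    (∀ z t : V, J.sub z t = (I.sub z t).map (φ.map z t).toLinearMap) ∧
    ¬ I.Homotopic (Walk.nil.cons a) (Walk.ofPath p) ∧ J.Homotopic (Walk.nil.cons a) (Walk.ofPath p)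

variable [Fintype V] {A : Type*} [Ring A] [Algebra k A] {e : V → A}
  (he : IsBasicDecomposition e)

variable {he} in
/-- `φ : kQ/I ⥤ A` is an admissible presentation of `A`: the ideal `I` is admissible and `φ` is an
isomorphism of `k`-categories that maps each vertex to the corresponding object of `A`. -/
structure IsPresentation (I : PathIdeal k V) (φ : BoundCat I ⥤ IdemCat k he) : Prop where
  admissible : I.IsAdmissible
  additive : φ.Additive
  linear : φ.Linear k
  obj_eq : ∀ x : V, φ.obj ⟨x⟩ = IdemCat.ob k he x
  full : φ.Full
  faithful : φ.Faithful

variable (k) in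
/-- `R` is a vertex of the quiver `Γ` of `A`: the homotopy relation of a presentation of `A`. -/
def IsGammaVertex (R : WalkRel V) : Prop :=
  ∃ (I : PathIdeal k V) (φ : BoundCat I ⥤ IdemCat k he), IsPresentation I φ ∧ R = I.homotopyRel

variable (k) in
/-- `R` is a source of `Γ`: a vertex that is not a direct successor of any vertex. -/
def IsGammaSource (R : WalkRel V) : Prop :=
  IsGammaVertex k he R ∧ ∀ R' : WalkRel V, IsGammaVertex k he R' → ¬ IsDirectSuccessor k R' R

end Gamma

end

noncomputable section

/-! ### Quivers without double bypass -/

section NoDoubleBypass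

variable {V : Type u} [Quiver.{v} V]

/-! Presentations of `A` are handled through the values of the arrows. A choice of one element of
the right Peirce space per arrow, outside the square of the radical, generates `A`, and its
relations form an admissible ideal; every presentation ideal arises so (`IsGeneratingSystem`). Two
choices differ by a rescaling of the arrows, which leaves homotopy unchanged, and by a substitution
`a ↦ a + τ`, where the tail `τ` is a combination of parallel paths of length at least two.

Without double bypasses no path of a tail contains an arrow that itself has a nonzero tail. So these
substitutions compose by adding tails (`unipotent_add`) and, in characteristic zero, each is the
exponential of a derivation (`unipotent_eq_exp`).

An ideal is homogeneous for its own homotopy relation (`homogeneousFor_self`). Hence taking the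
inverse image under a substitution with homotopic terms can only shrink the relation. In the
opposite case, when no term of the tail is homotopic to its arrow for the ideal or for its inverse
image, the ideal does not move at all (`comapUnipotent_eq_of_not_homotopic`): conjugating the
projections onto homotopy classes by the exponential and comparing terms degree by degree forces the
derivation to preserve the ideal. Removing the terms of a tail one at a time, on a side where they
are homotopic, then shows that an ideal with minimal relation is reached from any other presentation
ideal through a tail that is homotopic for the latter, up to a rescaling
(`IsHomotopyMinimal.exists_homotopicTail`). So a minimal relation lies below all others; any
relation strictly above it is entered by an arrow of `Γ`, given by the first transvection at which
the relation drops (`exists_transvection`). Arrows of `Γ` strictly enlarge the relation, so its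
source is exactly the minimal relation.

For a Galois covering of `A`, each arrow can be represented by an element that lifts to a single
morphism from every point of the fibre: take one component, over the fibre, of an element outside
the square of the radical. Uniqueness of components makes minimal relations lift, so walks act on
the fibres through their homotopy classes. The tail leading to the minimal ideal consists of paths
homotopic to the arrows, which lift to the same end points; hence the lifting property passes to a
presentation with ideal `I₀`. Sending the class of a walk `w` to the end of the lift of `w` from a
base point defines the functor from the universal cover, connectedness makes it surjective on
objects, and comparing the action of closed walks with that of `G` on one fibre gives the surjection
from the fundamental group whose kernel is `N`. -/

theorem HasNoDoubleBypass.no_cycle (h : HasNoDoubleBypass V) {x y : V} (a : x ⟶ y)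
    (p : Quiver.Path y x) : False := by
  -- A return path allows the arrow to be run through twice: `a p a` is a bypass of `a` containing
  -- `a`, so one pair plays both roles.
  have hb : IsBypass a ((Quiver.Path.nil.cons a).comp (p.cons a)) := fun e => by
    have := congrArg Quiver.Path.length e
    simp [Quiver.Path.length_comp] at this
  exact h x y x y a _ a _ hb hb ⟨Quiver.Path.nil, p.cons a, rfl⟩

/-- Two distinct parallel arrows are bypasses of each other, and the second one appears in itself
seen as a path. -/
theorem HasNoDoubleBypass.subsingleton_hom (h : HasNoDoubleBypass V) (x y : V) :
    Subsingleton (x ⟶ y) := by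
  refine ⟨fun a b => by_contra fun hab => ?_⟩
  have aux : ∀ c d : x ⟶ y, c ≠ d → IsBypass c d.toPath := fun c d hcd e => hcd (by
    simpa [Quiver.Hom.toPath] using e.symm)
  exact h x y x y a _ b _ (aux a b hab) (aux b a (Ne.symm hab)) ⟨Quiver.Path.nil, Quiver.Path.nil, rfl⟩

theorem HasNoDoubleBypass.eq_nil (h : HasNoDoubleBypass V) {x : V} (p : Quiver.Path x x) :
    p = Quiver.Path.nil := by
  cases p with
  | nil => rfl
  | cons p a => exact (h.no_cycle a p).elim

theorem HasNoDoubleBypass.ne_of_hom (h : HasNoDoubleBypass V) {x y : V} (a : x ⟶ y) : x ≠ y := by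
  rintro rfl
  exact h.no_cycle a Quiver.Path.nil

theorem HasNoDoubleBypass.length_ge_two (h : HasNoDoubleBypass V) {x y : V} (a : x ⟶ y)
    (p : Quiver.Path x y) (hp : p ≠ a.toPath) : 2 ≤ p.length := by
  cases p with
  | nil => exact (h.no_cycle a Quiver.Path.nil).elim
  | cons p b =>
    cases p with
    | nil =>
      have := h.subsingleton_hom x y
      exact (hp (by rw [Subsingleton.elim a b]; rfl)).elim
    | cons p c => simp

/-- Reachability by a path of positive length is irreflexive, as there are no cycles, hence well
founded on the finite vertex set. The induction is on the target, by splitting off the last arrow.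
-/
theorem HasNoDoubleBypass.finite_path [Finite V] (hfin : ∀ x y : V, Finite (x ⟶ y))
    (h : HasNoDoubleBypass V) (x y : V) : Finite (Quiver.Path x y) := by
  let r : V → V → Prop := fun s t => ∃ p : Quiver.Path s t, 0 < p.length
  have htr : IsTrans V r := ⟨by
    rintro s t z ⟨p, hp⟩ ⟨q, hq⟩
    exact ⟨p.comp q, by rw [Quiver.Path.length_comp]; omega⟩⟩
  have hirr : Std.Irrefl r := ⟨by
    rintro s ⟨p, hp⟩
    rw [h.eq_nil p] at hp
    simp at hp⟩
  have hwf : WellFounded r := Finite.wellFounded_of_trans_of_irrefl r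
  induction y using hwf.induction with
  | _ y ih =>
    have : ∀ z, Finite (Quiver.Path x z × (z ⟶ y)) := fun z => by
      by_cases hz : Nonempty (z ⟶ y)
      · obtain ⟨a⟩ := hz
        have := ih z ⟨a.toPath, by simp⟩
        have := hfin z y
        infer_instance
      · have := not_nonempty_iff.1 hz
        infer_instance
    let F : Option (Σ z, Quiver.Path x z × (z ⟶ y)) → Set (Quiver.Path x y) := fun o =>
      match o with
      | none => {p | p.length = 0}
      | some ⟨_, p, a⟩ => {p.cons a}
    have hF : ∀ o, (F o).Finite := by
      rintro (_ | ⟨z, p, a⟩)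
      · refine Set.Subsingleton.finite fun p hp q hq => ?_
        obtain rfl := Quiver.Path.eq_of_length_zero p hp
        rw [Quiver.Path.eq_nil_of_length_zero p hp, Quiver.Path.eq_nil_of_length_zero q hq]
      · exact Set.finite_singleton _
    have huniv : (⋃ o, F o) = Set.univ := by
      refine Set.eq_univ_of_forall fun p => Set.mem_iUnion.2 ?_
      cases p with
      | nil => exact ⟨none, rfl⟩
      | cons p a => exact ⟨some ⟨_, p, a⟩, rfl⟩
    exact Set.finite_univ_iff.1 (huniv ▸ Set.finite_iUnion hF)

end NoDoubleBypass

/-! ### Coordinate projections and homogeneous subspaces -/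

section Homogeneous

variable {k : Type*} [Field k] {X : Type*}

open Classical in
/-- The projection of a space with basis `X` onto the span of the basis elements in `s`. -/
def coordProj (k : Type*) [Field k] {X : Type*} (s : X → Prop) : (X →₀ k) →ₗ[k] (X →₀ k) where
  toFun f := f.filter s
  map_add' _ _ := Finsupp.filter_add
  map_smul' _ _ := Finsupp.filter_smul

theorem coordProj_apply_pos {s : X → Prop} {q : X} (h : s q) (f : X →₀ k) :
    coordProj k s f q = f q := by
  classical
  exact Finsupp.filter_apply_pos s f h

theorem coordProj_apply_neg {s : X → Prop} {q : X} (h : ¬ s q) (f : X →₀ k) :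
    coordProj k s f q = 0 := by
  classical
  exact Finsupp.filter_apply_neg s f h

theorem coordProj_eq_self {s : X → Prop} {f : X →₀ k} (h : ∀ q, f q ≠ 0 → s q) :
    coordProj k s f = f := by
  ext q
  by_cases hq : s q
  · exact coordProj_apply_pos hq f
  · rw [coordProj_apply_neg hq]
    exact (by_contra fun h0 => hq (h q (Ne.symm h0)))

theorem coordProj_eq_zero {s : X → Prop} {f : X →₀ k} (h : ∀ q, f q ≠ 0 → ¬ s q) :
    coordProj k s f = 0 := by
  ext q
  by_cases hq : s q
  · rw [coordProj_apply_pos hq]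
    exact (by_contra fun h0 => h q h0 hq)
  · exact coordProj_apply_neg hq f

theorem coordProj_comm (s t : X → Prop) (f : X →₀ k) :
    coordProj k s (coordProj k t f) = coordProj k t (coordProj k s f) := by
  ext q
  by_cases hs : s q <;> by_cases ht : t q <;>
    simp [coordProj_apply_pos, coordProj_apply_neg, hs, ht]

theorem coordProj_apply_ne_zero {s : X → Prop} {f : X →₀ k} {q : X}
    (h : coordProj k s f q ≠ 0) : s q ∧ f q ≠ 0 := by
  by_cases hs : s q
  · exact ⟨hs, by rwa [coordProj_apply_pos hs] at h⟩
  · exact (h (coordProj_apply_neg hs f)).elim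

theorem coordProj_single_pos {s : X → Prop} {q : X} (h : s q) (c : k) :
    coordProj k s (Finsupp.single q c) = Finsupp.single q c := by
  classical
  refine coordProj_eq_self fun q' hq' => ?_
  rw [Finsupp.single_apply] at hq'
  split_ifs at hq' with e
  · exact e ▸ h
  · exact (hq' rfl).elim

theorem coordProj_single_neg {s : X → Prop} {q : X} (h : ¬ s q) (c : k) :
    coordProj k s (Finsupp.single q c) = 0 := by
  classical
  refine coordProj_eq_zero fun q' hq' => ?_
  rw [Finsupp.single_apply] at hq'
  split_ifs at hq' with e
  · exact e ▸ h
  · exact (hq' rfl).elim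

/-- An element all of whose class components are in a subspace is in the subspace. -/
theorem mem_of_coordProj_mem (R : Setoid X) (W : Submodule k (X →₀ k)) (f : X →₀ k)
    (h : ∀ p, coordProj k (R p) f ∈ W) : f ∈ W := by
  classical
  suffices H : ∀ (n : ℕ) (f : X →₀ k), f.support.card ≤ n → (∀ p, coordProj k (R p) f ∈ W) → f ∈ W from
    H _ f le_rfl h
  intro n
  induction n with
  | zero =>
    intro f hf _
    have : f = 0 := Finsupp.support_eq_empty.1 (Finset.card_eq_zero.1 (Nat.le_zero.1 hf))
    exact this ▸ W.zero_mem
  | succ n ih =>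
    intro f hf h
    by_cases h0 : f = 0
    · exact h0 ▸ W.zero_mem
    obtain ⟨p, hp⟩ := Finsupp.ne_iff.1 h0
    -- Subtracting the class component of `p` removes `p` from the support, and each class component
    -- of the difference is one of `f` or zero.
    have hsub : f - coordProj k (R p) f ∈ W := by
      refine ih _ (Nat.lt_succ_iff.1 (lt_of_lt_of_le (Finset.card_lt_card ?_) hf)) fun q => ?_
      · refine Finset.ssubset_iff_subset_ne.2 ⟨fun q hq => ?_, fun e => ?_⟩
        · rw [Finsupp.mem_support_iff] at hq ⊢
          intro hfq
          apply hq
          by_cases hr : R p q <;> simp [coordProj_apply_pos, coordProj_apply_neg, hr, hfq]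
        · have : p ∈ (f - coordProj k (R p) f).support := e ▸ Finsupp.mem_support_iff.2 hp
          rw [Finsupp.mem_support_iff] at this
          exact this (by simp [coordProj_apply_pos (R.refl p)])
      · rw [map_sub]
        refine W.sub_mem (h q) ?_
        by_cases hr : R q p
        · rw [coordProj_eq_self fun t ht => R.trans hr (coordProj_apply_ne_zero ht).1]
          exact h p
        · rw [coordProj_eq_zero fun t ht hqt =>
            hr (R.trans hqt (R.symm (coordProj_apply_ne_zero ht).1))]
          exact W.zero_mem
    simpa using W.add_mem hsub (h p)

end Homogeneous

/-! ### Unipotent maps and homogeneous subspaces -/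

section Unipotent

variable {k : Type*} [Field k] {X : Type*}

/-- Reduces questions on the support of an image to images of basis elements; all later support
arguments go through it. -/
theorem exists_of_map_apply_ne_zero {Y : Type*} (D : (X →₀ k) →ₗ[k] (Y →₀ k)) {f : X →₀ k} {q : Y}
    (h : D f q ≠ 0) : ∃ p, f p ≠ 0 ∧ D (Finsupp.single p 1) q ≠ 0 := by
  by_contra! hc
  apply h
  conv_lhs => rw [← Finsupp.sum_single f]
  rw [map_finsuppSum, Finsupp.sum, Finsupp.finsetSum_apply]
  refine Finset.sum_eq_zero fun p hp => ?_
  have : Finsupp.single p (f p) = f p • Finsupp.single p (1 : k) := by simp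
  rw [this, map_smul, Finsupp.smul_apply, hc p (Finsupp.mem_support_iff.1 hp), smul_zero]

/-- A linear map that moves each basis element within its class commutes with the projections onto
the classes. -/
theorem map_coordProj_of_diagonal (R : Setoid X) (D : (X →₀ k) →ₗ[k] (X →₀ k))
    (hD : ∀ p q, D (Finsupp.single p 1) q ≠ 0 → R p q) (p : X) (f : X →₀ k) :
    D (coordProj k (R p) f) = coordProj k (R p) (D f) := by
  have : f = coordProj k (R p) f + (f - coordProj k (R p) f) := by abel
  conv_rhs => rw [this, map_add, map_add]
  have h₁ : coordProj k (R p) (D (coordProj k (R p) f)) = D (coordProj k (R p) f) := by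
    refine coordProj_eq_self fun q hq => ?_
    obtain ⟨t, ht, htq⟩ := exists_of_map_apply_ne_zero D hq
    exact R.trans (coordProj_apply_ne_zero ht).1 (hD t q htq)
  have h₂ : coordProj k (R p) (D (f - coordProj k (R p) f)) = 0 := by
    refine coordProj_eq_zero fun q hq hpq => ?_
    obtain ⟨t, ht, htq⟩ := exists_of_map_apply_ne_zero D hq
    have hpt : R p t := R.trans hpq (R.symm (hD t q htq))
    exact ht (by simp [coordProj_apply_pos hpt])
  rw [h₁, h₂, add_zero]

/-- If a linear map moves each basis element out of its class, the class component of the image of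
an element of that class vanishes. -/
theorem coordProj_map_of_offDiagonal (R : Setoid X) (D : (X →₀ k) →ₗ[k] (X →₀ k))
    (hD : ∀ p q, D (Finsupp.single p 1) q ≠ 0 → ¬ R p q) (p : X) (f : X →₀ k)
    (hf : ∀ q, f q ≠ 0 → R p q) : coordProj k (R p) (D f) = 0 := by
  refine coordProj_eq_zero fun q hq hpq => ?_
  obtain ⟨t, ht, htq⟩ := exists_of_map_apply_ne_zero D hq
  exact hD t q htq (R.trans (R.symm (hf t ht)) hpq)

/-- Two subspaces, each homogeneous for an equivalence relation on the basis, are equal if one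
is mapped onto the other by a unipotent map whose logarithm `D` raises a degree function on
the basis and moves every basis element out of its classes. -/
theorem eq_of_unipotent_of_homogeneous (l : X → ℕ) (B : ℕ) (hB : ∀ p, l p < B)
    (D g g' r r' : (X →₀ k) →ₗ[k] (X →₀ k))
    (hD : ∀ p q, D (Finsupp.single p 1) q ≠ 0 → l p < l q)
    (R₁ R₂ : Setoid X) (hR₁ : ∀ p q, D (Finsupp.single p 1) q ≠ 0 → ¬ R₁ p q)
    (hR₂ : ∀ p q, D (Finsupp.single p 1) q ≠ 0 → ¬ R₂ p q)
    (hr : ∀ W : Submodule k (X →₀ k), (∀ f ∈ W, D f ∈ W) → ∀ f ∈ W, r f ∈ W)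
    (hr' : ∀ W : Submodule k (X →₀ k), (∀ f ∈ W, D f ∈ W) → ∀ f ∈ W, r' f ∈ W)
    (hg : ∀ f, g f = f + D f + r (D (D f))) (hg' : ∀ f, g' f = f - D f + r' (D (D f)))
    (hgg' : ∀ f, g (g' f) = f)
    (I₁ I₂ : Submodule k (X →₀ k))
    (hI₁ : ∀ f ∈ I₁, ∀ p, coordProj k (R₁ p) f ∈ I₁)
    (hI₂ : ∀ f ∈ I₂, ∀ p, coordProj k (R₂ p) f ∈ I₂)
    (hI : ∀ f, f ∈ I₁ ↔ g f ∈ I₂) : I₁ = I₂ := by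
  classical
  -- The filtration by degree: `D` maps each step into the next, and the step `B` is zero.
  let L : ℕ → Submodule k (X →₀ k) := fun m => Finsupp.supported k k {p | m ≤ l p}
  have hL : ∀ m f, f ∈ L m ↔ ∀ p, f p ≠ 0 → m ≤ l p := fun m f => by
    simp only [L, Finsupp.mem_supported, Set.subset_def, Finset.mem_coe, Finsupp.mem_support_iff,
      Set.mem_ofPred_eq]
  have hLD : ∀ m f, f ∈ L m → D f ∈ L (m + 1) := fun m f hf => by
    rw [hL] at hf ⊢
    intro q hq
    obtain ⟨t, ht, htq⟩ := exists_of_map_apply_ne_zero D hq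
    exact lt_of_le_of_lt (hf t ht) (hD t q htq)
  have hLanti : ∀ m f, f ∈ L (m + 1) → f ∈ L m := fun m f hf => by
    rw [hL] at hf ⊢
    exact fun p hp => Nat.le_of_succ_le (hf p hp)
  have hLproj : ∀ m f (s : X → Prop), f ∈ L m → coordProj k s f ∈ L m := fun m f s hf => by
    rw [hL] at hf ⊢
    exact fun p hp => hf p (coordProj_apply_ne_zero hp).2
  have hLtop : ∀ m, B ≤ m → ∀ f ∈ L m, f = 0 := fun m hm f hf => by
    rw [hL] at hf
    ext p
    exact by_contra fun h => absurd (hf p h) (not_le.2 (lt_of_lt_of_le (hB p) hm))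
  have hLbot : ∀ f, f ∈ L 0 := fun f => (hL 0 f).2 fun p _ => Nat.zero_le _
  -- Descending induction on the degree. Stability of `I₁` under `D` is carried along, since it
  -- makes the part already treated stable under `D`.
  suffices H : ∀ n m, m + n = B →
      (∀ f ∈ L m, f ∈ I₁ ↔ f ∈ I₂) ∧ ∀ f ∈ L m, f ∈ I₁ → D f ∈ I₁ by
    ext f
    exact (H B 0 (by simp)).1 f (hLbot f)
  intro n
  induction n with
  | zero =>
    intro m hm
    refine ⟨fun f hf => ?_, fun f hf _ => ?_⟩
    · rw [hLtop m (by omega) f hf]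
      simp
    · rw [hLtop m (by omega) f hf, map_zero]
      exact I₁.zero_mem
  | succ n ih =>
    intro m hm
    obtain ⟨ih₁, ih₂⟩ := ih (m + 1) (by omega)
    -- By induction `M` is also contained in `I₂`, so it is stable under `D` and under both families
    -- of class projections.
    let M : Submodule k (X →₀ k) := I₁ ⊓ L (m + 1)
    have hM₂ : ∀ f ∈ M, f ∈ I₂ := fun f hf => (ih₁ f hf.2).1 hf.1
    have hMD : ∀ f ∈ M, D f ∈ M := fun f hf => ⟨ih₂ f hf.2 hf.1, hLanti _ _ (hLD _ _ hf.2)⟩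
    have hMP : ∀ f ∈ M, ∀ p, coordProj k (R₁ p) f ∈ M := fun f hf p =>
      ⟨hI₁ f hf.1 p, hLproj _ _ _ hf.2⟩
    have hMc : ∀ f ∈ M, ∀ p, coordProj k (R₂ p) f ∈ M := fun f hf p =>
      have h := hLproj _ _ (R₂ p) hf.2
      ⟨(ih₁ _ h).2 (hI₂ f (hM₂ f hf) p), h⟩
    -- the filtration `M + L s`
    let W : ℕ → Submodule k (X →₀ k) := fun s => M ⊔ L s
    have hWD : ∀ s, ∀ f ∈ W s, D f ∈ W (s + 1) := fun s f hf => by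
      obtain ⟨a, ha, b, hb, rfl⟩ := Submodule.mem_sup.1 hf
      rw [map_add]
      exact Submodule.add_mem_sup (hMD a ha) (hLD s b hb)
    have hWanti : ∀ s, ∀ f ∈ W (s + 1), f ∈ W s := fun s f hf => by
      obtain ⟨a, ha, b, hb, rfl⟩ := Submodule.mem_sup.1 hf
      exact Submodule.add_mem_sup ha (hLanti s b hb)
    -- The remainders `r` and `r'` enter only through the subspaces they preserve: any subspace
    -- stable under `D`, such as `W s`.
    have hWr : ∀ s, ∀ f ∈ W s, r f ∈ W s := fun s => hr _ fun f hf => hWanti s _ (hWD s f hf)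
    have hWr' : ∀ s, ∀ f ∈ W s, r' f ∈ W s := fun s => hr' _ fun f hf => hWanti s _ (hWD s f hf)
    have hWP : ∀ s, ∀ f ∈ W s, ∀ p, coordProj k (R₁ p) f ∈ W s := fun s f hf p => by
      obtain ⟨a, ha, b, hb, rfl⟩ := Submodule.mem_sup.1 hf
      rw [map_add]
      exact Submodule.add_mem_sup (hMP a ha p) (hLproj s b _ hb)
    have hWc : ∀ s, ∀ f ∈ W s, ∀ p, coordProj k (R₂ p) f ∈ W s := fun s f hf p => by
      obtain ⟨a, ha, b, hb, rfl⟩ := Submodule.mem_sup.1 hf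
      rw [map_add]
      exact Submodule.add_mem_sup (hMc a ha p) (hLproj s b _ hb)
    -- the expansion of the conjugate of a projection, to first order
    have hexp : ∀ s f p, D f ∈ W s → D (coordProj k (R₂ p) f) ∈ W s →
        g' (coordProj k (R₂ p) (g f)) - (coordProj k (R₂ p) f + coordProj k (R₂ p) (D f)
          - D (coordProj k (R₂ p) f)) ∈ W (s + 1) := fun s f p h h' => by
      have e₁ : r (D (D f)) ∈ W (s + 1) := hWr _ _ (hWD _ _ h)
      have e₂ := hWc _ _ e₁ p
      have e₃ := hWD _ _ (hWc _ _ h p)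
      have e₄ := hWanti _ _ (hWD _ _ e₂)
      have key : D (coordProj k (R₂ p) (g f)) - D (coordProj k (R₂ p) f) ∈ W (s + 1) := by
        rw [hg]
        simp only [map_add]
        convert (W (s + 1)).add_mem e₃ e₄ using 1
        abel
      have key' : D (coordProj k (R₂ p) (g f)) ∈ W s := by
        simpa using (W s).add_mem (hWanti _ _ key) h'
      have e₅ : r' (D (D (coordProj k (R₂ p) (g f)))) ∈ W (s + 1) := hWr' _ _ (hWD _ _ key')
      have e₆ : g' (coordProj k (R₂ p) (g f)) - (coordProj k (R₂ p) f + coordProj k (R₂ p) (D f)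
          - D (coordProj k (R₂ p) f)) = coordProj k (R₂ p) (r (D (D f)))
          - (D (coordProj k (R₂ p) (g f)) - D (coordProj k (R₂ p) f))
          + r' (D (D (coordProj k (R₂ p) (g f)))) := by
        have : coordProj k (R₂ p) (g f) = coordProj k (R₂ p) f + coordProj k (R₂ p) (D f)
            + coordProj k (R₂ p) (r (D (D f))) := by
          rw [hg, map_add, map_add]
        rw [hg' (coordProj k (R₂ p) (g f))]
        conv_lhs => enter [1, 1, 1]; rw [this]
        abel
      rw [e₆]
      exact (W (s + 1)).add_mem ((W (s + 1)).sub_mem e₂ key) e₅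
    -- the derivative of a class component
    have hmain : ∀ f ∈ L m, f ∈ I₁ → ∀ p, (∀ q, f q ≠ 0 → R₁ p q) → D f ∈ M := by
      intro f hfL hfI p hfp
      have hgI : g f ∈ I₂ := (hI f).1 hfI
      have hPf : coordProj k (R₁ p) f = f := coordProj_eq_self hfp
      have hPD : coordProj k (R₁ p) (D f) = 0 := coordProj_map_of_offDiagonal R₁ D hR₁ p f hfp
      have hPc : ∀ c, coordProj k (R₁ p) (coordProj k (R₂ c) f) = coordProj k (R₂ c) f := fun c => by
        rw [coordProj_comm, hPf]
      have hPDc : ∀ c, coordProj k (R₁ p) (D (coordProj k (R₂ c) f)) = 0 := fun c =>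
        coordProj_map_of_offDiagonal R₁ D hR₁ p _ fun q hq => hfp q (coordProj_apply_ne_zero hq).2
      -- A projection onto an `R₂`-class preserves `I₂`, so its conjugate by `g` preserves `I₁`.
      have hzI : ∀ c, g' (coordProj k (R₂ c) (g f)) ∈ I₁ := fun c => by
        rw [hI, hgg']
        exact hI₂ _ hgI c
      -- To first order the conjugate is the projection plus its commutator with `D`. Removing the
      -- `R₁`-class of `p` kills the zeroth-order term, as `f` lies in that class, and leaves the
      -- commutator unchanged, as `D` leaves the class.
      have hzW : ∀ s, D f ∈ W s → (∀ c, D (coordProj k (R₂ c) f) ∈ W s) → ∀ c,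
          (g' (coordProj k (R₂ c) (g f)) - coordProj k (R₁ p) (g' (coordProj k (R₂ c) (g f))))
            - (coordProj k (R₂ c) (D f) - D (coordProj k (R₂ c) f)) ∈ W (s + 1) := by
        intro s h h' c
        have h₁ := hexp s f c h (h' c)
        have h₂ := (W (s + 1)).sub_mem h₁ (hWP _ _ h₁ p)
        convert h₂ using 1
        simp only [map_sub, map_add, hPc, hPDc]
        rw [coordProj_comm, hPD, map_zero]
        abel
      -- Membership in `I₁` is homogeneity; membership in `L (m + 1)` holds because only the
      -- commutator and higher terms remain.
      have hz : ∀ c, g' (coordProj k (R₂ c) (g f))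
          - coordProj k (R₁ p) (g' (coordProj k (R₂ c) (g f))) ∈ M := by
        intro c
        refine ⟨I₁.sub_mem (hzI c) (hI₁ _ (hzI c) p), ?_⟩
        have h₁ : D f ∈ W (m + 1) := Submodule.mem_sup_right (hLD m f hfL)
        have h₂ : ∀ c, D (coordProj k (R₂ c) f) ∈ W (m + 1) := fun c =>
          Submodule.mem_sup_right (hLD m _ (hLproj m f _ hfL))
        have h₃ := (W (m + 1)).add_mem (hWanti _ _ (hzW (m + 1) h₁ h₂ c))
          ((W (m + 1)).sub_mem (hWc _ _ h₁ c) (h₂ c))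
        rw [sub_add_cancel] at h₃
        exact (sup_le inf_le_right le_rfl : W (m + 1) ≤ L (m + 1)) h₃
      -- Bootstrapping: if `D f` and all `D` of its `R₂`-components are known modulo degree `s` to
      -- lie in `M`, the commutators are known one degree further.
      have hall : ∀ s, D f ∈ W s ∧ ∀ c, D (coordProj k (R₂ c) f) ∈ W s := by
        intro s
        induction s with
        | zero => exact ⟨Submodule.mem_sup_right (hLbot _), fun c => Submodule.mem_sup_right (hLbot _)⟩
        | succ s ihs =>
          have h₁ : ∀ c, coordProj k (R₂ c) (D f) - D (coordProj k (R₂ c) f) ∈ W (s + 1) := fun c => by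
            have := (W (s + 1)).sub_mem (Submodule.mem_sup_left (hz c)) (hzW s ihs.1 ihs.2 c)
            rwa [sub_sub_cancel] at this
          -- Projecting the commutator onto the same `R₂`-class kills its second term, since `D`
          -- moves elements out of that class.
          have h₂ : ∀ c, coordProj k (R₂ c) (D f) ∈ W (s + 1) := fun c => by
            have := hWc _ _ (h₁ c) c
            rw [map_sub, coordProj_map_of_offDiagonal R₂ D hR₂ c (coordProj k (R₂ c) f)
              (fun q hq => (coordProj_apply_ne_zero hq).1), sub_zero] at this
            rwa [coordProj_eq_self fun q hq => (coordProj_apply_ne_zero hq).1] at this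
          refine ⟨mem_of_coordProj_mem R₂ _ _ h₂, fun c => ?_⟩
          have := (W (s + 1)).sub_mem (h₂ c) (h₁ c)
          rwa [sub_sub_cancel] at this
      -- At `s = B` the error term vanishes, so `D f` lies in `M` exactly.
      obtain ⟨a, ha, b, hb, hab⟩ := Submodule.mem_sup.1 (hall B).1
      rw [hLtop B le_rfl b hb, add_zero] at hab
      exact hab ▸ ha
    have hDM : ∀ f ∈ L m, f ∈ I₁ → D f ∈ M := fun f hf hfI => by
      have : f ∈ M.comap D := mem_of_coordProj_mem R₁ _ _ fun p =>
        hmain _ (hLproj m f _ hf) (hI₁ f hfI p) p fun q hq => (coordProj_apply_ne_zero hq).1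
      exact this
    have hgM : ∀ f ∈ L m, f ∈ I₁ → g f - f ∈ M := fun f hf hfI => by
      have h := hDM f hf hfI
      rw [hg, add_assoc, add_sub_cancel_left]
      exact M.add_mem h (hr M hMD _ (hMD _ h))
    refine ⟨fun f hf => ⟨fun hfI => ?_, fun hfI => ?_⟩, fun f hf hfI => (hDM f hf hfI).1⟩
    · have := I₂.sub_mem ((hI f).1 hfI) (hM₂ _ (hgM f hf hfI))
      rwa [sub_sub_cancel] at this
    -- The converse applies the estimate for `g - 1` to the preimage `g' f`, which is in `I₁` and in
    -- the same degree.
    · have h₁ : g' f ∈ I₁ := by rw [hI, hgg']; exact hfI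
      have h₂ : g' f ∈ L m := by
        rw [hg']
        refine (L m).add_mem ((L m).sub_mem hf (hLanti _ _ (hLD _ _ hf))) ?_
        exact hr' _ (fun z hz => hLanti _ _ (hLD _ _ hz)) _
          (hLanti _ _ (hLD _ _ (hLanti _ _ (hLD _ _ hf))))
      have h₃ := I₁.add_mem (hgM _ h₂ h₁).1 h₁
      rwa [hgg', sub_add_cancel] at h₃

end Unipotent

/-! ### Substitutions and derivations of the path category -/

section Substitution

variable {k : Type w} [Field k] {V : Type u} [Quiver.{v} V]

theorem exists_of_pathMul_apply_ne_zero {x y z : V} {f : PathSpace k x y} {g : PathSpace k y z}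
    {q : Quiver.Path x z} (h : pathMul k x y z f g q ≠ 0) :
    ∃ p₁ p₂, f p₁ ≠ 0 ∧ g p₂ ≠ 0 ∧ q = p₁.comp p₂ := by
  classical
  obtain ⟨p₁, h₁, h₂⟩ := exists_of_map_apply_ne_zero ((pathMul k x y z).flip g) h
  obtain ⟨p₂, h₃, h₄⟩ := exists_of_map_apply_ne_zero (pathMul k x y z (Finsupp.single p₁ 1)) h₂
  rw [pathMul_single_single, Finsupp.single_apply] at h₄
  exact ⟨p₁, p₂, h₁, h₃, by_contra fun h => h₄ (if_neg fun e => h e.symm)⟩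

/-- The image of a path under the substitution of `s a` for each arrow `a`. -/
def substPath (s : ∀ ⦃x y : V⦄, (x ⟶ y) → PathSpace k x y) {x : V} :
    ∀ {y : V}, Quiver.Path x y → PathSpace k x y
  | _, .nil => Finsupp.single Quiver.Path.nil 1
  | _, .cons p a => pathMul k _ _ _ (substPath s p) (s a)

/-- The endomorphism of the path category that maps each arrow `a` to `s a`. -/
def subst (s : ∀ ⦃x y : V⦄, (x ⟶ y) → PathSpace k x y) (x y : V) :
    PathSpace k x y →ₗ[k] PathSpace k x y :=
  Finsupp.linearCombination k (substPath s)

variable (s s' : ∀ ⦃x y : V⦄, (x ⟶ y) → PathSpace k x y)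

theorem subst_single {x y : V} (p : Quiver.Path x y) :
    subst s x y (Finsupp.single p 1) = substPath s p := by
  simp [subst]

theorem single_cons {x y z : V} (p : Quiver.Path x y) (a : y ⟶ z) :
    (Finsupp.single (p.cons a) 1 : PathSpace k x z) =
      pathMul k x y z (Finsupp.single p 1) (Finsupp.single a.toPath 1) := by
  rw [pathMul_single_single, mul_one]
  rfl

theorem substPath_comp {x y z : V} (p : Quiver.Path x y) (q : Quiver.Path y z) :
    substPath s (p.comp q) = pathMul k x y z (substPath s p) (substPath s q) := by
  induction q with
  | nil => exact (pathMul_nil k _).symm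
  | cons q a ih => rw [Quiver.Path.comp_cons, substPath, substPath, ih, pathMul_assoc]

theorem subst_pathMul {x y z : V} (f : PathSpace k x y) (g : PathSpace k y z) :
    subst s x z (pathMul k x y z f g) = pathMul k x y z (subst s x y f) (subst s y z g) := by
  induction f using Finsupp.induction_linear with
  | zero => simp
  | add f₁ f₂ h₁ h₂ => simp only [map_add, LinearMap.add_apply, h₁, h₂]
  | single p a =>
    induction g using Finsupp.induction_linear with
    | zero => simp
    | add f₁ f₂ h₁ h₂ => simp only [map_add, h₁, h₂]
    | single q b =>
      simp only [pathMul_single_single, subst, Finsupp.linearCombination_single, substPath_comp,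
        map_smul, LinearMap.smul_apply, smul_smul, mul_comm]

theorem subst_nil (x : V) : subst s x x (Finsupp.single Quiver.Path.nil 1) =
    Finsupp.single Quiver.Path.nil 1 := subst_single s _

theorem subst_toPath {x y : V} (a : x ⟶ y) : subst s x y (Finsupp.single a.toPath 1) = s a := by
  rw [subst_single]
  exact nil_pathMul k _

/-- Endomorphisms of the path category that agree on the arrows are equal. -/
theorem pathSpace_map_ext {φ ψ : ∀ x y : V, PathSpace k x y →ₗ[k] PathSpace k x y}
    (hφn : ∀ x, φ x x (Finsupp.single Quiver.Path.nil 1) = Finsupp.single Quiver.Path.nil 1)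
    (hψn : ∀ x, ψ x x (Finsupp.single Quiver.Path.nil 1) = Finsupp.single Quiver.Path.nil 1)
    (hφ : ∀ {x y z : V} (f : PathSpace k x y) (g : PathSpace k y z),
      φ x z (pathMul k x y z f g) = pathMul k x y z (φ x y f) (φ y z g))
    (hψ : ∀ {x y z : V} (f : PathSpace k x y) (g : PathSpace k y z),
      ψ x z (pathMul k x y z f g) = pathMul k x y z (ψ x y f) (ψ y z g))
    (h : ∀ {x y : V} (a : x ⟶ y), φ x y (Finsupp.single a.toPath 1) =
      ψ x y (Finsupp.single a.toPath 1)) (x y : V) : φ x y = ψ x y := by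
  refine Finsupp.lhom_ext' fun p => LinearMap.ext_ring ?_
  simp only [LinearMap.comp_apply, Finsupp.lsingle_apply]
  induction p with
  | nil => rw [hφn, hψn]
  | cons p a ih => rw [single_cons, hφ, hψ, ih, h]

theorem subst_subst (x y : V) (f : PathSpace k x y) :
    subst s x y (subst s' x y f) = subst (fun _ _ a => subst s _ _ (s' a)) x y f := by
  refine LinearMap.congr_fun (pathSpace_map_ext (φ := fun x y => subst s x y ∘ₗ subst s' x y)
    (fun x => ?_) (subst_nil _) (fun f g => ?_) (subst_pathMul _) (fun a => ?_) x y) f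
  · simp only [LinearMap.comp_apply, subst_nil]
  · simp only [LinearMap.comp_apply, subst_pathMul]
  · simp only [LinearMap.comp_apply, subst_toPath]

theorem subst_toPath_eq_id (x y : V) (f : PathSpace k x y) :
    subst (fun _ _ a => Finsupp.single a.toPath 1) x y f = f := by
  refine LinearMap.congr_fun (pathSpace_map_ext (ψ := fun x y => LinearMap.id)
    (subst_nil _) (fun _ => rfl) (subst_pathMul _) (fun _ _ => rfl) (fun a => ?_) x y) f
  exact subst_toPath _ a

/-- The dilatation that multiplies each arrow `x ⟶ y` by `t x y`. -/
def dilatation (t : V → V → k) : ∀ x y : V, PathSpace k x y →ₗ[k] PathSpace k x y :=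
  subst fun x y a => t x y • Finsupp.single a.toPath 1

theorem dilatation_inv (t : V → V → k) (ht : ∀ x y, t x y ≠ 0) (x y : V) (f : PathSpace k x y) :
    dilatation t x y (dilatation (fun x y => (t x y)⁻¹) x y f) = f := by
  rw [dilatation, dilatation, subst_subst]
  conv_rhs => rw [← subst_toPath_eq_id x y f]
  congr 2
  funext x y a
  rw [map_smul, subst_toPath, smul_smul, inv_mul_cancel₀ (ht x y), one_smul]

/-- A family of elements of the path spaces that are combinations of paths of length at least
two. -/
def IsTail (τ : ∀ x y : V, PathSpace k x y) : Prop :=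
  ∀ x y p, τ x y p ≠ 0 → 2 ≤ p.length

variable {τ σ : ∀ x y : V, PathSpace k x y}

theorem IsTail.zero : IsTail (fun x y : V => (0 : PathSpace k x y)) := fun _ _ _ h => (h rfl).elim

theorem IsTail.add (hτ : IsTail τ) (hσ : IsTail σ) : IsTail (τ + σ) := fun x y p h => by
  by_cases h₁ : τ x y p = 0
  · refine hσ x y p fun h₂ => h ?_
    rw [Pi.add_apply, Pi.add_apply, Finsupp.add_apply, h₁, h₂, add_zero]
  · exact hτ x y p h₁

theorem IsTail.neg (hτ : IsTail τ) : IsTail (-τ) := fun x y p h =>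
  hτ x y p fun h₀ => h (by rw [Pi.neg_apply, Pi.neg_apply, Finsupp.neg_apply, h₀, neg_zero])

/-- The endomorphism of the path category that maps each arrow `a : x ⟶ y` to `a + τ x y`. -/
def unipotent (τ : ∀ x y : V, PathSpace k x y) : ∀ x y : V, PathSpace k x y →ₗ[k] PathSpace k x y :=
  subst fun x y a => Finsupp.single a.toPath 1 + τ x y

theorem unipotent_toPath {x y : V} (a : x ⟶ y) :
    unipotent τ x y (Finsupp.single a.toPath 1) = Finsupp.single a.toPath 1 + τ x y :=
  subst_toPath _ a

theorem unipotent_zero (x y : V) (f : PathSpace k x y) : unipotent 0 x y f = f := by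
  conv_rhs => rw [← subst_toPath_eq_id x y f]
  rw [unipotent]
  congr 2
  funext x y a
  exact add_zero _

/-- The value at a path of the derivation that maps each arrow `x ⟶ y` to `τ x y`. -/
def derivPath (τ : ∀ x y : V, PathSpace k x y) {x : V} :
    ∀ {y : V}, Quiver.Path x y → PathSpace k x y
  | _, .nil => 0
  | _, .cons (b := y) (c := z) p a =>
    pathMul k x y z (derivPath τ p) (Finsupp.single a.toPath 1) +
      pathMul k x y z (Finsupp.single p 1) (τ y z)

/-- The derivation of the path category that maps each arrow `x ⟶ y` to `τ x y`. -/
def pathDeriv (τ : ∀ x y : V, PathSpace k x y) (x y : V) : PathSpace k x y →ₗ[k] PathSpace k x y :=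
  Finsupp.linearCombination k (derivPath τ)

theorem pathDeriv_single {x y : V} (p : Quiver.Path x y) :
    pathDeriv τ x y (Finsupp.single p 1) = derivPath τ p := by
  simp [pathDeriv]

theorem derivPath_comp {x y z : V} (p : Quiver.Path x y) (q : Quiver.Path y z) :
    derivPath τ (p.comp q) = pathMul k x y z (derivPath τ p) (Finsupp.single q 1) +
      pathMul k x y z (Finsupp.single p 1) (derivPath τ q) := by
  induction q with
  | nil =>
    rw [Quiver.Path.comp_nil, pathMul_nil, derivPath, map_zero, add_zero]
  | cons q a ih =>
    rw [Quiver.Path.comp_cons, derivPath, ih, derivPath, map_add, map_add, LinearMap.add_apply,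
      pathMul_assoc, ← single_cons, pathMul_assoc, add_assoc, ← pathMul_assoc _ _ _ (τ _ _),
      pathMul_single_single, mul_one]

theorem pathDeriv_pathMul {x y z : V} (f : PathSpace k x y) (g : PathSpace k y z) :
    pathDeriv τ x z (pathMul k x y z f g) =
      pathMul k x y z (pathDeriv τ x y f) g + pathMul k x y z f (pathDeriv τ y z g) := by
  induction f using Finsupp.induction_linear with
  | zero => simp
  | add f₁ f₂ h₁ h₂ => simp only [map_add, LinearMap.add_apply, h₁, h₂]; abel
  | single p a =>
    induction g using Finsupp.induction_linear with
    | zero => simp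
    | add f₁ f₂ h₁ h₂ => simp only [map_add, h₁, h₂]; abel
    | single q b =>
      rw [← mul_one a, ← mul_one b, ← smul_eq_mul, ← smul_eq_mul, ← Finsupp.smul_single,
        ← Finsupp.smul_single]
      simp only [map_smul, LinearMap.smul_apply, pathDeriv_single, pathMul_single_single, mul_one,
        derivPath_comp, smul_add]

theorem pathDeriv_toPath {x y : V} (a : x ⟶ y) :
    pathDeriv τ x y (Finsupp.single a.toPath 1) = τ x y := by
  rw [pathDeriv_single]
  change pathMul k x x y 0 _ + pathMul k x x y (Finsupp.single Quiver.Path.nil 1) (τ x y) = _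
  rw [nil_pathMul, map_zero, LinearMap.zero_apply, zero_add]

theorem pathDeriv_neg (x y : V) : pathDeriv (-τ) x y = -pathDeriv τ x y := by
  refine Finsupp.lhom_ext' fun p => LinearMap.ext_ring ?_
  simp only [LinearMap.comp_apply, Finsupp.lsingle_apply, LinearMap.neg_apply, pathDeriv_single]
  induction p with
  | nil => exact neg_zero.symm
  | cons p a ih =>
    rw [derivPath, derivPath, ih, Pi.neg_apply, Pi.neg_apply, map_neg, map_neg,
      LinearMap.neg_apply, neg_add]

/-! ### The effect of the absence of double bypasses -/

/-- Both maps see a path only through the tails of its arrows; the bypass condition will supply the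
vanishing of those tails. -/
theorem unipotent_single_of_vanish {x y : V} (P : Quiver.Path x y)
    (h : ∀ (z t : V) (b : z ⟶ t) (p₁ : Quiver.Path x z) (p₂ : Quiver.Path t y),
      P = (p₁.cons b).comp p₂ → σ z t = 0) :
    unipotent σ x y (Finsupp.single P 1) = Finsupp.single P 1 ∧
      pathDeriv σ x y (Finsupp.single P 1) = 0 := by
  induction P with
  | nil => exact ⟨subst_nil _ _, pathDeriv_single _⟩
  | @cons y z P b ih =>
    obtain ⟨h₁, h₂⟩ := ih fun z t c p₁ p₂ e => h z t c p₁ (p₂.cons b) (by rw [e]; rfl)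
    have h₃ : σ y z = 0 := h _ _ b P Quiver.Path.nil rfl
    constructor
    · rw [single_cons, unipotent, subst_pathMul, subst_toPath, h₃, add_zero, ← unipotent, h₁]
    · rw [single_cons, pathDeriv_pathMul, h₂, pathDeriv_toPath, h₃, map_zero, map_zero,
        LinearMap.zero_apply, add_zero]

/-- A path of `τ` parallel to `a` is a bypass of `a`. If it contained an arrow `b` with nonzero `σ`,
a term of `σ` at `b` would be a second bypass, making a double one. -/
theorem HasNoDoubleBypass.tail_fixed (hb : HasNoDoubleBypass V) (hτ : IsTail τ) (hσ : IsTail σ)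
    {x y : V} (a : x ⟶ y) : unipotent σ x y (τ x y) = τ x y ∧ pathDeriv σ x y (τ x y) = 0 := by
  have key : ∀ P : Quiver.Path x y, 2 ≤ P.length →
      unipotent σ x y (Finsupp.single P 1) = Finsupp.single P 1 ∧
        pathDeriv σ x y (Finsupp.single P 1) = 0 := by
    refine fun P hP => unipotent_single_of_vanish P fun z t b p₁ p₂ e => ?_
    ext q
    refine by_contra fun hq => hb x y z t a P b q ?_ ?_ ⟨p₁, p₂, e⟩
    · rintro rfl
      simp at hP
    · rintro rfl
      have := hσ z t _ hq
      simp at this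
  have hsum : τ x y = ∑ p ∈ (τ x y).support, τ x y p • Finsupp.single p 1 := by
    conv_lhs => rw [← Finsupp.sum_single (τ x y)]
    exact Finset.sum_congr rfl fun p _ => by simp
  have hlen : ∀ p ∈ (τ x y).support, 2 ≤ p.length := fun p hp =>
    hτ x y p (Finsupp.mem_support_iff.1 hp)
  constructor
  · conv_lhs => rw [hsum]
    rw [map_sum]
    conv_rhs => rw [hsum]
    exact Finset.sum_congr rfl fun p hp => by rw [map_smul, (key p (hlen p hp)).1]
  · rw [hsum, map_sum]
    exact Finset.sum_eq_zero fun p hp => by rw [map_smul, (key p (hlen p hp)).2, smul_zero]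

/-- The outer substitution fixes the tail added by the inner one, so the two tails simply add up. In
particular these endomorphisms commute, and negating the tail inverts them. -/
theorem HasNoDoubleBypass.unipotent_add (hb : HasNoDoubleBypass V) (hτ : IsTail τ) (hσ : IsTail σ)
    (x y : V) (f : PathSpace k x y) :
    unipotent (σ + τ) x y f = unipotent σ x y (unipotent τ x y f) := by
  conv_rhs => rw [unipotent, unipotent, subst_subst]
  rw [unipotent]
  congr 2
  funext x y a
  have := (hb.tail_fixed hτ hσ a).1
  rw [unipotent] at this
  rw [map_add, this, subst_toPath, add_assoc]
  rfl

theorem HasNoDoubleBypass.unipotent_neg_self (hb : HasNoDoubleBypass V) (hτ : IsTail τ)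
    (x y : V) (f : PathSpace k x y) : unipotent (-τ) x y (unipotent τ x y f) = f := by
  rw [← hb.unipotent_add hτ hτ.neg, neg_add_cancel, unipotent_zero]

theorem HasNoDoubleBypass.unipotent_self_neg (hb : HasNoDoubleBypass V) (hτ : IsTail τ)
    (x y : V) (f : PathSpace k x y) : unipotent τ x y (unipotent (-τ) x y f) = f := by
  rw [← hb.unipotent_add hτ.neg hτ, add_neg_cancel, unipotent_zero]

/-- A unipotent endomorphism is the exponential of the corresponding derivation. -/
theorem HasNoDoubleBypass.unipotent_eq_exp [CharZero k] (hb : HasNoDoubleBypass V)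
    (hτ : IsTail τ) {x y : V} (p : Quiver.Path x y) (n : ℕ) (hn : p.length ≤ n) :
    unipotent τ x y (Finsupp.single p 1) =
      ∑ j ∈ Finset.range (n + 1), ((j.factorial : k)⁻¹) •
        (pathDeriv τ x y ^ j) (Finsupp.single p 1) := by
  induction p generalizing n with
  | nil =>
    rw [Finset.sum_range_succ', Finset.sum_eq_zero]
    · simp [unipotent, subst_nil]
    · intro j _
      rw [pow_succ, Module.End.mul_apply, pathDeriv_single, derivPath, map_zero, smul_zero]
  | @cons y z p a ih =>
    obtain ⟨m, rfl⟩ : ∃ m, n = m + 1 := ⟨n - 1, by rw [Quiver.Path.length_cons] at hn; omega⟩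
    rw [Quiver.Path.length_cons] at hn
    -- In the Leibniz expansion the last arrow is differentiated at most once, because the
    -- derivation kills its tail. The factor `j + 1` counts the positions of that differentiation.
    have hpow : ∀ j, (pathDeriv τ x z ^ (j + 1)) (Finsupp.single (p.cons a) 1) =
        pathMul k x y z ((pathDeriv τ x y ^ (j + 1)) (Finsupp.single p 1))
          (Finsupp.single a.toPath 1) +
        ((j + 1 : ℕ) : k) • pathMul k x y z ((pathDeriv τ x y ^ j) (Finsupp.single p 1)) (τ y z) := by
      intro j
      induction j with
      | zero =>
        rw [zero_add, pow_one, pow_one, pow_zero, single_cons, pathDeriv_pathMul, pathDeriv_toPath,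
          Module.End.one_apply, Nat.cast_one, one_smul]
      | succ j ihj =>
        rw [pow_succ', Module.End.mul_apply, ihj, map_add, map_smul, pathDeriv_pathMul,
          pathDeriv_pathMul, pathDeriv_toPath, (hb.tail_fixed hτ hτ a).2, map_zero, add_zero,
          ← Module.End.mul_apply, ← Module.End.mul_apply, ← pow_succ', ← pow_succ', add_assoc]
        congr 1
        rw [Nat.cast_succ (j + 1), add_smul, one_smul, add_comm]
    -- Characteristic zero lets `j + 1` cancel against the factorial, so the second part of the sum
    -- is again an exponential series.
    have hfact : ∀ j : ℕ, (((j + 1).factorial : k)⁻¹) * ((j + 1 : ℕ) : k) = (j.factorial : k)⁻¹ := by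
      intro j
      rw [Nat.factorial_succ, Nat.cast_mul, mul_inv_rev, mul_assoc,
        inv_mul_cancel₀ (Nat.cast_ne_zero.2 (Nat.succ_ne_zero j)), mul_one]
    have h₁ := ih (m + 1) (by omega)
    have h₂ := ih m (by omega)
    rw [Finset.sum_range_succ', pow_zero, Module.End.one_apply]
    simp only [hpow, smul_add, smul_smul, hfact]
    rw [Finset.sum_add_distrib, single_cons]
    have e₁ : unipotent τ x z (pathMul k x y z (Finsupp.single p 1) (Finsupp.single a.toPath 1)) =
        pathMul k x y z (unipotent τ x y (Finsupp.single p 1)) (Finsupp.single a.toPath 1) +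
          pathMul k x y z (unipotent τ x y (Finsupp.single p 1)) (τ y z) := by
      rw [unipotent, subst_pathMul, subst_toPath, map_add]
    rw [e₁]
    conv_lhs => enter [1]; rw [h₁, Finset.sum_range_succ']
    conv_lhs => enter [2]; rw [h₂]
    simp only [map_add, map_sum, map_smul, LinearMap.add_apply, LinearMap.sum_apply,
      LinearMap.smul_apply, pow_zero, Module.End.one_apply]
    abel

/-- The derivation replaces one arrow by a path of length at least two. -/
theorem length_lt_of_derivPath_ne_zero (hτ : IsTail τ) {x y : V} (p q : Quiver.Path x y)
    (h : derivPath τ p q ≠ 0) : p.length < q.length := by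
  induction p with
  | nil => exact (h rfl).elim
  | @cons y z p a ih =>
    rw [derivPath, Finsupp.add_apply] at h
    by_cases h₁ : pathMul k x y z (derivPath τ p) (Finsupp.single a.toPath 1) q = 0
    · rw [h₁, zero_add] at h
      obtain ⟨p₁, p₂, e₁, e₂, rfl⟩ := exists_of_pathMul_apply_ne_zero h
      obtain rfl : p = p₁ := by
        by_contra hne
        exact e₁ (Finsupp.single_eq_of_ne (Ne.symm hne))
      have := hτ _ _ _ e₂
      rw [Quiver.Path.length_cons, Quiver.Path.length_comp]
      omega
    · obtain ⟨p₁, p₂, e₁, e₂, rfl⟩ := exists_of_pathMul_apply_ne_zero h₁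
      obtain rfl : a.toPath = p₂ := by
        by_contra hne
        exact e₂ (Finsupp.single_eq_of_ne (Ne.symm hne))
      have := ih p₁ e₁
      rw [Quiver.Path.length_cons, Quiver.Path.length_comp, Quiver.Path.length_toPath]
      omega

end Substitution

/-! ### Homogeneity of ideals with respect to homotopy relations -/

section HomotopyHomogeneous

variable {k : Type w} [Field k] {V : Type u} [Quiver.{v} V]

theorem Walk.ofPath_comp {x y z : V} (p : Quiver.Path x y) (q : Quiver.Path y z) :
    Walk.ofPath (p.comp q) = (Walk.ofPath p).comp (Walk.ofPath q) := by
  induction q with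
  | nil => rfl
  | cons q a ih => exact congrArg (fun w => Walk.cons w a) ih

theorem PathIdeal.Homotopic.cancel_left {I : PathIdeal k V} {x y z : V} {c : Walk x y}
    {d d' : Walk y z} (h : I.Homotopic (c.comp d) (c.comp d')) : I.Homotopic d d' := by
  have key : ∀ d : Walk y z, I.Homotopic (c.inv.comp (c.comp d)) d := fun d => by
    have := Homotopic.comp (Homotopic.inv_comp I c) (.refl d)
    rwa [Walk.nil_comp, Walk.comp_assoc] at this
  exact .trans (.symm (key d)) (.trans (.comp (.refl _) h) (key d'))

theorem PathIdeal.Homotopic.cancel_right {I : PathIdeal k V} {x y z : V} {c c' : Walk x y}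
    {d : Walk y z} (h : I.Homotopic (c.comp d) (c'.comp d)) : I.Homotopic c c' := by
  have key : ∀ c : Walk x y, I.Homotopic ((c.comp d).comp d.inv) c := fun c => by
    have := Homotopic.comp (.refl c) (Homotopic.comp_inv I d)
    rwa [← Walk.comp_assoc] at this
  exact .trans (.symm (key c)) (.trans (.comp h (.refl _)) (key c'))

/-- Homotopy as a setoid on the oriented paths with given end points. -/
def PathIdeal.pathSetoid (I : PathIdeal k V) (x y : V) : Setoid (Quiver.Path x y) where
  r p q := I.Homotopic (Walk.ofPath p) (Walk.ofPath q)
  iseqv := ⟨fun _ => .refl _, .symm, .trans⟩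

/-- The ideal `J` is homogeneous for the homotopy relation of `I`. -/
def PathIdeal.HomogeneousFor (J I : PathIdeal k V) : Prop :=
  ∀ (x y : V), ∀ f ∈ J.sub x y, ∀ p, coordProj k (I.pathSetoid x y p) f ∈ J.sub x y

theorem sum_single_eq_coordProj {X : Type*} (f : X →₀ k) (s : Finset X) :
    ∑ p ∈ s, Finsupp.single p (f p) = coordProj k (· ∈ s) f := by
  classical
  ext q
  rw [Finsupp.finsetSum_apply]
  by_cases hq : q ∈ s
  · rw [coordProj_apply_pos (s := (· ∈ s)) hq, Finset.sum_eq_single q]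
    · simp
    · intro b _ hb
      exact Finsupp.single_eq_of_ne hb.symm
    · exact fun h => (h hq).elim
  · rw [coordProj_apply_neg (s := (· ∈ s)) hq]
    refine Finset.sum_eq_zero fun b hb => Finsupp.single_eq_of_ne ?_
    rintro rfl
    exact hq hb

/-- If some part of a minimal relation is in the ideal, it is the whole relation or zero. -/
theorem PathIdeal.IsMinimalRelation.all_of_coordProj_mem {I : PathIdeal k V} {x y : V}
    {r : PathSpace k x y} (hr : I.IsMinimalRelation r) {s : Quiver.Path x y → Prop}
    (hs : coordProj k s r ∈ I.sub x y) {p q : Quiver.Path x y} (hp : p ∈ r.support)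
    (hq : q ∈ r.support) (hsp : s p) : s q := by
  classical
  by_contra hsq
  -- The offending partial sum runs over the paths of the relation satisfying `s`: it contains `p`
  -- and misses `q`.
  refine hr.minimal (r.support.filter s) ⟨p, Finset.mem_filter.2 ⟨hp, hsp⟩⟩ ?_ ?_
  · refine Finset.ssubset_iff_subset_ne.2 ⟨Finset.filter_subset _ _, fun e => hsq ?_⟩
    rw [← e] at hq
    exact (Finset.mem_filter.1 hq).2
  · rw [sum_single_eq_coordProj]
    convert hs using 1
    ext t
    by_cases ht : s t
    · rw [coordProj_apply_pos ht]
      by_cases hr0 : r t = 0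
      · rw [coordProj_apply_neg (s := (· ∈ r.support.filter s)), hr0]
        exact fun h => Finsupp.mem_support_iff.1 (Finset.mem_filter.1 h).1 hr0
      · exact coordProj_apply_pos (s := (· ∈ r.support.filter s))
          (Finset.mem_filter.2 ⟨Finsupp.mem_support_iff.2 hr0, ht⟩) r
    · rw [coordProj_apply_neg ht, coordProj_apply_neg (s := (· ∈ r.support.filter s))]
      exact fun h => ht (Finset.mem_filter.1 h).2

/-- An element of the ideal splits into minimal relations, and each minimal relation lies in one
homotopy class. The splitting is by induction on the size of the support. -/
theorem PathIdeal.homogeneousFor_self (I : PathIdeal k V) : I.HomogeneousFor I := by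
  classical
  intro x y
  suffices H : ∀ (n : ℕ), ∀ f ∈ I.sub x y, f.support.card ≤ n →
      ∀ p, coordProj k (I.pathSetoid x y p) f ∈ I.sub x y from fun f hf => H _ f hf le_rfl
  intro n
  induction n with
  | zero =>
    intro f _ hn p
    have : f = 0 := Finsupp.support_eq_empty.1 (Finset.card_eq_zero.1 (Nat.le_zero.1 hn))
    rw [this, map_zero]
    exact Submodule.zero_mem _
  | succ n ih =>
    intro f hf hn p
    by_cases h0 : f = 0
    · rw [h0, map_zero]
      exact Submodule.zero_mem _
    by_cases hmin : I.IsMinimalRelation f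
    · by_cases hq : ∃ q ∈ f.support, I.pathSetoid x y p q
      · obtain ⟨q, hq, hpq⟩ := hq
        rw [coordProj_eq_self]
        · exact hf
        · intro t ht
          exact (I.pathSetoid x y).trans hpq (.relation f hmin q t hq (Finsupp.mem_support_iff.2 ht))
      · rw [coordProj_eq_zero]
        · exact Submodule.zero_mem _
        · intro t ht hpt
          exact hq ⟨t, Finsupp.mem_support_iff.2 ht, hpt⟩
    -- A nonzero non-minimal element has a proper partial sum in the ideal; that sum and its
    -- complement both have smaller support.
    · obtain ⟨s, hs₁, hs₂, hs₃⟩ : ∃ s : Finset (Quiver.Path x y), s.Nonempty ∧ s ⊂ f.support ∧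
          ∑ p ∈ s, Finsupp.single p (f p) ∈ I.sub x y := by
        by_contra! hc
        exact hmin ⟨hf, h0, hc⟩
      rw [sum_single_eq_coordProj] at hs₃
      have e : f = coordProj k (· ∈ s) f + (f - coordProj k (· ∈ s) f) := by abel
      rw [e, map_add]
      obtain ⟨a, ha⟩ := hs₁
      obtain ⟨b, hb, hbs⟩ := Finset.exists_of_ssubset hs₂
      refine Submodule.add_mem _ (ih _ hs₃ ?_ p) (ih _ (Submodule.sub_mem _ hf hs₃) ?_ p) <;>
        refine Nat.lt_succ_iff.1 (lt_of_lt_of_le (Finset.card_lt_card ?_) hn)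
      · refine (Finset.ssubset_iff_of_subset ?_).2 ⟨b, hb, ?_⟩
        · intro t ht
          exact Finsupp.mem_support_iff.2 (coordProj_apply_ne_zero (Finsupp.mem_support_iff.1 ht)).2
        · intro h
          exact hbs (coordProj_apply_ne_zero (Finsupp.mem_support_iff.1 h)).1
      · refine (Finset.ssubset_iff_of_subset ?_).2 ⟨a, hs₂.1 ha, ?_⟩
        · intro t ht
          rw [Finsupp.mem_support_iff] at ht ⊢
          intro h
          apply ht
          by_cases hts : t ∈ s <;> simp [coordProj_apply_pos, coordProj_apply_neg, hts, h]
        · simp [coordProj_apply_pos (s := (· ∈ s)) ha]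

/-- A class component of a minimal relation of `J` is a partial sum lying in `J`, hence is
everything by minimality. Thus homogeneity is all that is needed to compare two homotopy relations.
-/
theorem PathIdeal.HomogeneousFor.homotopic {J I : PathIdeal k V} (h : J.HomogeneousFor I)
    {x y : V} {c d : Walk x y} (hcd : J.Homotopic c d) : I.Homotopic c d := by
  induction hcd with
  | refl c => exact .refl c
  | symm _ ih => exact .symm ih
  | trans _ _ ih₁ ih₂ => exact .trans ih₁ ih₂
  | comp _ _ ih₁ ih₂ => exact .comp ih₁ ih₂
  | cons_consInv a => exact .cons_consInv a
  | consInv_cons a => exact .consInv_cons a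
  | relation r hr p q hp hq =>
    exact hr.all_of_coordProj_mem (h _ _ r hr.mem p) hp hq ((I.pathSetoid _ _).refl p)

/-- The inverse image of an ideal under a substitution. -/
def PathIdeal.comapSubst (I : PathIdeal k V) (s : ∀ ⦃x y : V⦄, (x ⟶ y) → PathSpace k x y) :
    PathIdeal k V where
  sub x y := (I.sub x y).comap (subst s x y)
  mul_left f g hg := by
    rw [Submodule.mem_comap] at hg ⊢
    rw [subst_pathMul]
    exact I.mul_left _ _ hg
  mul_right f g hf := by
    rw [Submodule.mem_comap] at hf ⊢
    rw [subst_pathMul]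
    exact I.mul_right _ _ hf

/-- The substitution `s` maps each arrow to a combination of paths homotopic to it. -/
def PathIdeal.PreservesHomotopy (I : PathIdeal k V)
    (s : ∀ ⦃x y : V⦄, (x ⟶ y) → PathSpace k x y) : Prop :=
  ∀ ⦃x y : V⦄ (a : x ⟶ y) (q : Quiver.Path x y), s a q ≠ 0 →
    I.Homotopic (Walk.nil.cons a) (Walk.ofPath q)

theorem PathIdeal.PreservesHomotopy.substPath {I : PathIdeal k V}
    {s : ∀ ⦃x y : V⦄, (x ⟶ y) → PathSpace k x y} (hs : I.PreservesHomotopy s) {x y : V}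
    (p q : Quiver.Path x y) (h : substPath s p q ≠ 0) :
    I.Homotopic (Walk.ofPath p) (Walk.ofPath q) := by
  induction p with
  | nil =>
    obtain rfl : Quiver.Path.nil = q := by
      by_contra hne
      exact h (Finsupp.single_eq_of_ne (Ne.symm hne))
    exact .refl _
  | cons p a ih =>
    obtain ⟨p₁, p₂, e₁, e₂, rfl⟩ := exists_of_pathMul_apply_ne_zero h
    rw [Walk.ofPath_comp]
    exact .comp (ih p₁ e₁) (hs a p₂ e₂)

/-- A substitution moving each arrow within its class moves each path within its class, so it
commutes with the class projections. -/
theorem PathIdeal.PreservesHomotopy.homogeneousFor {I J : PathIdeal k V}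
    {s : ∀ ⦃x y : V⦄, (x ⟶ y) → PathSpace k x y} (hs : I.PreservesHomotopy s)
    (hJ : J.HomogeneousFor I) : (J.comapSubst s).HomogeneousFor I := by
  intro x y f hf p
  change subst s x y (coordProj k _ f) ∈ J.sub x y
  rw [map_coordProj_of_diagonal]
  · exact hJ x y _ hf p
  · intro p q h
    rw [subst_single] at h
    exact hs.substPath p q h

/-- Only this inclusion holds in general: the reverse one would need the inverse substitution to
respect the possibly finer relation of the inverse image. -/
theorem PathIdeal.PreservesHomotopy.homotopic {I : PathIdeal k V}
    {s : ∀ ⦃x y : V⦄, (x ⟶ y) → PathSpace k x y} (hs : I.PreservesHomotopy s)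
    {x y : V} {c d : Walk x y} (hcd : (I.comapSubst s).Homotopic c d) : I.Homotopic c d :=
  (hs.homogeneousFor I.homogeneousFor_self).homotopic hcd

variable {τ : ∀ x y : V, PathSpace k x y}

/-- The inverse image of an ideal under a unipotent endomorphism. -/
def PathIdeal.comapUnipotent (I : PathIdeal k V) (τ : ∀ x y : V, PathSpace k x y) :
    PathIdeal k V :=
  I.comapSubst fun x y a => Finsupp.single a.toPath 1 + τ x y

theorem PathIdeal.mem_comapUnipotent (I : PathIdeal k V) {x y : V} (f : PathSpace k x y) :
    f ∈ (I.comapUnipotent τ).sub x y ↔ unipotent τ x y f ∈ I.sub x y := Iff.rfl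

/-- All terms of `τ` are homotopic to the arrow they are parallel to. -/
def PathIdeal.HomotopicTail (I : PathIdeal k V) (τ : ∀ x y : V, PathSpace k x y) : Prop :=
  ∀ ⦃x y : V⦄ (a : x ⟶ y) (q : Quiver.Path x y), τ x y q ≠ 0 →
    I.Homotopic (Walk.nil.cons a) (Walk.ofPath q)

theorem PathIdeal.HomotopicTail.preservesHomotopy {I : PathIdeal k V} (h : I.HomotopicTail τ) :
    I.PreservesHomotopy fun x y a => Finsupp.single a.toPath 1 + τ x y := by
  intro x y a q hq
  by_cases h₁ : a.toPath = q
  · subst h₁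
    exact .refl _
  · refine h a q fun h₂ => hq ?_
    change (Finsupp.single a.toPath 1 : PathSpace k x y) q + τ x y q = 0
    rw [Finsupp.single_eq_of_ne (Ne.symm h₁), h₂, add_zero]

theorem PathIdeal.HomotopicTail.homotopic {I : PathIdeal k V} (h : I.HomotopicTail τ)
    {x y : V} {c d : Walk x y} (hcd : (I.comapUnipotent τ).Homotopic c d) : I.Homotopic c d :=
  h.preservesHomotopy.homotopic hcd

theorem PathIdeal.comapUnipotent_comapUnipotent (hb : HasNoDoubleBypass V) (I : PathIdeal k V)
    {σ : ∀ x y : V, PathSpace k x y} (hτ : IsTail τ) (hσ : IsTail σ) :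
    (I.comapUnipotent σ).comapUnipotent τ = I.comapUnipotent (σ + τ) := by
  ext x y f
  rw [mem_comapUnipotent, mem_comapUnipotent, mem_comapUnipotent, hb.unipotent_add hτ hσ]

theorem PathIdeal.comapUnipotent_zero (I : PathIdeal k V) : I.comapUnipotent 0 = I := by
  ext x y f
  rw [mem_comapUnipotent, unipotent_zero]

/-- A term of the derivative is the original path with one arrow replaced. A homotopy between the
two would give, after cancelling the common beginning and end, one between the arrow and the tail
term. -/
theorem PathIdeal.not_homotopic_of_derivPath_ne_zero {I : PathIdeal k V}
    (h : ∀ ⦃x y : V⦄ (a : x ⟶ y) (q : Quiver.Path x y), τ x y q ≠ 0 →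
      ¬ I.Homotopic (Walk.nil.cons a) (Walk.ofPath q)) {x y : V} (p q : Quiver.Path x y)
    (hpq : derivPath τ p q ≠ 0) : ¬ I.Homotopic (Walk.ofPath p) (Walk.ofPath q) := by
  induction p with
  | nil => exact (hpq rfl).elim
  | @cons y z p a ih =>
    have hcons : Walk.ofPath (p.cons a) = (Walk.ofPath p).comp (Walk.nil.cons a) := rfl
    rw [derivPath, Finsupp.add_apply] at hpq
    by_cases h₁ : pathMul k x y z (derivPath τ p) (Finsupp.single a.toPath 1) q = 0
    · rw [h₁, zero_add] at hpq
      obtain ⟨p₁, p₂, e₁, e₂, rfl⟩ := exists_of_pathMul_apply_ne_zero hpq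
      obtain rfl : p = p₁ := by
        by_contra hne
        exact e₁ (Finsupp.single_eq_of_ne (Ne.symm hne))
      rw [Walk.ofPath_comp, hcons]
      exact fun hc => h a p₂ e₂ hc.cancel_left
    · obtain ⟨p₁, p₂, e₁, e₂, rfl⟩ := exists_of_pathMul_apply_ne_zero h₁
      obtain rfl : a.toPath = p₂ := by
        by_contra hne
        exact e₂ (Finsupp.single_eq_of_ne (Ne.symm hne))
      rw [Walk.ofPath_comp, hcons]
      exact fun hc => ih p₁ e₁ hc.cancel_right

/-- If no term of `τ` is homotopic to the arrow it is parallel to, neither for `I` nor for its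
inverse image under the unipotent endomorphism given by `τ`, then the two ideals are equal. -/
theorem PathIdeal.comapUnipotent_eq_of_not_homotopic [CharZero k] (hb : HasNoDoubleBypass V)
    (hfin : ∀ x y : V, Finite (Quiver.Path x y)) (I : PathIdeal k V) (hτ : IsTail τ)
    (h : ∀ ⦃x y : V⦄ (a : x ⟶ y) (q : Quiver.Path x y), τ x y q ≠ 0 →
      ¬ I.Homotopic (Walk.nil.cons a) (Walk.ofPath q))
    (h' : ∀ ⦃x y : V⦄ (a : x ⟶ y) (q : Quiver.Path x y), τ x y q ≠ 0 →
      ¬ (I.comapUnipotent τ).Homotopic (Walk.nil.cons a) (Walk.ofPath q)) :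
    I.comapUnipotent τ = I := by
  refine PathIdeal.ext (funext fun x => funext fun y => ?_)
  obtain ⟨B, hB⟩ : ∃ B : ℕ, ∀ p : Quiver.Path x y, p.length < B := by
    obtain ⟨B, hB⟩ := (Set.finite_range fun p : Quiver.Path x y => p.length).bddAbove
    exact ⟨B + 1, fun p => Nat.lt_succ_of_le (hB ⟨p, rfl⟩)⟩
  -- The exponential series with its terms of order zero and one split off, whence the shift `j +
  -- 2`. It stops at `B`, which exceeds all path lengths.
  have hexp : ∀ σ : ∀ x y : V, PathSpace k x y, IsTail σ → ∀ f, unipotent σ x y f =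
      f + pathDeriv σ x y f + (∑ j ∈ Finset.range B, (((j + 2).factorial : k)⁻¹) •
        (pathDeriv σ x y ^ j)) (pathDeriv σ x y (pathDeriv σ x y f)) := by
    intro σ hσ f
    have key : unipotent σ x y = LinearMap.id + pathDeriv σ x y +
        (∑ j ∈ Finset.range B, (((j + 2).factorial : k)⁻¹) • (pathDeriv σ x y ^ j)) ∘ₗ
          (pathDeriv σ x y ∘ₗ pathDeriv σ x y) := by
      refine Finsupp.lhom_ext' fun p => LinearMap.ext_ring ?_
      simp only [LinearMap.comp_apply, Finsupp.lsingle_apply, LinearMap.add_apply,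
        LinearMap.id_apply]
      rw [hb.unipotent_eq_exp hσ p (B + 1) (le_trans (hB p).le (Nat.le_succ B)),
        Finset.sum_range_succ', Finset.sum_range_succ']
      have hsum : ∀ j, (pathDeriv σ x y ^ (j + 1 + 1)) (Finsupp.single p 1) =
          (pathDeriv σ x y ^ j) (pathDeriv σ x y (pathDeriv σ x y (Finsupp.single p 1))) :=
        fun j => by rw [pow_succ, pow_succ, Module.End.mul_apply, Module.End.mul_apply]
      simp only [hsum, LinearMap.sum_apply, LinearMap.smul_apply]
      rw [zero_add, pow_one, pow_zero, Module.End.one_apply, Nat.factorial_zero,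
        Nat.factorial_one, Nat.cast_one, inv_one, one_smul, one_smul]
      abel
    rw [key]
    rfl
  have hpow : ∀ (σ : ∀ x y : V, PathSpace k x y) (W : Submodule k (PathSpace k x y)),
      (∀ f ∈ W, pathDeriv σ x y f ∈ W) → ∀ f ∈ W, (∑ j ∈ Finset.range B,
        (((j + 2).factorial : k)⁻¹) • (pathDeriv σ x y ^ j)) f ∈ W := by
    intro σ W hW f hf
    rw [LinearMap.sum_apply]
    have : ∀ j, (pathDeriv σ x y ^ j) f ∈ W := fun j => by
      induction j with
      | zero => exact hf
      | succ j ih =>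
        rw [pow_succ', Module.End.mul_apply]
        exact hW _ ih
    exact W.sum_mem fun j _ => W.smul_mem _ (this j)
  refine eq_of_unipotent_of_homogeneous (fun p : Quiver.Path x y => p.length) B hB
    (pathDeriv τ x y) (unipotent τ x y) (unipotent (-τ) x y) _
    (∑ j ∈ Finset.range B, (((j + 2).factorial : k)⁻¹) • (pathDeriv (-τ) x y ^ j)) ?_
    ((I.comapUnipotent τ).pathSetoid x y) (I.pathSetoid x y) ?_ ?_ (hpow τ) ?_ (hexp τ hτ) ?_
    (hb.unipotent_self_neg hτ x y) _ _ ((I.comapUnipotent τ).homogeneousFor_self x y)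
    (I.homogeneousFor_self x y) (fun f => Iff.rfl)
  · intro p q hpq
    rw [pathDeriv_single] at hpq
    exact length_lt_of_derivPath_ne_zero hτ p q hpq
  · intro p q hpq
    rw [pathDeriv_single] at hpq
    exact not_homotopic_of_derivPath_ne_zero h' p q hpq
  · intro p q hpq
    rw [pathDeriv_single] at hpq
    exact not_homotopic_of_derivPath_ne_zero h p q hpq
  · intro W hW
    refine hpow (-τ) W fun f hf => ?_
    rw [pathDeriv_neg]
    exact W.neg_mem (hW f hf)
  · intro f
    rw [hexp (-τ) hτ.neg f]
    simp only [pathDeriv_neg, LinearMap.neg_apply, map_neg, neg_neg, sub_eq_add_neg]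

end HomotopyHomogeneous

/-! ### Ideals with minimal homotopy relation -/

section Confluence

variable {k : Type w} [Field k] {V : Type u} [Quiver.{v} V]

/-- The homotopy relation of `I` is contained in that of `J`. -/
def PathIdeal.HomotopyLE (I J : PathIdeal k V) : Prop :=
  ∀ ⦃x y : V⦄ (c d : Walk x y), I.Homotopic c d → J.Homotopic c d

theorem PathIdeal.homotopyRel_eq {I J : PathIdeal k V} (h : I.HomotopyLE J) (h' : J.HomotopyLE I) :
    I.homotopyRel = J.homotopyRel := by
  funext x y c d
  exact propext ⟨h c d, h' c d⟩

theorem PathIdeal.homotopyLE_of_eq {I J : PathIdeal k V} (h : I.homotopyRel = J.homotopyRel) :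
    I.HomotopyLE J := fun x y c d hcd => by
  have := congrFun (congrFun (congrFun (congrFun h x) y) c) d
  exact this.mp hcd

theorem PathIdeal.HomotopicTail.homotopyLE {I : PathIdeal k V} {τ : ∀ x y : V, PathSpace k x y}
    (h : I.HomotopicTail τ) : (I.comapUnipotent τ).HomotopyLE I := fun _ _ _ _ => h.homotopic

open Classical in
/-- The tail with the single term `c p`. -/
def tailSingle {x y : V} (p : Quiver.Path x y) (c : k) : ∀ x y : V, PathSpace k x y :=
  Pi.single x (Pi.single y (Finsupp.single p c))

theorem tailSingle_self {x y : V} (p : Quiver.Path x y) (c : k) :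
    tailSingle p c x y = Finsupp.single p c := by
  simp [tailSingle]

theorem eq_of_tailSingle_ne_zero {x y x' y' : V} {p : Quiver.Path x y} {c : k}
    {q : Quiver.Path x' y'} (h : tailSingle p c x' y' q ≠ 0) :
    (⟨x', y', q⟩ : Σ x y : V, Quiver.Path x y) = ⟨x, y, p⟩ := by
  classical
  by_cases hx : x' = x
  · subst hx
    by_cases hy : y' = y
    · subst hy
      rw [tailSingle_self] at h
      by_cases hp : q = p
      · rw [hp]
      · exact (h (Finsupp.single_eq_of_ne hp)).elim
    · rw [tailSingle, Pi.single_eq_same, Pi.single_eq_of_ne hy] at h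
      exact (h rfl).elim
  · rw [tailSingle, Pi.single_eq_of_ne hx] at h
    exact (h rfl).elim

theorem isTail_tailSingle {x y : V} {p : Quiver.Path x y} (hp : 2 ≤ p.length) (c : k) :
    IsTail (tailSingle p c) := fun x' y' q h => by
  cases eq_of_tailSingle_ne_zero h
  exact hp

theorem PathIdeal.homotopicTail_tailSingle {I : PathIdeal k V} {x y : V} {p : Quiver.Path x y}
    (c : k) (h : ∀ a : x ⟶ y, I.Homotopic (Walk.nil.cons a) (Walk.ofPath p)) :
    I.HomotopicTail (tailSingle p c) := fun x' y' a q hq => by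
  cases eq_of_tailSingle_ne_zero hq
  exact h a

theorem PathIdeal.HomotopicTail.add {I : PathIdeal k V} {τ σ : ∀ x y : V, PathSpace k x y}
    (hτ : I.HomotopicTail τ) (hσ : I.HomotopicTail σ) : I.HomotopicTail (τ + σ) :=
  fun x y a q h => by
    by_cases h₁ : τ x y q = 0
    · refine hσ a q fun h₂ => h ?_
      rw [Pi.add_apply, Pi.add_apply, Finsupp.add_apply, h₁, h₂, add_zero]
    · exact hτ a q h₁

theorem PathIdeal.HomotopicTail.neg {I : PathIdeal k V} {τ : ∀ x y : V, PathSpace k x y}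
    (hτ : I.HomotopicTail τ) : I.HomotopicTail (-τ) := fun x y a q h =>
  hτ a q fun h₀ => h (by rw [Pi.neg_apply, Pi.neg_apply, Finsupp.neg_apply, h₀, neg_zero])

theorem PathIdeal.HomotopicTail.mono {I J : PathIdeal k V} {τ : ∀ x y : V, PathSpace k x y}
    (hτ : I.HomotopicTail τ) (h : I.HomotopyLE J) : J.HomotopicTail τ :=
  fun _ _ a q hq => h _ _ (hτ a q hq)

/-- The paths that occur in a tail. -/
def tailTerms (τ : ∀ x y : V, PathSpace k x y) : Set (Σ x y : V, Quiver.Path x y) :=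
  {b | τ b.1 b.2.1 b.2.2 ≠ 0}

/-- Subtracting a term drops it from the tail and creates no new one; this drives the inductions on
the number of terms. -/
theorem tailTerms_sub_tailSingle {τ : ∀ x y : V, PathSpace k x y} {x y : V}
    {p : Quiver.Path x y} (hp : τ x y p ≠ 0) :
    tailTerms (τ - tailSingle p (τ x y p)) ⊂ tailTerms τ := by
  have hsub : ∀ b ∈ tailTerms (τ - tailSingle p (τ x y p)), b ≠ ⟨x, y, p⟩ := by
    rintro b hb rfl
    apply hb
    change τ x y p - tailSingle p (τ x y p) x y p = 0
    rw [tailSingle_self, Finsupp.single_eq_same, sub_self]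
  refine ⟨fun b hb => ?_, fun h => hsub _ (h (show (⟨x, y, p⟩ : Σ x y : V, Quiver.Path x y) ∈
    tailTerms τ from hp)) rfl⟩
  intro h0
  apply hb
  change τ b.1 b.2.1 b.2.2 - tailSingle p (τ x y p) b.1 b.2.1 b.2.2 = 0
  rw [h0, zero_sub, neg_eq_zero]
  by_contra hne
  exact hsub b hb (eq_of_tailSingle_ne_zero hne)

theorem IsTail.sub_tailSingle {τ : ∀ x y : V, PathSpace k x y} (hτ : IsTail τ) {x y : V}
    {p : Quiver.Path x y} (hp : τ x y p ≠ 0) : IsTail (τ - tailSingle p (τ x y p)) :=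
  fun x' y' q h => hτ x' y' q
    ((tailTerms_sub_tailSingle hp).1 (show (⟨x', y', q⟩ : Σ x y : V, Quiver.Path x y) ∈ _ from h))

theorem PathIdeal.HomotopicTail.sub_tailSingle {I : PathIdeal k V}
    {τ : ∀ x y : V, PathSpace k x y} (hτ : I.HomotopicTail τ) {x y : V}
    {p : Quiver.Path x y} (hp : τ x y p ≠ 0) : I.HomotopicTail (τ - tailSingle p (τ x y p)) :=
  fun x' y' a q h => hτ a q
    ((tailTerms_sub_tailSingle hp).1 (show (⟨x', y', q⟩ : Σ x y : V, Quiver.Path x y) ∈ _ from h))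

/-- The homotopy relation of `I` is minimal among those of the inverse images of `I` under
unipotent endomorphisms. -/
def PathIdeal.IsUnipotentMinimal (I : PathIdeal k V) : Prop :=
  ∀ σ : ∀ x y : V, PathSpace k x y, IsTail σ →
    (I.comapUnipotent σ).HomotopyLE I → I.HomotopyLE (I.comapUnipotent σ)

/-- If the homotopy relation of an inverse image of `I` under a unipotent endomorphism is minimal,
then this ideal is also the inverse image of `I` under a unipotent endomorphism compatible with the
homotopy relation of `I`. -/
theorem PathIdeal.IsUnipotentMinimal.exists_homotopicTail [CharZero k] [Finite V]
    (hb : HasNoDoubleBypass V) (hfin : ∀ x y : V, Finite (Quiver.Path x y))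
    {I : PathIdeal k V} {τ : ∀ x y : V, PathSpace k x y} (hτ : IsTail τ)
    (hmin : (I.comapUnipotent τ).IsUnipotentMinimal) :
    ∃ σ : ∀ x y : V, PathSpace k x y, IsTail σ ∧ I.HomotopicTail σ ∧
      I.comapUnipotent τ = I.comapUnipotent σ := by
  obtain ⟨n, hn⟩ : ∃ n, (tailTerms τ).ncard ≤ n := ⟨_, le_rfl⟩
  induction n generalizing I τ with
  | zero =>
    refine ⟨0, IsTail.zero, fun x y a q h => (h rfl).elim, ?_⟩
    congr 1
    have : tailTerms τ = ∅ := (Set.ncard_eq_zero (Set.toFinite _)).1 (Nat.le_zero.1 hn)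
    funext x y
    ext p
    by_contra h
    have h' : (⟨x, y, p⟩ : Σ x y : V, Quiver.Path x y) ∈ tailTerms τ := h
    rw [this] at h'
    exact h'
  | succ n ih =>
    by_cases hc : ∃ (x y : V) (a : x ⟶ y) (p : Quiver.Path x y), τ x y p ≠ 0 ∧
        (I.Homotopic (Walk.nil.cons a) (Walk.ofPath p) ∨
          (I.comapUnipotent τ).Homotopic (Walk.nil.cons a) (Walk.ofPath p))
    · obtain ⟨x, y, a, p, hp, hcase⟩ := hc
      have hsing := isTail_tailSingle (hτ x y p hp) (τ x y p)
      have hsub := hτ.sub_tailSingle hp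
      have hcard : (tailTerms (τ - tailSingle p (τ x y p))).ncard ≤ n :=
        Nat.lt_succ_iff.1 (lt_of_lt_of_le
          (Set.ncard_lt_ncard (tailTerms_sub_tailSingle hp) (Set.toFinite _)) hn)
      have hall : ∀ {J : PathIdeal k V}, J.Homotopic (Walk.nil.cons a) (Walk.ofPath p) →
          J.HomotopicTail (tailSingle p (τ x y p)) := fun h =>
        homotopicTail_tailSingle _ fun a' => by
          have := hb.subsingleton_hom x y
          rwa [Subsingleton.elim a' a]
      rcases hcase with h | h
      -- The term is homotopic for `I`: it is moved to the side of `I`, which is replaced by an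
      -- ideal with a smaller homotopy relation. Tails homotopic for the new ideal are then
      -- homotopic for `I`.
      · have e : (I.comapUnipotent (tailSingle p (τ x y p))).comapUnipotent
            (τ - tailSingle p (τ x y p)) = I.comapUnipotent τ := by
          rw [comapUnipotent_comapUnipotent hb I hsub hsing, add_sub_cancel]
        obtain ⟨σ, hσ₁, hσ₂, hσ₃⟩ := ih (I := I.comapUnipotent (tailSingle p (τ x y p))) hsub
          (by rwa [e]) hcard
        refine ⟨tailSingle p (τ x y p) + σ, hsing.add hσ₁,
          (hall h).add (hσ₂.mono (hall h).homotopyLE), ?_⟩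
        rw [← e, hσ₃, comapUnipotent_comapUnipotent hb I hσ₁ hsing]
      -- The term is homotopic for the far ideal: removing it there shrinks that relation, hence by
      -- minimality leaves it unchanged, and the induction applies to the shortened tail.
      · have e : (I.comapUnipotent τ).comapUnipotent (-tailSingle p (τ x y p)) =
            I.comapUnipotent (τ - tailSingle p (τ x y p)) := by
          rw [comapUnipotent_comapUnipotent hb I hsing.neg hτ, sub_eq_add_neg]
        have hle := (hall h).neg.homotopyLE
        have hge := hmin _ hsing.neg hle
        rw [e] at hle hge
        have hmin' : (I.comapUnipotent (τ - tailSingle p (τ x y p))).IsUnipotentMinimal := by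
          intro σ hσ hσle
          rw [← e, comapUnipotent_comapUnipotent hb _ hσ hsing.neg, e] at hσle ⊢
          refine fun x y c d hcd => hmin _ (hsing.neg.add hσ) (fun x y c d hcd' => ?_) c d
            (hle c d hcd)
          exact hle c d (hσle c d hcd')
        obtain ⟨σ, hσ₁, hσ₂, hσ₃⟩ := ih hsub hmin' hcard
        refine ⟨σ + tailSingle p (τ x y p), hσ₁.add hsing, hσ₂.add (hall ?_), ?_⟩
        -- The removed term is homotopic for the far ideal, hence for the shortened one, which is an
        -- inverse image of `I` along a homotopic tail; so it is homotopic for `I` as well and may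
        -- be added back.
        · have := hge _ _ h
          rw [hσ₃] at this
          exact hσ₂.homotopic this
        · rw [← comapUnipotent_comapUnipotent hb I hsing hσ₁, ← hσ₃,
            comapUnipotent_comapUnipotent hb I hsing hsub, sub_add_cancel]
    -- No term is homotopic on either side, so the two ideals coincide and the zero tail serves.
    · push Not at hc
      refine ⟨0, IsTail.zero, fun x y a q h => (h rfl).elim, ?_⟩
      rw [comapUnipotent_zero]
      exact comapUnipotent_eq_of_not_homotopic hb hfin I hτ
        (fun x y a q h => (hc x y a q h).1) (fun x y a q h => (hc x y a q h).2)

/-- On the way from an ideal to an inverse image with a smaller homotopy relation there is a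
transvection at which the homotopy relation changes for the first time. -/
theorem PathIdeal.HomotopicTail.exists_transvection [Finite V]
    (hb : HasNoDoubleBypass V) (hfin : ∀ x y : V, Finite (Quiver.Path x y))
    {I : PathIdeal k V} {τ : ∀ x y : V, PathSpace k x y} (hτ : IsTail τ) (hI : I.HomotopicTail τ)
    (hne : ¬ I.HomotopyLE (I.comapUnipotent τ)) :
    ∃ (σ : ∀ x y : V, PathSpace k x y) (x y : V) (a : x ⟶ y) (p : Quiver.Path x y) (c : k),
      IsTail σ ∧ (I.comapUnipotent σ).homotopyRel = I.homotopyRel ∧ 2 ≤ p.length ∧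
      I.Homotopic (Walk.nil.cons a) (Walk.ofPath p) ∧
      ¬ (I.comapUnipotent (σ + tailSingle p c)).Homotopic (Walk.nil.cons a) (Walk.ofPath p) := by
  obtain ⟨n, hn⟩ : ∃ n, (tailTerms τ).ncard ≤ n := ⟨_, le_rfl⟩
  induction n generalizing I τ with
  | zero =>
    refine (hne ?_).elim
    have : tailTerms τ = ∅ := (Set.ncard_eq_zero (Set.toFinite _)).1 (Nat.le_zero.1 hn)
    have h0 : τ = 0 := by
      funext x y
      ext p
      by_contra h
      have h' : (⟨x, y, p⟩ : Σ x y : V, Quiver.Path x y) ∈ tailTerms τ := h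
      rw [this] at h'
      exact h'
    rw [h0, comapUnipotent_zero]
    exact fun _ _ _ _ h => h
  | succ n ih =>
    by_cases h0 : τ = 0
    · rw [h0, comapUnipotent_zero] at hne
      exact (hne fun _ _ _ _ h => h).elim
    obtain ⟨x, y, p, hp⟩ : ∃ (x y : V) (p : Quiver.Path x y), τ x y p ≠ 0 := by
      by_contra! hc
      exact h0 (by funext x y; ext p; exact hc x y p)
    have hsing := isTail_tailSingle (hτ x y p hp) (τ x y p)
    have hsub := hτ.sub_tailSingle hp
    have hcard : (tailTerms (τ - tailSingle p (τ x y p))).ncard ≤ n :=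
      Nat.lt_succ_iff.1 (lt_of_lt_of_le
        (Set.ncard_lt_ncard (tailTerms_sub_tailSingle hp) (Set.toFinite _)) hn)
    have hItail : I.HomotopicTail (tailSingle p (τ x y p)) :=
      homotopicTail_tailSingle _ fun a => hI a p hp
    -- If the first transvection already destroys the homotopy between arrow and path, it is the one
    -- sought, with `σ = 0`.
    by_cases hc : ∃ a : x ⟶ y, ¬ (I.comapUnipotent (tailSingle p (τ x y p))).Homotopic
        (Walk.nil.cons a) (Walk.ofPath p)
    · obtain ⟨a, ha⟩ := hc
      exact ⟨0, x, y, a, p, τ x y p, IsTail.zero, by rw [comapUnipotent_zero], hτ x y p hp,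
        hI a p hp, by rwa [zero_add]⟩
    · push Not at hc
      have hle := hItail.homotopyLE
      have hback : (I.comapUnipotent (tailSingle p (τ x y p))).comapUnipotent
          (-tailSingle p (τ x y p)) = I := by
        rw [comapUnipotent_comapUnipotent hb I hsing.neg hsing, add_neg_cancel,
          comapUnipotent_zero]
      -- The term is still homotopic after the transvection, so the inverse transvection is
      -- compatible too and the relation is unchanged; the induction continues with the remaining
      -- terms.
      have hge : I.HomotopyLE (I.comapUnipotent (tailSingle p (τ x y p))) := by
        have := (homotopicTail_tailSingle (τ x y p) hc).neg.homotopyLE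
        rwa [hback] at this
      have e : (I.comapUnipotent (tailSingle p (τ x y p))).comapUnipotent
          (τ - tailSingle p (τ x y p)) = I.comapUnipotent τ := by
        rw [comapUnipotent_comapUnipotent hb I hsub hsing, add_sub_cancel]
      obtain ⟨σ, x', y', a, q, c, h₁, h₂, h₃, h₄, h₅⟩ :=
        ih (I := I.comapUnipotent (tailSingle p (τ x y p))) hsub
          ((hI.sub_tailSingle hp).mono hge)
          (fun h => hne fun x y c d hcd => by
            have := h c d (hge c d hcd)
            rwa [e] at this) hcard
      rw [comapUnipotent_comapUnipotent hb I h₁ hsing] at h₂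
      rw [comapUnipotent_comapUnipotent hb I (h₁.add (isTail_tailSingle h₃ c)) hsing] at h₅
      exact ⟨tailSingle p (τ x y p) + σ, x', y', a, q, c, hsing.add h₁,
        h₂.trans (homotopyRel_eq hle hge), h₃, hle _ _ h₄, by rwa [add_assoc]⟩

end Confluence

/-! ### The radical of a basic algebra -/

section Radical

/-- Write the minimal polynomial of `b` as `(X - c) ^ n * q` with coprime factors. The idempotent
given by a Bézout identity is 0 or 1: the first makes `b - c` nilpotent, and the second would make
`q` annihilate `b`. -/
theorem exists_sub_algebraMap_isNilpotent {k B : Type*} [Field k] [IsAlgClosed k] [Ring B]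
    [Nontrivial B] [Algebra k B] [FiniteDimensional k B]
    (hB : ∀ E : B, E * E = E → E = 0 ∨ E = 1) (b : B) :
    ∃ c : k, IsNilpotent (b - algebraMap k B c) := by
  have hint : IsIntegral k b := Algebra.IsIntegral.isIntegral b
  have hp0 := minpoly.ne_zero hint
  obtain ⟨c, hc⟩ := IsAlgClosed.exists_root (minpoly k b) (minpoly.degree_pos hint).ne'
  obtain ⟨q, hq, hdvd⟩ :=
    Polynomial.exists_eq_pow_rootMultiplicity_mul_and_not_dvd (minpoly k b) hp0 c
  obtain ⟨u, v, huv⟩ : IsCoprime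
      ((Polynomial.X - Polynomial.C c) ^ (minpoly k b).rootMultiplicity c) q :=
    (((Polynomial.irreducible_X_sub_C c).coprime_iff_not_dvd).2 hdvd).pow_left
  generalize (minpoly k b).rootMultiplicity c = n at hq huv
  have hprod : ∀ r : Polynomial k,
      Polynomial.aeval b (r * ((Polynomial.X - Polynomial.C c) ^ n * q)) = 0 := fun r => by
    rw [← hq, map_mul, minpoly.aeval, mul_zero]
  have hsum : Polynomial.aeval b (u * (Polynomial.X - Polynomial.C c) ^ n) +
      Polynomial.aeval b (v * q) = 1 := by
    rw [← map_add, huv, map_one]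
  refine ⟨c, ?_⟩
  rcases hB (Polynomial.aeval b (u * (Polynomial.X - Polynomial.C c) ^ n)) (by
    have h1 : Polynomial.aeval b (u * (Polynomial.X - Polynomial.C c) ^ n) *
        Polynomial.aeval b (v * q) = 0 := by
      rw [← map_mul, ← hprod (u * v)]
      congr 1
      ring
    calc _ = Polynomial.aeval b (u * (Polynomial.X - Polynomial.C c) ^ n) *
          (Polynomial.aeval b (u * (Polynomial.X - Polynomial.C c) ^ n) +
            Polynomial.aeval b (v * q)) := by rw [mul_add, h1, add_zero]
      _ = _ := by rw [hsum, mul_one]) with h | h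
  · refine ⟨n, ?_⟩
    have h1 : (b - algebraMap k B c) ^ n =
        Polynomial.aeval b ((Polynomial.X - Polynomial.C c) ^ n) := by simp
    rw [h, zero_add] at hsum
    rw [h1, ← mul_one (Polynomial.aeval b _), ← hsum, ← map_mul, ← hprod v]
    congr 1
    ring
  · exfalso
    have h1 : Polynomial.aeval b q = 0 := by
      rw [← one_mul (Polynomial.aeval b q), ← h, ← map_mul, ← hprod u]
      congr 1
      ring
    have h2 : (Polynomial.X - Polynomial.C c) ∣ minpoly k b := Polynomial.dvd_iff_isRoot.2 hc
    exact hdvd (h2.trans (minpoly.dvd k b h1))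

variable {k : Type*} [Field k] {A : Type*} [Ring A] [Algebra k A]
  {V : Type*} [Fintype V] {e : V → A} {he : IsBasicDecomposition e}

/-- A morphism of `A` seen as a `k`-category, as an element of `A`. -/
def homVal (X Y : IdemCat k he) : (X ⟶ Y) →ₗ[k] A where
  toFun f := f.1
  map_add' _ _ := rfl
  map_smul' _ _ := rfl

theorem homVal_injective (X Y : IdemCat k he) : Function.Injective (homVal X Y) :=
  Subtype.val_injective

theorem homVal_comp {X Y Z : IdemCat k he} (f : X ⟶ Y) (g : Y ⟶ Z) :
    homVal X Z (f ≫ g) = homVal Y Z g * homVal X Y f := rfl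

theorem homVal_id (X : IdemCat k he) : homVal X X (𝟙 X) = e X.vertex := rfl

theorem homVal_mem {X Y : IdemCat k he} (f : X ⟶ Y) :
    homVal X Y f ∈ peirceSpace k (e Y.vertex) (e X.vertex) := f.2

theorem mem_peirceSpace {b a r : A} : r ∈ peirceSpace k b a ↔ b * r = r ∧ r * a = r := Iff.rfl

/-- An idempotent endomorphism and its complement decompose the primitive idempotent of the object.
-/
theorem eq_one_or_zero_of_idem (X : IdemCat k he) (E : End X) (h : E * E = E) : E = 0 ∨ E = 1 := by
  have hmul : homVal X X E * homVal X X E = homVal X X E := congrArg (homVal X X) h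
  have h1 : e X.vertex * homVal X X E = homVal X X E := (homVal_mem (k := k) E).1
  have h2 : homVal X X E * e X.vertex = homVal X X E := (homVal_mem (k := k) E).2
  have hid := he.idem X.vertex
  rcases he.primitive X.vertex (homVal X X E) (e X.vertex - homVal X X E) hmul
    (by rw [IsIdempotentElem, mul_sub, sub_mul, sub_mul, h1, h2, hmul, hid.eq]; abel)
    (by rw [mul_sub, h2, hmul, sub_self]) (by rw [sub_mul, h1, hmul, sub_self])
    (by abel) with h' | h'
  · exact Or.inl (homVal_injective X X (h'.trans (map_zero _).symm))
  · exact Or.inr (homVal_injective X X (sub_eq_zero.1 h').symm)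

/-- Right multiplication by an isomorphism and its inverse would identify the two left ideals,
contrary to the algebra being basic. -/
theorem not_isIso_of_ne {X Y : IdemCat k he} (h : X.vertex ≠ Y.vertex) (f : X ⟶ Y) :
    ¬ IsIso f := by
  intro hf
  have h1 : homVal Y X (inv f) * homVal X Y f = e X.vertex :=
    congrArg (homVal X X) (IsIso.hom_inv_id f)
  have h2 : homVal X Y f * homVal Y X (inv f) = e Y.vertex :=
    congrArg (homVal Y Y) (IsIso.inv_hom_id f)
  have key : ∀ {u v : V} {s t : A}, s ∈ peirceSpace k (e u) (e v) → ∀ r ∈ (Ideal.span {e u} : Ideal A),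
      r * s ∈ (Ideal.span {e v} : Ideal A) := by
    intro u v s t hs r hr
    rw [Ideal.mem_span_singleton']
    exact ⟨r * s, by rw [mul_assoc, hs.2]⟩
  have key' : ∀ {u : V} {r : A}, r ∈ (Ideal.span {e u} : Ideal A) → r * e u = r := by
    intro u r hr
    obtain ⟨a, rfl⟩ := Ideal.mem_span_singleton'.1 hr
    rw [mul_assoc, (he.idem u).eq]
  refine (he.not_iso _ _ h).false
    { toFun := fun r => ⟨r.1 * homVal Y X (inv f), key (t := 0) (homVal_mem (inv f)) r.1 r.2⟩
      invFun := fun r => ⟨r.1 * homVal X Y f, key (t := 0) (homVal_mem f) r.1 r.2⟩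
      map_add' := fun r s => Subtype.ext (add_mul _ _ _)
      map_smul' := fun c r => Subtype.ext (mul_assoc _ _ _)
      left_inv := fun r => Subtype.ext ?_
      right_inv := fun r => Subtype.ext ?_ }
  · change r.1 * homVal Y X (inv f) * homVal X Y f = r.1
    rw [mul_assoc, h1, key' r.2]
  · change r.1 * homVal X Y f * homVal Y X (inv f) = r.1
    rw [mul_assoc, h2, key' r.2]

instance [FiniteDimensional k A] (X Y : IdemCat k he) : FiniteDimensional k (X ⟶ Y) :=
  FiniteDimensional.of_injective (homVal X Y) (homVal_injective X Y)

instance [FiniteDimensional k A] (X : IdemCat k he) : FiniteDimensional k (End X) :=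
  inferInstanceAs (FiniteDimensional k (X ⟶ X))

instance (X : IdemCat k he) : Nontrivial (End X) :=
  ⟨0, 1, fun h => he.ne_zero X.vertex (congrArg (homVal X X) h).symm⟩

variable (k A) in
/-- The Jacobson radical as a subspace. -/
def jacobsonSpace : Submodule k A := (Ideal.jacobson (⊥ : Ideal A)).restrictScalars k

theorem mul_mem_jacobsonSpace_left (a : A) {b : A} (hb : b ∈ jacobsonSpace k A) :
    a * b ∈ jacobsonSpace k A := Ideal.mul_mem_left _ a hb

theorem mul_mem_jacobsonSpace_right {a : A} (b : A) (ha : a ∈ jacobsonSpace k A) :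
    a * b ∈ jacobsonSpace k A := Ideal.mul_mem_right b (Ideal.jacobson (⊥ : Ideal A)) ha

theorem exists_jacobsonSpace_pow_eq_bot [FiniteDimensional k A] :
    ∃ n, jacobsonSpace k A ^ n = ⊥ := by
  have : IsArtinianRing A := .of_finite k A
  obtain ⟨n, hn⟩ := IsArtinianRing.isNilpotent_jacobson_bot (R := A)
  refine ⟨n, ?_⟩
  have key : ∀ m, ∀ b ∈ jacobsonSpace k A ^ m, b ∈ Ideal.jacobson (⊥ : Ideal A) ^ m := by
    intro m
    induction m with
    | zero => intro b _; rw [Submodule.pow_zero, Ideal.one_eq_top]; trivial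
    | succ m ih =>
      intro b hb
      rw [pow_succ] at hb
      rw [Submodule.pow_succ]
      refine Submodule.mul_induction_on hb (fun c hc d hd => Ideal.mul_mem_mul (ih c hc) hd)
        (fun c d hc hd => add_mem hc hd)
  rw [eq_bot_iff]
  intro b hb
  have := key n b hb
  rw [hn] at this
  exact this

variable [IsAlgClosed k] [FiniteDimensional k A]

/-- The endomorphism is a scalar plus a nilpotent; a nonzero scalar would make it invertible. -/
theorem isNilpotent_of_not_isIso (X : IdemCat k he) (f : End X) (hf : ¬ IsIso f) :
    IsNilpotent f := by
  obtain ⟨c, hc⟩ := exists_sub_algebraMap_isNilpotent (k := k) (eq_one_or_zero_of_idem X) f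
  by_cases h0 : c = 0
  · rwa [h0, map_zero, sub_zero] at hc
  · refine (hf ((isUnit_iff_isIso f).1 ?_)).elim
    have hu : IsUnit (algebraMap k (End X) c) := (IsUnit.mk0 c h0).map _
    have := IsNilpotent.isUnit_add_left_of_commute hc hu (Algebra.commutes c _).symm
    rwa [add_comm, sub_add_cancel] at this

/-- It suffices that `a * f` is nilpotent for every `a`, for then `1 + a * f` is invertible. Only
the Peirce component of `a` opposite to `f` matters, so this becomes nilpotency of an endomorphism
of `Y`. -/
theorem homVal_mem_jacobson_of_not_isIso {X Y : IdemCat k he} (f : X ⟶ Y) (hf : ¬ IsIso f) :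
    homVal X Y f ∈ jacobsonSpace k A := by
  have key : ∀ a : A, IsNilpotent (a * homVal X Y f) := by
    intro a
    let g : Y ⟶ X := ⟨e X.vertex * a * e Y.vertex, by
      rw [mem_peirceSpace, ← mul_assoc, ← mul_assoc, (he.idem X.vertex).eq]
      exact ⟨rfl, by rw [mul_assoc, (he.idem Y.vertex).eq]⟩⟩
    have hg : homVal Y X g = e X.vertex * a * e Y.vertex := rfl
    by_cases hgf : IsIso (g ≫ f)
    -- If the composite endomorphism of `Y` is invertible, `f` is a split epimorphism. The
    -- associated idempotent of `X` is 0, which would force the identity of `Y` to vanish, or 1,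
    -- which makes `f` invertible.
    · refine (hf ?_).elim
      let i := inv (g ≫ f) ≫ g
      have h1 : i ≫ f = 𝟙 Y := by
        rw [Category.assoc, IsIso.inv_hom_id]
      let fi : End X := f ≫ i
      have h2 : fi * fi = fi := by
        change (f ≫ i) ≫ (f ≫ i) = f ≫ i
        rw [Category.assoc, ← Category.assoc i, h1, Category.id_comp]
      rcases eq_one_or_zero_of_idem X fi h2 with h | h
      · have h3 : 𝟙 Y = 0 := by
          have : (i ≫ f) ≫ (i ≫ f) = 0 := by
            rw [Category.assoc, ← Category.assoc f i f]
            change i ≫ (show X ⟶ X from fi) ≫ f = 0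
            rw [h]
            change i ≫ (0 : X ⟶ X) ≫ f = 0
            rw [Limits.zero_comp, Limits.comp_zero]
          rwa [h1, Category.comp_id] at this
        exact (he.ne_zero Y.vertex (congrArg (homVal Y Y) h3)).elim
      · exact ⟨i, h, h1⟩
    · let gf : End Y := g ≫ f
      obtain ⟨n, hn⟩ := isNilpotent_of_not_isIso Y gf hgf
      refine ⟨n + 1, ?_⟩
      have hpow : ∀ m, homVal Y Y (gf ^ m) * homVal X Y f =
          (homVal X Y f * a) ^ m * homVal X Y f := by
        intro m
        induction m with
        | zero =>
          rw [pow_zero, pow_zero, one_mul]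
          exact (homVal_mem f).1
        | succ m ih =>
          have h1 : homVal Y Y (gf ^ (m + 1)) =
              homVal Y Y (gf ^ m) * (homVal X Y f * homVal Y X g) := by
            rw [pow_succ]
            rfl
          rw [h1, hg, pow_succ]
          have h2 : homVal X Y f * (e X.vertex * a * e Y.vertex) * homVal X Y f =
              homVal X Y f * (a * homVal X Y f) := by
            rw [← mul_assoc, ← mul_assoc, (homVal_mem f).2, mul_assoc, (homVal_mem f).1, mul_assoc]
          rw [mul_assoc, h2, ← mul_assoc, ih, mul_assoc, mul_assoc, mul_assoc]
      have h3 : ∀ m, (a * homVal X Y f) ^ (m + 1) = a * ((homVal X Y f * a) ^ m * homVal X Y f) := by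
        intro m
        induction m with
        | zero => simp
        | succ m ih => rw [pow_succ, ih, pow_succ]; simp only [mul_assoc]
      rw [h3, ← hpow, hn]
      change a * (0 * _) = 0
      rw [zero_mul, mul_zero]
  change homVal X Y f ∈ Ideal.jacobson ⊥
  rw [Ideal.mem_jacobson_iff]
  intro a
  obtain ⟨u, hu⟩ := (key a).isUnit_add_one
  refine ⟨(u⁻¹ : Aˣ), ?_⟩
  rw [Ideal.mem_bot, sub_eq_zero, mul_assoc]
  calc (u⁻¹ : Aˣ).1 * (a * homVal X Y f) + (u⁻¹ : Aˣ).1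
      = (u⁻¹ : Aˣ).1 * (a * homVal X Y f + 1) := by rw [mul_add, mul_one]
    _ = 1 := by rw [← hu, Units.inv_mul]

theorem mem_radHom_iff {X Y : IdemCat k he} (f : X ⟶ Y) :
    f ∈ radHom k (IdemCat k he) X Y ↔ homVal X Y f ∈ jacobsonSpace k A := by
  constructor
  · intro h
    have : radHom k (IdemCat k he) X Y ≤ (jacobsonSpace k A).comap (homVal X Y) :=
      Submodule.span_le.2 fun f hf => homVal_mem_jacobson_of_not_isIso f hf
    exact this h
  · intro h
    refine Submodule.subset_span fun hf => ?_
    -- An isomorphism in the radical would put an idempotent there; since the radical is nilpotent,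
    -- that idempotent would be zero.
    have h1 : e X.vertex ∈ jacobsonSpace k A := by
      have : homVal Y X (inv f) * homVal X Y f = e X.vertex :=
        congrArg (homVal X X) (IsIso.hom_inv_id f)
      rw [← this]
      exact mul_mem_jacobsonSpace_left _ h
    obtain ⟨n, hn⟩ := exists_jacobsonSpace_pow_eq_bot (k := k) (A := A)
    have h2 : e X.vertex ^ (n + 1) ∈ jacobsonSpace k A ^ (n + 1) := Submodule.pow_mem_pow _ h1 _
    rw [pow_succ (jacobsonSpace k A), hn, Submodule.bot_mul, (he.idem _).pow_succ_eq] at h2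
    exact he.ne_zero _ h2

/-- The endomorphism rings are local with residue field `k`: subtracting the right scalar leaves a
nilpotent, hence non-invertible, endomorphism. -/
theorem exists_sub_smul_id_mem_jacobson (X : IdemCat k he) (f : X ⟶ X) :
    ∃ c : k, homVal X X f - c • e X.vertex ∈ jacobsonSpace k A := by
  let f' : End X := f
  obtain ⟨c, hc⟩ := exists_sub_algebraMap_isNilpotent (k := k) (eq_one_or_zero_of_idem X) f'
  refine ⟨c, ?_⟩
  have h := homVal_mem_jacobson_of_not_isIso (X := X) (Y := X)
    (f' - algebraMap k (End X) c) (fun h => by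
    have := (isUnit_iff_isIso _).2 h
    exact not_isUnit_zero (M₀ := End X) (by
      obtain ⟨n, hn⟩ := hc
      rw [← hn]
      exact this.pow n))
  exact h

end Radical

/-! ### The square of the radical -/

section RadicalSquare

variable {k : Type*} [Field k] {A : Type*} [Ring A] [Algebra k A] {V : Type*} [Fintype V] {e : V → A}

variable (k) in
/-- The square of the radical, as a subspace of `A`. -/
def radSqVal (he : IsBasicDecomposition e) (x y : V) : Submodule k A :=
  (radSqHom k (IdemCat k he) ⟨x⟩ ⟨y⟩).map (homVal ⟨x⟩ ⟨y⟩)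

variable [IsAlgClosed k] [FiniteDimensional k A]

theorem IsBasicDecomposition.mem_jacobsonSpace (he : IsBasicDecomposition e) {x y : V} (h : x ≠ y) {m : A}
    (hm : m ∈ peirceSpace k (e y) (e x)) : m ∈ jacobsonSpace k A :=
  homVal_mem_jacobson_of_not_isIso (he := he) (X := ⟨x⟩) (Y := ⟨y⟩) ⟨m, hm⟩
    (not_isIso_of_ne h _)

theorem mul_mem_radSqVal (he : IsBasicDecomposition e) {x y z : V} {m n : A} (hm : m ∈ peirceSpace k (e y) (e x))
    (hn : n ∈ peirceSpace k (e z) (e y)) (hmJ : m ∈ jacobsonSpace k A)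
    (hnJ : n ∈ jacobsonSpace k A) : n * m ∈ radSqVal k he x z := by
  refine ⟨(⟨m, hm⟩ : (⟨x⟩ : IdemCat k he) ⟶ ⟨y⟩) ≫ (⟨n, hn⟩ : (⟨y⟩ : IdemCat k he) ⟶ ⟨z⟩),
    Submodule.subset_span ⟨⟨y⟩, _, _, ?_, ?_, rfl⟩, rfl⟩
  · exact (mem_radHom_iff _).2 hmJ
  · exact (mem_radHom_iff _).2 hnJ

theorem radSqVal_le (he : IsBasicDecomposition e) {W : Submodule k A} {x z : V}
    (h : ∀ (y : V) (m n : A), m ∈ peirceSpace k (e y) (e x) → n ∈ peirceSpace k (e z) (e y) →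
      m ∈ jacobsonSpace k A → n ∈ jacobsonSpace k A → n * m ∈ W) : radSqVal k he x z ≤ W := by
  rw [radSqVal, Submodule.map_le_iff_le_comap, radSqHom, Submodule.span_le]
  rintro _ ⟨y, m, n, hm, hn, rfl⟩
  exact h y.vertex m.1 n.1 m.2 n.2 ((mem_radHom_iff m).1 hm) ((mem_radHom_iff n).1 hn)

theorem radSqVal_le_jacobsonSpace_sq (he : IsBasicDecomposition e) (x z : V) :
    radSqVal k he x z ≤ jacobsonSpace k A * jacobsonSpace k A :=
  radSqVal_le he fun _ _ _ _ _ hm hn => Submodule.mul_mem_mul hn hm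

/-- The radical is spanned, modulo its square, by any element for the only arrow. -/
theorem IsOrdinaryQuiver.exists_sub_smul_mem_radSqVal [Quiver V] {he : IsBasicDecomposition e}
    (hQ : IsOrdinaryQuiver k V (IdemCat k he) (IdemCat.ob k he)) (hb : HasNoDoubleBypass V) {x y : V}
    {m : A} (hm : m ∈ peirceSpace k (e y) (e x)) (hmJ : m ∈ jacobsonSpace k A) :
    (IsEmpty (x ⟶ y) → m ∈ radSqVal k he x y) ∧
    (Nonempty (x ⟶ y) → (∃ n ∈ peirceSpace k (e y) (e x), n ∉ radSqVal k he x y) ∧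
      ∀ n ∈ peirceSpace k (e y) (e x), n ∉ radSqVal k he x y →
        ∃ c : k, m - c • n ∈ radSqVal k he x y) := by
  obtain ⟨hfin, hcard⟩ := hQ x y
  let X : IdemCat k he := ⟨x⟩
  let Y : IdemCat k he := ⟨y⟩
  let N := (radSqHom k (IdemCat k he) X Y).submoduleOf (radHom k (IdemCat k he) X Y)
  change Nat.card (x ⟶ y) = Module.finrank k (radHom k (IdemCat k he) X Y ⧸ N) at hcard
  have hmem : ∀ {n : A} (hn : n ∈ peirceSpace k (e y) (e x)),
      (⟨n, hn⟩ : X ⟶ Y) ∈ radSqHom k (IdemCat k he) X Y ↔ n ∈ radSqVal k he x y := by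
    refine fun {n} hn => ⟨fun h => ⟨_, h, rfl⟩, ?_⟩
    rintro ⟨n', h, rfl⟩
    exact h
  let m' : radHom k (IdemCat k he) X Y := ⟨⟨m, hm⟩, (mem_radHom_iff (X := X) (Y := Y) ⟨m, hm⟩).2 hmJ⟩
  constructor
  · intro hempty
    rw [Nat.card_of_isEmpty] at hcard
    have := Module.finrank_zero_iff.1 hcard.symm
    have h0 : N.mkQ m' = 0 := Subsingleton.elim _ _
    rw [Submodule.mkQ_apply, Submodule.Quotient.mk_eq_zero] at h0
    exact (hmem hm).1 h0
  · rintro ⟨a⟩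
    have hss := hb.subsingleton_hom x y
    -- There is exactly one arrow, so the radical modulo its square is one-dimensional here.
    have : Unique (x ⟶ y) := ⟨⟨a⟩, fun b => Subsingleton.elim b a⟩
    rw [Nat.card_unique] at hcard
    constructor
    · have := Module.nontrivial_of_finrank_pos (R := k) (hcard ▸ Nat.one_pos)
      obtain ⟨q, hq⟩ := exists_ne (0 : radHom k (IdemCat k he) X Y ⧸ N)
      obtain ⟨n, rfl⟩ := N.mkQ_surjective q
      refine ⟨n.1.1, n.1.2, fun h => hq ?_⟩
      rw [Submodule.mkQ_apply, Submodule.Quotient.mk_eq_zero]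
      exact (hmem n.1.2).2 h
    · intro n hn hn'
      have hnJ : n ∈ jacobsonSpace k A := he.mem_jacobsonSpace (hb.ne_of_hom a) hn
      let n' : radHom k (IdemCat k he) X Y :=
        ⟨⟨n, hn⟩, (mem_radHom_iff (X := X) (Y := Y) ⟨n, hn⟩).2 hnJ⟩
      have hne : N.mkQ n' ≠ 0 := by
        rw [Submodule.mkQ_apply, Ne, Submodule.Quotient.mk_eq_zero]
        exact fun h => hn' ((hmem hn).1 h)
      obtain ⟨c, hc⟩ := (finrank_eq_one_iff_of_nonzero' _ hne).1 hcard.symm (N.mkQ m')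
      refine ⟨c, ?_⟩
      rw [← map_smul, eq_comm, ← sub_eq_zero, ← map_sub, Submodule.mkQ_apply,
        Submodule.Quotient.mk_eq_zero] at hc
      exact (hmem (Submodule.sub_mem _ hm (Submodule.smul_mem _ c hn))).1 hc

end RadicalSquare

/-! ### Presentations by arrows -/

section Presentation

variable {k : Type*} [Field k] {A : Type*} [Ring A] [Algebra k A]
  {V : Type u} [Quiver.{v} V]

/-- The value of a path when each arrow `a` is given the value `f a`. -/
def evalPath (e : V → A) (f : ∀ ⦃x y : V⦄, (x ⟶ y) → A) {x : V} :
    ∀ {y : V}, Quiver.Path x y → A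
  | _, .nil => e x
  | _, .cons p a => f a * evalPath e f p

variable (k) in
/-- The linear extension of `evalPath`. -/
def evalLin (e : V → A) (f : ∀ ⦃x y : V⦄, (x ⟶ y) → A) (x y : V) : PathSpace k x y →ₗ[k] A :=
  Finsupp.linearCombination k (evalPath e f)

variable {e : V → A} {f : ∀ ⦃x y : V⦄, (x ⟶ y) → A}

theorem evalLin_single {x y : V} (p : Quiver.Path x y) :
    evalLin k e f x y (Finsupp.single p 1) = evalPath e f p := by
  simp [evalLin]

theorem evalLin_mem_of_support {x y : V} (W : Submodule k A) (r : PathSpace k x y)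
    (h : ∀ p, r p ≠ 0 → evalPath e f p ∈ W) : evalLin k e f x y r ∈ W := by
  rw [evalLin, Finsupp.linearCombination_apply]
  exact W.sum_mem fun p hp => W.smul_mem _ (h p (Finsupp.mem_support_iff.1 hp))


variable (k) in
/-- The elements `f a` are in the Peirce spaces given by the end points of the arrows. -/
def IsPeirceSystem (e : V → A) (f : ∀ ⦃x y : V⦄, (x ⟶ y) → A) : Prop :=
  ∀ ⦃x y : V⦄ (a : x ⟶ y), f a ∈ peirceSpace k (e y) (e x)

theorem evalPath_toPath (hf : IsPeirceSystem k e f) {x y : V} (a : x ⟶ y) :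
    evalPath e f a.toPath = f a := (hf a).2

variable [Fintype V]

theorem evalPath_mem (he : IsBasicDecomposition e) (hf : IsPeirceSystem k e f) {x y : V} (p : Quiver.Path x y) :
    evalPath e f p ∈ peirceSpace k (e y) (e x) := by
  induction p with
  | nil => exact ⟨he.idem x, he.idem x⟩
  | cons p a ih => exact ⟨by rw [evalPath, ← mul_assoc, (hf a).1], by rw [evalPath, mul_assoc, ih.2]⟩

theorem evalLin_mem (he : IsBasicDecomposition e) (hf : IsPeirceSystem k e f) {x y : V} (r : PathSpace k x y) :
    evalLin k e f x y r ∈ peirceSpace k (e y) (e x) :=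
  evalLin_mem_of_support _ r fun p _ => evalPath_mem he hf p

theorem evalPath_comp (he : IsBasicDecomposition e) (hf : IsPeirceSystem k e f) {x y z : V} (p : Quiver.Path x y)
    (q : Quiver.Path y z) : evalPath e f (p.comp q) = evalPath e f q * evalPath e f p := by
  induction q with
  | nil => exact (evalPath_mem he hf p).1.symm
  | cons q a ih => rw [Quiver.Path.comp_cons, evalPath, ih, evalPath, mul_assoc]

theorem evalLin_pathMul (he : IsBasicDecomposition e) (hf : IsPeirceSystem k e f) {x y z : V} (r : PathSpace k x y)
    (s : PathSpace k y z) : evalLin k e f x z (pathMul k x y z r s) =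
      evalLin k e f y z s * evalLin k e f x y r := by
  induction r using Finsupp.induction_linear with
  | zero => simp
  | add f₁ f₂ h₁ h₂ => simp only [map_add, LinearMap.add_apply, h₁, h₂, mul_add]
  | single p a =>
    induction s using Finsupp.induction_linear with
    | zero => simp
    | add f₁ f₂ h₁ h₂ => simp only [map_add, h₁, h₂, add_mul]
    | single q b =>
      simp only [pathMul_single_single, evalLin, Finsupp.linearCombination_single,
        evalPath_comp he hf, smul_mul_smul_comm, mul_comm]

/-- Substituting in the paths amounts to changing the values of the arrows, which turns a change of
generators into an inverse image of ideals. -/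
theorem evalLin_subst (he : IsBasicDecomposition e) (hf : IsPeirceSystem k e f)
    (s : ∀ ⦃x y : V⦄, (x ⟶ y) → PathSpace k x y) {x y : V} (r : PathSpace k x y) :
    evalLin k e f x y (subst s x y r) =
      evalLin k e (fun x y a => evalLin k e f x y (s a)) x y r := by
  refine LinearMap.congr_fun (f := evalLin k e f x y ∘ₗ subst s x y) (Finsupp.lhom_ext' fun p =>
    LinearMap.ext_ring ?_) r
  simp only [LinearMap.comp_apply, Finsupp.lsingle_apply, subst_single, evalLin_single]
  clear r
  induction p with
  | nil => rw [substPath, evalLin_single]; rfl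
  | cons p a ih => rw [substPath, evalLin_pathMul he hf, ih, evalPath]

variable (k) in
/-- The kernel of the evaluation, as an ideal of the path category. -/
def evalKer (he : IsBasicDecomposition e) (hf : IsPeirceSystem k e f) : PathIdeal k V where
  sub x y := LinearMap.ker (evalLin k e f x y)
  mul_left r s hs := by
    rw [LinearMap.mem_ker] at hs ⊢
    rw [evalLin_pathMul he hf, hs, zero_mul]
  mul_right r s hs := by
    rw [LinearMap.mem_ker] at hs ⊢
    rw [evalLin_pathMul he hf, hs, mul_zero]

/-- The functor from `kQ/I` to `A` that maps each arrow `a` to `f a`. -/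
def evalFunctor (he : IsBasicDecomposition e) (hf : IsPeirceSystem k e f) (I : PathIdeal k V)
    (hI : ∀ x y, I.sub x y ≤ LinearMap.ker (evalLin k e f x y)) : BoundCat I ⥤ IdemCat k he where
  obj x := ⟨x.vertex⟩
  map {x y} m := ⟨(I.sub x.vertex y.vertex).liftQ (evalLin k e f x.vertex y.vertex) (hI _ _) m, by
    obtain ⟨m, rfl⟩ := Submodule.mkQ_surjective _ m
    exact evalLin_mem he hf m⟩
  map_id x := Subtype.ext (evalLin_single Quiver.Path.nil)
  map_comp {x y z} m n := by
    obtain ⟨m, rfl⟩ := Submodule.mkQ_surjective _ m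
    obtain ⟨n, rfl⟩ := Submodule.mkQ_surjective _ n
    exact Subtype.ext (evalLin_pathMul he hf m n)

end Presentation

/-! ### Generation of the algebra by arrows -/

section Generation

variable {k : Type*} [Field k] {A : Type*} [Ring A] [Algebra k A]
  {V : Type u} [Fintype V] {e : V → A}

theorem mul_mul_mem_peirceSpace (he : IsBasicDecomposition e) (x y : V) (b : A) :
    e y * b * e x ∈ peirceSpace k (e y) (e x) := by
  rw [mem_peirceSpace, ← mul_assoc, ← mul_assoc, (he.idem y).eq]
  exact ⟨rfl, by rw [mul_assoc, (he.idem x).eq]⟩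

theorem eq_sum_peirce (he : IsBasicDecomposition e) (b : A) :
    b = ∑ y, ∑ x, e y * b * e x := by
  simp_rw [← Finset.mul_sum, ← Finset.sum_mul, he.complete, one_mul, mul_one]

variable [Quiver.{v} V] {f : ∀ ⦃x y : V⦄, (x ⟶ y) → A}

variable (k) in
/-- The elements of `A` whose Peirce components are values of the evaluation. -/
def evalSpace (e : V → A) (f : ∀ ⦃x y : V⦄, (x ⟶ y) → A) : Submodule k A where
  carrier := {b | ∀ x y, e y * b * e x ∈ LinearMap.range (evalLin k e f x y)}
  add_mem' h h' x y := by
    rw [mul_add, add_mul]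
    exact add_mem (h x y) (h' x y)
  zero_mem' x y := by
    rw [mul_zero, zero_mul]
    exact zero_mem _
  smul_mem' c b h x y := by
    rw [mul_smul_comm, smul_mul_assoc]
    exact Submodule.smul_mem _ c (h x y)

/-- Inserting the sum of all idempotents between two factors expresses each Peirce component of a
product through those of the factors. -/
theorem evalSpace_mul_le (he : IsBasicDecomposition e) (hf : IsPeirceSystem k e f) :
    evalSpace k e f * evalSpace k e f ≤ evalSpace k e f := by
  refine Submodule.mul_le.2 fun b hb c hc x y => ?_
  have : e y * (b * c) * e x = ∑ z, (e y * b * e z) * (e z * c * e x) := by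
    have h : ∀ z, (e y * b * e z) * (e z * c * e x) = e y * b * (e z) * (c * e x) := fun z => by
      rw [← mul_assoc, ← mul_assoc, mul_assoc _ (e z) (e z), (he.idem z).eq, mul_assoc _ c]
    simp_rw [h, ← Finset.sum_mul, ← Finset.mul_sum, he.complete, mul_one, mul_assoc]
  rw [this]
  refine Submodule.sum_mem _ fun z _ => ?_
  obtain ⟨r, hr⟩ := hb z y
  obtain ⟨s, hs⟩ := hc x z
  exact ⟨pathMul k x z y s r, by rw [evalLin_pathMul he hf, hr, hs]⟩

theorem mem_evalSpace (he : IsBasicDecomposition e) {x y : V} {m : A}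
    (hm : m ∈ peirceSpace k (e y) (e x)) (h : m ∈ LinearMap.range (evalLin k e f x y)) :
    m ∈ evalSpace k e f := by
  intro x' y'
  by_cases hx : x = x'
  · subst hx
    by_cases hy : y' = y
    · subst hy
      rwa [hm.1, hm.2]
    · rw [← hm.1, ← mul_assoc, he.ortho hy, zero_mul, zero_mul]
      exact zero_mem _
  · rw [← hm.2, mul_assoc, mul_assoc, he.ortho hx, mul_zero, mul_zero]
    exact zero_mem _

variable [IsAlgClosed k] [FiniteDimensional k A] {he : IsBasicDecomposition e}

/-- Positive length matters: the zeroth power is the span of 1, which need not contain the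
idempotent of a single vertex. -/
theorem evalPath_mem_jacobsonSpace (hb : HasNoDoubleBypass V) (he : IsBasicDecomposition e)
    (hf : IsPeirceSystem k e f) {x y : V} (p : Quiver.Path x y) (hp : 0 < p.length) :
    evalPath e f p ∈ jacobsonSpace k A ^ p.length := by
  induction p with
  | nil => simp at hp
  | cons p a ih =>
    have ha : f a ∈ jacobsonSpace k A := he.mem_jacobsonSpace (hb.ne_of_hom a) (hf a)
    cases p with
    | nil =>
      change evalPath e f a.toPath ∈ jacobsonSpace k A ^ 1
      rwa [evalPath_toPath hf, pow_one]
    | cons p b =>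
      rw [Quiver.Path.length_cons, pow_succ']
      exact Submodule.mul_mem_mul ha (ih (by simp))

/-- Arrows that are not in the square of the radical generate the algebra. -/
theorem exists_evalLin_eq (hQ : IsOrdinaryQuiver k V (IdemCat k he) (IdemCat.ob k he))
    (hb : HasNoDoubleBypass V) (hf : IsPeirceSystem k e f)
    (hrad : ∀ ⦃x y : V⦄ (a : x ⟶ y), f a ∉ radSqVal k he x y) {x y : V} {m : A}
    (hm : m ∈ peirceSpace k (e y) (e x)) : ∃ r, evalLin k e f x y r = m := by
  set J := jacobsonSpace k A with hJ
  set T := evalSpace k e f with hT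
  -- Modulo the square of the radical, a Peirce component is a multiple of the value of the only
  -- arrow, or zero if there is none.
  have hstep : J ≤ (T ⊓ J) ⊔ J ^ 2 := by
    intro b hbJ
    rw [eq_sum_peirce he b]
    refine Submodule.sum_mem _ fun y _ => Submodule.sum_mem _ fun x _ => ?_
    have hc := mul_mul_mem_peirceSpace (k := k) he x y b
    have hcJ : e y * b * e x ∈ J :=
      mul_mem_jacobsonSpace_right _ (mul_mem_jacobsonSpace_left _ hbJ)
    obtain ⟨h₁, h₂⟩ := hQ.exists_sub_smul_mem_radSqVal hb hc hcJ
    have hle : radSqVal k he x y ≤ (T ⊓ J) ⊔ J ^ 2 := by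
      rw [pow_two]
      exact (radSqVal_le_jacobsonSpace_sq he x y).trans le_sup_right
    rcases isEmpty_or_nonempty (x ⟶ y) with hE | hN
    · exact hle (h₁ hE)
    · obtain ⟨a⟩ := hN
      obtain ⟨c, hc'⟩ := (h₂ ⟨a⟩).2 (f a) (hf a) (hrad a)
      rw [← sub_add_cancel (e y * b * e x) (c • f a)]
      refine Submodule.add_mem _ (hle hc') (Submodule.mem_sup_left (Submodule.smul_mem _ c ⟨?_, ?_⟩))
      · exact mem_evalSpace he (hf a) ⟨_, (evalLin_single a.toPath).trans (evalPath_toPath hf a)⟩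
      · exact he.mem_jacobsonSpace (hb.ne_of_hom a) (hf a)
  have hpow : ∀ n, J ^ (n + 1) ≤ (T ⊓ J) ^ (n + 1) ⊔ J ^ (n + 2) := by
    intro n
    induction n with
    | zero => simpa using hstep
    | succ n ih =>
      have hTJ : (T ⊓ J) ^ (n + 1) ≤ J ^ (n + 1) := pow_le_pow_left' inf_le_right _
      calc J ^ (n + 1 + 1) = J ^ (n + 1) * J := pow_succ _ _
        _ ≤ ((T ⊓ J) ^ (n + 1) ⊔ J ^ (n + 2)) * ((T ⊓ J) ⊔ J ^ 2) := mul_le_mul' ih hstep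
        _ ≤ (T ⊓ J) ^ (n + 1 + 1) ⊔ J ^ (n + 1 + 2) := by
          rw [Submodule.sup_mul, Submodule.mul_sup, Submodule.mul_sup]
          refine sup_le (sup_le ?_ ?_) (sup_le ?_ ?_)
          · rw [← pow_succ]
            exact le_sup_left
          · refine le_trans (mul_le_mul' hTJ le_rfl) ?_
            rw [← pow_add]
            exact le_sup_right
          · refine le_trans (mul_le_mul' le_rfl inf_le_right) ?_
            rw [← pow_succ]
            exact le_sup_right
          · refine le_trans (mul_le_mul' le_rfl (?_ : J ^ 2 ≤ J)) ?_
            · rw [pow_two]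
              exact Submodule.mul_le.2 fun b _ c hc => mul_mem_jacobsonSpace_left b hc
            · rw [← pow_succ]
              exact le_sup_right
  have hTpow : ∀ n, (T ⊓ J) ^ (n + 1) ≤ T := by
    intro n
    induction n with
    | zero => simp
    | succ n ih =>
      rw [pow_succ]
      exact (mul_le_mul' ih inf_le_left).trans (evalSpace_mul_le he hf)
  have hall : ∀ n, J ≤ T ⊔ J ^ (n + 1) := by
    intro n
    induction n with
    | zero => simp
    | succ n ih =>
      exact ih.trans (sup_le le_sup_left ((hpow n).trans
        (sup_le ((hTpow n).trans le_sup_left) le_sup_right)))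
  -- The radical is nilpotent, so approximation modulo all its powers is exact.
  have hJT : J ≤ T := by
    obtain ⟨n, hn⟩ := exists_jacobsonSpace_pow_eq_bot (k := k) (A := A)
    have := hall n
    rwa [pow_succ, hJ, hn, Submodule.bot_mul, sup_bot_eq] at this
  have hTm : ∀ b ∈ J, b ∈ peirceSpace k (e y) (e x) → ∃ r, evalLin k e f x y r = b := by
    intro b hbJ hbP
    have := hJT hbJ x y
    rwa [hbP.1, hbP.2] at this
  -- At a single vertex the identity contributes too; it is the value of the trivial path.
  by_cases hxy : x = y
  · subst hxy
    obtain ⟨c, hc⟩ := exists_sub_smul_id_mem_jacobson (he := he) ⟨x⟩ ⟨m, hm⟩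
    obtain ⟨r, hr⟩ := hTm _ hc (Submodule.sub_mem _ hm
      (Submodule.smul_mem _ c ⟨he.idem x, he.idem x⟩))
    refine ⟨r + c • Finsupp.single Quiver.Path.nil 1, ?_⟩
    rw [map_add, hr, map_smul, evalLin_single]
    exact sub_add_cancel _ _
  · exact hTm m (he.mem_jacobsonSpace hxy hm) hm

theorem evalPath_mem_radSqVal (hb : HasNoDoubleBypass V) (he : IsBasicDecomposition e)
    (hf : IsPeirceSystem k e f) {x y : V} (p : Quiver.Path x y) (hp : 2 ≤ p.length) :
    evalPath e f p ∈ radSqVal k he x y := by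
  have hJ : ∀ {z t : V} (a : z ⟶ t), f a ∈ jacobsonSpace k A := fun a =>
    he.mem_jacobsonSpace (hb.ne_of_hom a) (hf a)
  cases p with
  | nil => simp at hp
  | cons p a =>
    cases p with
    | nil => simp at hp
    | cons p b =>
      refine mul_mem_radSqVal he (evalPath_mem he hf _) (hf a) ?_ (hJ a)
      exact mul_mem_jacobsonSpace_right _ (hJ b)

/-- The kernel of an evaluation whose values at the arrows are not in the square of the radical is
admissible. -/
theorem evalKer_isAdmissible (hb : HasNoDoubleBypass V) (hf : IsPeirceSystem k e f)
    (hrad : ∀ ⦃x y : V⦄ (a : x ⟶ y), f a ∉ radSqVal k he x y) :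
    (evalKer k he hf).IsAdmissible := by
  constructor
  · intro x y r hr p hp
    rw [Finsupp.mem_support_iff] at hp
    have hr0 : evalLin k e f x y r = 0 := hr
    by_contra hlt
    cases p with
    | nil =>
      have hnil : r = r Quiver.Path.nil • Finsupp.single Quiver.Path.nil 1 := by
        ext q
        rw [hb.eq_nil q]
        simp
      rw [hnil, map_smul, evalLin_single] at hr0
      exact he.ne_zero x ((smul_eq_zero.1 hr0).resolve_left hp)
    | cons p a =>
      cases p with
      | cons p b => simp at hlt
      | nil =>
        -- Apart from the arrow, all paths in the relation have length at least two and values in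
        -- the square of the radical. A nonzero coefficient at the arrow would place its value there
        -- too.
        have h₁ : evalLin k e f x y (r - r a.toPath • Finsupp.single a.toPath 1) ∈
            radSqVal k he x y := by
          refine evalLin_mem_of_support _ _ fun q hq => ?_
          refine evalPath_mem_radSqVal hb he hf q (hb.length_ge_two a q ?_)
          rintro rfl
          simp at hq
        rw [map_sub, hr0, zero_sub, map_smul, evalLin_single, evalPath_toPath hf,
          Submodule.neg_mem_iff] at h₁
        exact hrad a ((Submodule.smul_mem_iff _ (show r a.toPath ≠ 0 from hp)).1 h₁)
  · intro x
    obtain ⟨n, hn⟩ := exists_jacobsonSpace_pow_eq_bot (k := k) (A := A)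
    -- Here `n` is a vanishing exponent of the radical; the added two meets the lower bound required
    -- by admissibility and keeps the lengths positive.
    have key : ∀ (y z : V) (p : Quiver.Path y z), n + 2 ≤ p.length →
        Finsupp.single p 1 ∈ (evalKer k he hf).sub y z := by
      intro y z p hp
      change evalLin k e f y z (Finsupp.single p 1) = 0
      rw [evalLin_single]
      have := evalPath_mem_jacobsonSpace (k := k) hb he hf p (by omega)
      rw [show p.length = n + (p.length - n) by omega, pow_add, hn, Submodule.bot_mul] at this
      exact this
    exact ⟨n + 2, by omega, fun y p => key x y p, fun y p => key y x p⟩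

end Generation

/-! ### Generating systems and presentations -/

section PresentationSystems

variable {k : Type w} [Field k] {A : Type*} [Ring A] [Algebra k A]
  {V : Type u} [Quiver.{v} V] [Fintype V] {e : V → A} {he : IsBasicDecomposition e}

variable (he) in
/-- `f` is a system of elements of `A` for the arrows of the quiver, in the right Peirce spaces and
outside the square of the radical, and `I` is the ideal of the relations between them. -/
structure IsGeneratingSystem (I : PathIdeal k V) (f : ∀ ⦃x y : V⦄, (x ⟶ y) → A) : Prop where
  peirce : IsPeirceSystem k e f
  notMem : ∀ ⦃x y : V⦄ (a : x ⟶ y), f a ∉ radSqVal k he x y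
  mem_iff : ∀ ⦃x y : V⦄ (r : PathSpace k x y), r ∈ I.sub x y ↔ evalLin k e f x y r = 0

theorem IsGeneratingSystem.le_ker {I : PathIdeal k V} {f : ∀ ⦃x y : V⦄, (x ⟶ y) → A}
    (h : IsGeneratingSystem he I f) (x y : V) : I.sub x y ≤ LinearMap.ker (evalLin k e f x y) :=
  fun r hr => (h.mem_iff r).1 hr

/-- The system consists of the images of the arrows. Admissibility is what keeps them outside the
square of the radical. -/
theorem IsPresentation.exists_isGeneratingSystem [IsAlgClosed k] [FiniteDimensional k A]
    (hb : HasNoDoubleBypass V) {I : PathIdeal k V} {φ : BoundCat I ⥤ IdemCat k he}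
    (h : IsPresentation I φ) : ∃ f, IsGeneratingSystem he I f := by
  have hadd := h.additive
  have hlin := h.linear
  have hfull := h.full
  have hfaith := h.faithful
  have hv : ∀ x : V, (φ.obj ⟨x⟩).vertex = x := fun x => congrArg IdemCat.vertex (h.obj_eq x)
  let q : ∀ x y : V, PathSpace k x y →ₗ[k] ((⟨x⟩ : BoundCat I) ⟶ ⟨y⟩) := fun x y => (I.sub x y).mkQ
  let F : ∀ x y : V, PathSpace k x y →ₗ[k] A := fun x y =>
    homVal _ _ ∘ₗ (φ.mapLinearMap k) ∘ₗ q x y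
  have hFmem : ∀ x y r, F x y r ∈ peirceSpace k (e y) (e x) := fun x y r => by
    have := homVal_mem (φ.map (q x y r))
    rwa [hv, hv] at this
  let f : ∀ ⦃x y : V⦄, (x ⟶ y) → A := fun x y a => F x y (Finsupp.single a.toPath 1)
  have hf : IsPeirceSystem k e f := fun x y a => hFmem x y _
  have hFmul : ∀ {x y z : V} (r : PathSpace k x y) (s : PathSpace k y z),
      F x z (pathMul k x y z r s) = F y z s * F x y r := fun {x y z} r s => by
    have h1 : q x z (pathMul k x y z r s) = q x y r ≫ q y z s := rfl
    change homVal _ _ (φ.map (q x z (pathMul k x y z r s))) = _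
    rw [h1, φ.map_comp, homVal_comp]
    rfl
  have hF : ∀ x y, evalLin k e f x y = F x y := fun x y => by
    refine Finsupp.lhom_ext' fun p => LinearMap.ext_ring ?_
    simp only [LinearMap.comp_apply, Finsupp.lsingle_apply, evalLin_single]
    induction p with
    | nil =>
      have h1 : q x x (Finsupp.single Quiver.Path.nil 1) = 𝟙 _ := rfl
      change e x = homVal _ _ (φ.map (q x x (Finsupp.single Quiver.Path.nil 1)))
      rw [h1, φ.map_id, homVal_id, hv]
    | cons p a ih => rw [evalPath, ih, single_cons, hFmul]
  have hker : ∀ ⦃x y : V⦄ (r : PathSpace k x y), r ∈ I.sub x y ↔ evalLin k e f x y r = 0 := by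
    intro x y r
    rw [hF]
    have h1 : r ∈ I.sub x y ↔ q x y r = 0 := (Submodule.Quotient.mk_eq_zero _).symm
    rw [h1]
    constructor
    · intro h0
      change homVal _ _ (φ.map (q x y r)) = 0
      rw [h0, φ.map_zero, map_zero]
    · intro h0
      refine φ.map_injective ?_
      rw [φ.map_zero]
      exact homVal_injective _ _ (h0.trans (map_zero _).symm)
  have hsurj : ∀ x y, ∀ m ∈ peirceSpace k (e y) (e x), ∃ r, evalLin k e f x y r = m := by
    intro x y m hm
    obtain ⟨g, hg⟩ := φ.map_surjective (X := ⟨x⟩) (Y := ⟨y⟩) ⟨m, by rwa [hv, hv]⟩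
    obtain ⟨r, rfl⟩ := Submodule.mkQ_surjective (I.sub x y) g
    exact ⟨r, by rw [hF]; exact congrArg (homVal _ _) hg⟩
  -- Radical elements need no trivial path: at one vertex the trivial path is the only one, and a
  -- nonzero multiple of an idempotent is not in the radical.
  have hpos : ∀ x y, ∀ m ∈ peirceSpace k (e y) (e x), m ∈ jacobsonSpace k A →
      ∃ r, (∀ p, r p ≠ 0 → 1 ≤ p.length) ∧ evalLin k e f x y r = m := by
    intro x y m hm hmJ
    obtain ⟨r, hr⟩ := hsurj x y m hm
    by_cases hxy : x = y
    · subst hxy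
      have hnil : r = r Quiver.Path.nil • Finsupp.single Quiver.Path.nil 1 := by
        ext p
        rw [hb.eq_nil p]
        simp
      refine ⟨0, fun p hp => (hp rfl).elim, ?_⟩
      have hJ : r Quiver.Path.nil • e x ∈ jacobsonSpace k A := by
        rw [hnil, map_smul, evalLin_single] at hr
        rwa [← hr] at hmJ
      have h0 : r Quiver.Path.nil = 0 := by
        by_contra hne
        obtain ⟨n, hn⟩ := exists_jacobsonSpace_pow_eq_bot (k := k) (A := A)
        have h2 := Submodule.pow_mem_pow _ ((Submodule.smul_mem_iff _ hne).1 hJ) (n + 1)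
        rw [pow_succ (jacobsonSpace k A), hn, Submodule.bot_mul, (he.idem _).pow_succ_eq] at h2
        exact he.ne_zero _ h2
      rw [map_zero, ← hr, hnil, h0, zero_smul, map_zero]
    · refine ⟨r, fun p _ => ?_, hr⟩
      by_contra hlt
      exact hxy (p.eq_of_length_zero (by omega))
  refine ⟨f, hf, fun x y a ha => ?_, hker⟩
  -- Products of two radical elements are thus values of combinations of paths of length at least
  -- two.
  have hle : radSqVal k he x y ≤
      (Finsupp.supported k k {p : Quiver.Path x y | 2 ≤ p.length}).map (evalLin k e f x y) := by
    refine radSqVal_le he fun z m n hm hn hmJ hnJ => ?_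
    obtain ⟨r, hr, rfl⟩ := hpos x z m hm hmJ
    obtain ⟨s, hs, rfl⟩ := hpos z y n hn hnJ
    refine ⟨pathMul k x z y r s, ?_, evalLin_pathMul he hf r s⟩
    intro p hp
    obtain ⟨p₁, p₂, h₁, h₂, rfl⟩ :=
      exists_of_pathMul_apply_ne_zero (Finsupp.mem_support_iff.1 hp)
    change 2 ≤ (p₁.comp p₂).length
    have := hr p₁ h₁
    have := hs p₂ h₂
    rw [Quiver.Path.length_comp]
    omega
  obtain ⟨r, hr, hra⟩ := hle ha
  -- If the arrow's value were in the square of the radical, this would be a relation with a term of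
  -- length one.
  have hmem : Finsupp.single a.toPath 1 - r ∈ I.sub x y := by
    rw [hker, map_sub, evalLin_single, evalPath_toPath hf, hra, sub_self]
  have := h.admissible.length_ge_two x y _ hmem a.toPath (by
    rw [Finsupp.mem_support_iff, Finsupp.sub_apply, Finsupp.single_eq_same]
    have : r a.toPath = 0 := by
      by_contra hne
      have : 2 ≤ a.toPath.length := hr (Finsupp.mem_support_iff.2 hne)
      simp at this
    rw [this, sub_zero]
    exact one_ne_zero)
  simp at this

variable [IsAlgClosed k] [FiniteDimensional k A]

theorem IsGeneratingSystem.isPresentation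
    (hQ : IsOrdinaryQuiver k V (IdemCat k he) (IdemCat.ob k he)) (hb : HasNoDoubleBypass V)
    {I : PathIdeal k V} {f : ∀ ⦃x y : V⦄, (x ⟶ y) → A} (h : IsGeneratingSystem he I f) :
    IsPresentation I (evalFunctor he h.peirce I h.le_ker) where
  admissible := by
    have : I = evalKer k he h.peirce := by
      ext x y r
      exact h.mem_iff r
    rw [this]
    exact evalKer_isAdmissible hb h.peirce h.notMem
  additive := ⟨fun {_ _ m n} => Subtype.ext (map_add (Submodule.liftQ _ _ _) m n)⟩
  linear := ⟨fun {_ _} m c => Subtype.ext (map_smul (Submodule.liftQ _ _ _) c m)⟩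
  obj_eq _ := rfl
  full := ⟨fun {x y} m => by
    obtain ⟨r, hr⟩ := exists_evalLin_eq hQ hb h.peirce h.notMem m.2
    exact ⟨(I.sub _ _).mkQ r, Subtype.ext hr⟩⟩
  faithful := ⟨fun {x y} m n hmn => by
    obtain ⟨m, rfl⟩ := Submodule.mkQ_surjective _ m
    obtain ⟨n, rfl⟩ := Submodule.mkQ_surjective _ n
    have : evalLin k e f x.vertex y.vertex m = evalLin k e f x.vertex y.vertex n :=
      congrArg Subtype.val hmn
    refine (Submodule.Quotient.eq _).2 ((h.mem_iff _).2 ?_)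
    rw [map_sub, this, sub_self]⟩

theorem exists_isGeneratingSystem
    (hQ : IsOrdinaryQuiver k V (IdemCat k he) (IdemCat.ob k he)) (hb : HasNoDoubleBypass V) :
    ∃ (I : PathIdeal k V) (f : _), IsGeneratingSystem he I f := by
  have : ∀ (x y : V) (_ : x ⟶ y), ∃ n ∈ peirceSpace k (e y) (e x), n ∉ radSqVal k he x y :=
    fun x y a => ((hQ.exists_sub_smul_mem_radSqVal hb (m := 0) (zero_mem _) (zero_mem _)).2 ⟨a⟩).1
  choose f hf hf' using this
  exact ⟨evalKer k he (f := f) hf, f, hf, hf', fun x y r => Iff.rfl⟩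

/-- The new values differ from the old ones by elements of the square of the radical, so they stay
outside it. -/
theorem IsGeneratingSystem.comapUnipotent (hb : HasNoDoubleBypass V)
    {I : PathIdeal k V} {f : ∀ ⦃x y : V⦄, (x ⟶ y) → A} (h : IsGeneratingSystem he I f)
    {τ : ∀ x y : V, PathSpace k x y} (hτ : IsTail τ) :
    IsGeneratingSystem he (I.comapUnipotent τ)
      (fun x y a => evalLin k e f x y (Finsupp.single a.toPath 1 + τ x y)) where
  peirce x y a := evalLin_mem he h.peirce _
  notMem x y a ha := by
    rw [map_add, evalLin_single, evalPath_toPath h.peirce] at ha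
    refine h.notMem a ((Submodule.add_mem_iff_left _ ?_).1 ha)
    exact evalLin_mem_of_support _ _ fun p hp =>
      evalPath_mem_radSqVal hb he h.peirce p (hτ x y p hp)
  mem_iff x y r := by
    rw [PathIdeal.mem_comapUnipotent, h.mem_iff, unipotent, evalLin_subst he h.peirce]

/-- Two generating systems are related by a dilatation and a unipotent endomorphism. -/
theorem IsGeneratingSystem.exists_dilatation_unipotent
    (hQ : IsOrdinaryQuiver k V (IdemCat k he) (IdemCat.ob k he)) (hb : HasNoDoubleBypass V)
    {I I' : PathIdeal k V} {f f' : ∀ ⦃x y : V⦄, (x ⟶ y) → A} (h : IsGeneratingSystem he I f)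
    (h' : IsGeneratingSystem he I' f') :
    ∃ (t : V → V → k) (τ : ∀ x y : V, PathSpace k x y), (∀ x y, t x y ≠ 0) ∧ IsTail τ ∧
      ∀ ⦃x y : V⦄ (r : PathSpace k x y), r ∈ I'.sub x y ↔
        unipotent τ x y (dilatation t x y r) ∈ I.sub x y := by
  classical
  have hex : ∀ x y : V, ∃ (t : k) (τ : PathSpace k x y), t ≠ 0 ∧ (∀ p, τ p ≠ 0 → 2 ≤ p.length) ∧
      ∀ a : x ⟶ y, evalLin k e f x y (t • (Finsupp.single a.toPath 1 + τ)) = f' a := by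
    intro x y
    rcases isEmpty_or_nonempty (x ⟶ y) with hE | ⟨⟨a⟩⟩
    -- Without an arrow the scalar is arbitrary but nonzero, and the tail must be zero or long; 1
    -- and 0 will do.
    · exact ⟨1, 0, one_ne_zero, fun p hp => (hp rfl).elim, fun a => hE.elim a⟩
    · obtain ⟨s, hs⟩ := exists_evalLin_eq hQ hb h.peirce h.notMem (h'.peirce a)
      have hlen : ∀ p : Quiver.Path x y, (s - s a.toPath • Finsupp.single a.toPath 1 : PathSpace k x y) p ≠ 0 → 2 ≤ p.length := by
        refine fun p hp => hb.length_ge_two a p ?_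
        rintro rfl
        simp at hp
      -- The scalar is the coefficient of the arrow in an expression of the new value; were it zero,
      -- that value would lie in the square of the radical. The tail is the rest divided by it.
      have ht : s a.toPath ≠ 0 := by
        intro h0
        rw [h0, zero_smul, sub_zero] at hlen
        refine h'.notMem a (hs ▸ evalLin_mem_of_support _ _ fun p hp => ?_)
        exact evalPath_mem_radSqVal hb he h.peirce p (hlen p hp)
      refine ⟨s a.toPath, (s a.toPath)⁻¹ • (s - s a.toPath • Finsupp.single a.toPath 1), ht,
        fun p hp => hlen p fun h0 => hp ?_, fun b => ?_⟩
      · rw [Finsupp.smul_apply, h0, smul_zero]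
      · have := hb.subsingleton_hom x y
        rw [Subsingleton.elim b a, smul_add, smul_smul, mul_inv_cancel₀ ht, one_smul,
          add_sub_cancel, hs]
  choose t τ ht hτ hev using hex
  refine ⟨t, τ, ht, hτ, fun x y r => ?_⟩
  rw [h.mem_iff, h'.mem_iff, unipotent, dilatation, subst_subst, evalLin_subst he h.peirce]
  have : (fun (x y : V) (a : x ⟶ y) => evalLin k e f x y
      (subst (fun x y a => Finsupp.single a.toPath 1 + τ x y) x y
        (t x y • Finsupp.single a.toPath 1))) = f' := by
    funext x y a
    rw [map_smul, subst_toPath, hev]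
  rw [this]

end PresentationSystems

/-! ### The source of the quiver of homotopy relations -/

section Source

variable {k : Type w} [Field k] {A : Type*} [Ring A] [Algebra k A]
  {V : Type u} [Quiver.{v} V]

theorem PathIdeal.preservesHomotopy_dilatation (I : PathIdeal k V) (t : V → V → k) :
    I.PreservesHomotopy fun x y a => t x y • Finsupp.single a.toPath 1 := by
  intro x y a q hq
  obtain rfl : a.toPath = q := by
    by_contra hne
    refine hq ?_
    rw [Finsupp.smul_apply, Finsupp.single_eq_of_ne (Ne.symm hne), smul_zero]
  exact .refl _

/-- A dilatation and its inverse both send arrows to multiples of themselves, so they respect every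
homotopy relation and give both inclusions. -/
theorem PathIdeal.homotopyRel_eq_of_dilatation {I J : PathIdeal k V} {t : V → V → k}
    (ht : ∀ x y, t x y ≠ 0)
    (h : ∀ ⦃x y : V⦄ (r : PathSpace k x y), r ∈ I.sub x y ↔ dilatation t x y r ∈ J.sub x y) :
    I.homotopyRel = J.homotopyRel := by
  have h₁ : I = J.comapSubst fun x y a => t x y • Finsupp.single a.toPath 1 := by
    ext x y r
    exact h r
  have h₂ : J = I.comapSubst fun x y a => (t x y)⁻¹ • Finsupp.single a.toPath 1 := by
    ext x y r
    change _ ↔ dilatation (fun x y => (t x y)⁻¹) x y r ∈ I.sub x y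
    rw [h, dilatation_inv t ht]
  refine homotopyRel_eq (fun x y c d hcd => ?_) (fun x y c d hcd => ?_)
  · rw [h₁] at hcd
    exact (J.preservesHomotopy_dilatation t).homotopic hcd
  · rw [h₂] at hcd
    exact (I.preservesHomotopy_dilatation _).homotopic hcd

/-- The homotopy relation of a direct predecessor is smaller. -/
theorem IsDirectSuccessor.homotopyLE {I J : PathIdeal k V}
    (h : IsDirectSuccessor k I.homotopyRel J.homotopyRel) :
    I.HomotopyLE J ∧ ¬ J.HomotopyLE I := by
  obtain ⟨I', J', φ, x, y, a, p, τ, -, -, hI, hJ, ⟨hbyp, ha, hother⟩, hmap, hn, hh⟩ := h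
  refine ⟨fun z t c d hcd => ?_, fun hle => hn ?_⟩
  · let s : ∀ ⦃x y : V⦄, (x ⟶ y) → PathSpace k x y := fun x y b =>
      φ.map x y (Finsupp.single b.toPath 1)
    -- An automorphism of the path category is determined by the arrows, so it is a substitution,
    -- compatible with the relation of the target ideal by hypothesis.
    have hφ : ∀ z t, (φ.map z t).toLinearMap = subst s z t :=
      pathSpace_map_ext (φ := fun z t => (φ.map z t).toLinearMap) φ.map_nil (subst_nil s)
        φ.map_mul (subst_pathMul s) (fun b => (subst_toPath s b).symm)
    have hI' : I' = J'.comapSubst s := by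
      ext z t r
      change _ ↔ subst s z t r ∈ J'.sub z t
      rw [← hφ, hmap]
      refine ⟨fun hr => ⟨r, hr, rfl⟩, ?_⟩
      rintro ⟨r', hr', e⟩
      rwa [(φ.map z t).injective e] at hr'
    have hs : J'.PreservesHomotopy s := by
      intro z t b q hq
      by_cases hba : (⟨z, t, b⟩ : Σ z t : V, (z ⟶ t)) = ⟨x, y, a⟩
      · cases hba
        simp only [s, ha] at hq
        by_cases h₁ : a.toPath = q
        · rw [← h₁]
          exact .refl _
        · obtain rfl : p = q := by
            by_contra hne
            refine hq ?_
            rw [Finsupp.add_apply, Finsupp.single_eq_of_ne (Ne.symm h₁), Finsupp.smul_apply,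
              Finsupp.single_eq_of_ne (Ne.symm hne), smul_zero, add_zero]
          exact hh
      · simp only [s, hother z t b hba] at hq
        obtain rfl : b.toPath = q := by
          by_contra hne
          exact hq (Finsupp.single_eq_of_ne (Ne.symm hne))
        exact .refl _
    have h₁ := PathIdeal.homotopyLE_of_eq hI c d hcd
    rw [hI'] at h₁
    exact PathIdeal.homotopyLE_of_eq hJ.symm c d (hs.homotopic h₁)
  · exact PathIdeal.homotopyLE_of_eq hI _ _ (hle _ _ (PathIdeal.homotopyLE_of_eq hJ.symm _ _ hh))

/-- The transvection that maps the arrow `x ⟶ y` to its sum with `c p`. -/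
def transvection (hb : HasNoDoubleBypass V) {x y : V} {p : Quiver.Path x y} (hp : 2 ≤ p.length)
    (c : k) : PathAut k V where
  map z t := LinearEquiv.ofLinearMap (unipotent (tailSingle p c) z t) (unipotent (-tailSingle p c) z t)
    (LinearMap.ext fun r => hb.unipotent_self_neg (isTail_tailSingle hp c) z t r)
    (LinearMap.ext fun r => hb.unipotent_neg_self (isTail_tailSingle hp c) z t r)
  map_nil z := subst_nil _ z
  map_mul r s := subst_pathMul _ r s

theorem transvection_map_apply (hb : HasNoDoubleBypass V) {x y : V} {p : Quiver.Path x y}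
    (hp : 2 ≤ p.length) (c : k) (z t : V) (r : PathSpace k z t) :
    (transvection hb hp c).map z t r = unipotent (tailSingle p c) z t r := rfl

theorem sub_eq_map_transvection (hb : HasNoDoubleBypass V) {x y : V} {p : Quiver.Path x y}
    (hp : 2 ≤ p.length) (c : k) (J : PathIdeal k V) (z t : V) :
    J.sub z t = ((J.comapUnipotent (tailSingle p c)).sub z t).map
      ((transvection hb hp c).map z t).toLinearMap := by
  have hsing := isTail_tailSingle hp c
  ext r
  rw [Submodule.mem_map]
  constructor
  · intro hr
    refine ⟨unipotent (-tailSingle p c) z t r, ?_, ?_⟩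
    · rwa [PathIdeal.mem_comapUnipotent, hb.unipotent_self_neg hsing]
    · rw [LinearEquiv.coe_coe, transvection_map_apply, hb.unipotent_self_neg hsing]
  · rintro ⟨r', hr', rfl⟩
    rw [LinearEquiv.coe_coe, transvection_map_apply]
    exact (PathIdeal.mem_comapUnipotent _ _).1 hr'

theorem transvection_isTransvection (hb : HasNoDoubleBypass V) {x y : V} (a : x ⟶ y)
    {p : Quiver.Path x y} (hp : 2 ≤ p.length) (c : k) :
    (transvection hb hp c).IsTransvection a p c := by
  refine ⟨?_, ?_, fun z t b hba => ?_⟩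
  · rintro rfl
    simp at hp
  · refine (unipotent_toPath a).trans ?_
    rw [tailSingle_self, Finsupp.smul_single, smul_eq_mul, mul_one]
  · refine (unipotent_toPath b).trans ?_
    have : tailSingle p c z t = 0 := by
      ext q
      by_contra hne
      cases eq_of_tailSingle_ne_zero hne
      have := hb.subsingleton_hom x y
      exact hba (by rw [Subsingleton.elim b a])
    rw [this, add_zero]

variable [Fintype V] {e : V → A} {he : IsBasicDecomposition e}

variable (he) in
/-- The homotopy relation of `I` is minimal among those of the presentations of `A`. -/
def IsHomotopyMinimal (I : PathIdeal k V) : Prop :=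
  ∀ (J : PathIdeal k V) (φ : BoundCat J ⥤ IdemCat k he), IsPresentation J φ →
    J.HomotopyLE I → I.HomotopyLE J

theorem IsHomotopyMinimal.of_eq {I J : PathIdeal k V} (hI : IsHomotopyMinimal he I)
    (h : I.homotopyRel = J.homotopyRel) : IsHomotopyMinimal he J := fun J' φ hφ hle _ _ c d hcd =>
  hI J' φ hφ (fun _ _ c d h' => PathIdeal.homotopyLE_of_eq h.symm c d (hle c d h')) c d
    (PathIdeal.homotopyLE_of_eq h.symm c d hcd)

/-- An arrow of `Γ` into this relation would start at a strictly smaller one. -/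
theorem IsHomotopyMinimal.isGammaSource {I : PathIdeal k V} {φ : BoundCat I ⥤ IdemCat k he}
    (hφ : IsPresentation I φ) (hmin : IsHomotopyMinimal he I) :
    IsGammaSource k he I.homotopyRel := by
  refine ⟨⟨I, φ, hφ, rfl⟩, ?_⟩
  rintro _ ⟨J, ψ, hψ, rfl⟩ hsucc
  exact hsucc.homotopyLE.2 (hmin J ψ hψ hsucc.homotopyLE.1)

variable [IsAlgClosed k] [FiniteDimensional k A]

/-- There are finitely many paths, so a presentation can be chosen with the fewest homotopic pairs
of parallel paths. Through homogeneity, these pairs determine the relation on all walks. -/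
theorem exists_isHomotopyMinimal (hfin : ∀ x y : V, Finite (Quiver.Path x y))
    (hQ : IsOrdinaryQuiver k V (IdemCat k he) (IdemCat.ob k he)) (hb : HasNoDoubleBypass V) :
    ∃ (I : PathIdeal k V) (φ : BoundCat I ⥤ IdemCat k he),
      IsPresentation I φ ∧ IsHomotopyMinimal he I := by
  let S : PathIdeal k V → Set (Σ x y : V, Quiver.Path x y × Quiver.Path x y) := fun I =>
    {b | I.Homotopic (Walk.ofPath b.2.2.1) (Walk.ofPath b.2.2.2)}
  obtain ⟨I₁, f₁, h₁⟩ := exists_isGeneratingSystem hQ hb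
  obtain ⟨I, ⟨φ, hφ⟩, hmin⟩ := (measure fun I => (S I).ncard).wf.has_min
    {I : PathIdeal k V | ∃ φ : BoundCat I ⥤ IdemCat k he, IsPresentation I φ}
    ⟨I₁, _, h₁.isPresentation hQ hb⟩
  refine ⟨I, φ, hφ, fun J ψ hψ hle x y c d hcd => ?_⟩
  have hsub : S J ⊆ S I := fun b hb => hle _ _ hb
  have hS : S J = S I := Set.eq_of_subset_of_ncard_le hsub (not_lt.1 (hmin J ⟨ψ, hψ⟩))
    (Set.toFinite _)
  have hrel : ∀ (x y : V) (p : Quiver.Path x y), (J.pathSetoid x y p : _ → Prop) =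
      I.pathSetoid x y p := by
    intro x y p
    funext q
    exact congrArg (fun T : Set (Σ x y : V, Quiver.Path x y × Quiver.Path x y) =>
      (⟨x, y, p, q⟩ : Σ x y : V, Quiver.Path x y × Quiver.Path x y) ∈ T) hS
  have hhom : I.HomogeneousFor J := fun x y r hr p => by
    rw [hrel]
    exact I.homogeneousFor_self x y r hr p
  exact hhom.homotopic hcd

/-- A presentation whose homotopy relation is minimal is obtained from any other presentation by a
dilatation and a unipotent endomorphism compatible with the homotopy relation of the latter. -/
theorem IsHomotopyMinimal.exists_homotopicTail [CharZero k]
    (hfin : ∀ x y : V, Finite (Quiver.Path x y))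
    (hQ : IsOrdinaryQuiver k V (IdemCat k he) (IdemCat.ob k he)) (hb : HasNoDoubleBypass V)
    {I₀ I : PathIdeal k V} {f₀ f : ∀ ⦃x y : V⦄, (x ⟶ y) → A}
    (h₀ : IsGeneratingSystem he I₀ f₀) (h : IsGeneratingSystem he I f)
    (hmin : IsHomotopyMinimal he I₀) :
    ∃ (t : V → V → k) (τ : ∀ x y : V, PathSpace k x y), (∀ x y, t x y ≠ 0) ∧ IsTail τ ∧
      I.HomotopicTail τ ∧ I₀.homotopyRel = (I.comapUnipotent τ).homotopyRel ∧
      ∀ ⦃x y : V⦄ (r : PathSpace k x y), r ∈ I₀.sub x y ↔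
        unipotent τ x y (dilatation t x y r) ∈ I.sub x y := by
  obtain ⟨t, σ, ht, hσ, hmem⟩ := h.exists_dilatation_unipotent hQ hb h₀
  have hrel : I₀.homotopyRel = (I.comapUnipotent σ).homotopyRel :=
    PathIdeal.homotopyRel_eq_of_dilatation ht fun x y r =>
      (hmem r).trans (I.mem_comapUnipotent _).symm
  -- Further inverse images under unipotent endomorphisms again come from presentations of `A`, so
  -- minimality among presentations applies.
  have hmin' : (I.comapUnipotent σ).IsUnipotentMinimal := by
    intro ρ hρ hle
    exact (hmin.of_eq hrel) _ _
      (((h.comapUnipotent hb hσ).comapUnipotent hb hρ).isPresentation hQ hb) hle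
  obtain ⟨τ, hτ, hIτ, e⟩ := hmin'.exists_homotopicTail hb hfin hσ
  rw [e] at hrel
  refine ⟨t, τ, ht, hτ, hIτ, hrel, fun x y r => ?_⟩
  rw [hmem, ← PathIdeal.mem_comapUnipotent, ← PathIdeal.mem_comapUnipotent, e]

/-- The minimal relation is contained in that of the source. If the inclusion were strict, the first
transvection at which the relation drops, read backwards, would be an arrow of `Γ` into the source.
-/
theorem IsGammaSource.eq_of_isHomotopyMinimal [CharZero k]
    (hfin : ∀ x y : V, Finite (Quiver.Path x y))
    (hQ : IsOrdinaryQuiver k V (IdemCat k he) (IdemCat.ob k he)) (hb : HasNoDoubleBypass V)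
    {I₀ : PathIdeal k V} {φ₀ : BoundCat I₀ ⥤ IdemCat k he} (hφ₀ : IsPresentation I₀ φ₀)
    (hmin : IsHomotopyMinimal he I₀) {R : WalkRel V} (hR : IsGammaSource k he R) :
    R = I₀.homotopyRel := by
  obtain ⟨⟨I, φ, hφ, rfl⟩, hsource⟩ := hR
  obtain ⟨f₀, h₀⟩ := hφ₀.exists_isGeneratingSystem hb
  obtain ⟨f, h⟩ := hφ.exists_isGeneratingSystem hb
  obtain ⟨t, τ, -, hτ, hIτ, hrel, -⟩ := hmin.exists_homotopicTail hfin hQ hb h₀ h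
  rw [hrel]
  refine PathIdeal.homotopyRel_eq (by_contra fun hne => ?_) hIτ.homotopyLE
  obtain ⟨σ, x, y, a, p, c, hσ, hσrel, hp, hap, hnap⟩ := hIτ.exists_transvection hb hfin hτ hne
  have hsing := isTail_tailSingle hp c
  have hJ' := (h.comapUnipotent hb (hσ.add hsing)).isPresentation hQ hb
  refine hsource _ ⟨_, _, hJ', rfl⟩ ⟨I.comapUnipotent (σ + tailSingle p c), I.comapUnipotent σ,
    transvection hb hp c, x, y, a, p, c, hJ'.admissible,
    ((h.comapUnipotent hb hσ).isPresentation hQ hb).admissible, rfl, hσrel.symm,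
    transvection_isTransvection hb a hp c, fun z s => ?_, hnap,
    PathIdeal.homotopyLE_of_eq hσrel.symm _ _ hap⟩
  rw [← PathIdeal.comapUnipotent_comapUnipotent hb I hsing hσ]
  exact sub_eq_map_transvection hb hp c _ z s

end Source

/-! ### Values of morphisms of a covering -/

section CoverValues

variable {k : Type w} [Field k] {A : Type*} [Ring A] [Algebra k A]
  {V : Type u} [Fintype V] {e : V → A} {he : IsBasicDecomposition e}
  {C : Type*} [Category* C]

/-- Values in `A` do not see transports along equalities of objects; comparing morphisms by their
values avoids those transports. -/
theorem homVal_comp_eqToHom {X Y Z : IdemCat k he} (f : X ⟶ Y) (h : Y = Z) :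
    homVal X Z (f ≫ eqToHom h) = homVal X Y f := by
  subst h
  simp

theorem homVal_eqToHom_comp {X Y Z : IdemCat k he} (h : X = Y) (f : Y ⟶ Z) :
    homVal X Z (eqToHom h ≫ f) = homVal Y Z f := by
  subst h
  simp

/-- Functors to `A` are equal if they agree on objects and their values on morphisms agree as
elements of `A`. -/
theorem idemCat_functor_ext {F G : C ⥤ IdemCat k he} (hobj : ∀ x, F.obj x = G.obj x)
    (hmap : ∀ {x y : C} (m : x ⟶ y), homVal _ _ (F.map m) = homVal _ _ (G.map m)) : F = G := by
  refine CategoryTheory.Functor.ext hobj fun x y m => homVal_injective _ _ ?_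
  rw [homVal_eqToHom_comp, homVal_comp_eqToHom, hmap]

theorem homVal_map_of_eq {F G : C ⥤ IdemCat k he} (h : F = G) {x y : C} (m : x ⟶ y) :
    homVal _ _ (F.map m) = homVal _ _ (G.map m) := by
  subst h
  rfl

/-- Functors that agree on objects and become equal after composition with a faithful functor are
equal. -/
theorem functor_eq_of_comp_faithful {D E : Type*} [Category* D] [Category* E] {F G : C ⥤ D}
    (P : D ⥤ E) [P.Faithful] (hobj : ∀ x, F.obj x = G.obj x) (h : F ⋙ P = G ⋙ P) : F = G := by
  refine CategoryTheory.Functor.ext hobj fun x y m => P.map_injective ?_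
  have := Functor.congr_hom h m
  simp only [Functor.comp_map] at this
  rw [this, P.map_comp, P.map_comp, eqToHom_map, eqToHom_map]

variable [Preadditive C]

/-- The value in `A` of an element of `⨁ C(z, z')`. -/
def fromVal (F : C ⥤ IdemCat k he) [F.Additive] (z : C) (b : IdemCat k he) :
    (DirectSum {z' : C // F.obj z' = b} fun z' => (z ⟶ z'.1)) →+ A :=
  (homVal (F.obj z) b).toAddMonoidHom.comp (coverMapFrom F z b)

/-- The value in `A` of an element of `⨁ C(z, z')`. -/
def toVal (F : C ⥤ IdemCat k he) [F.Additive] (b : IdemCat k he) (z' : C) :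
    (DirectSum {z : C // F.obj z = b} fun z => (z.1 ⟶ z')) →+ A :=
  (homVal b (F.obj z')).toAddMonoidHom.comp (coverMapTo F b z')

variable (F : C ⥤ IdemCat k he) [F.Additive]

open Classical in
theorem fromVal_of {z : C} {b : IdemCat k he} (z' : {z' : C // F.obj z' = b}) (m : z ⟶ z'.1) :
    fromVal F z b (DirectSum.of (fun z' : {z' : C // F.obj z' = b} => (z ⟶ z'.1)) z' m) =
      homVal _ _ (F.map m) := by
  change homVal _ _ (coverMapFrom F z b (DirectSum.of _ z' m)) = _
  rw [coverMapFrom, DirectSum.toAddMonoid_of]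
  exact homVal_comp_eqToHom _ _

open Classical in
theorem toVal_of {z' : C} {b : IdemCat k he} (z : {z : C // F.obj z = b}) (m : z.1 ⟶ z') :
    toVal F b z' (DirectSum.of (fun z : {z : C // F.obj z = b} => (z.1 ⟶ z')) z m) =
      homVal _ _ (F.map m) := by
  change homVal _ _ (coverMapTo F b z' (DirectSum.of _ z m)) = _
  rw [coverMapTo, DirectSum.toAddMonoid_of]
  exact homVal_eqToHom_comp _ _

open Classical in
theorem fromVal_eq_sum {z : C} {b : IdemCat k he}
    (d : DirectSum {z' : C // F.obj z' = b} fun z' => (z ⟶ z'.1)) :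
    fromVal F z b d = ∑ z' ∈ DFinsupp.support d, homVal _ _ (F.map (d z')) := by
  conv_lhs => rw [← DirectSum.sum_support_of d]
  rw [map_sum]
  exact Finset.sum_congr rfl fun z' _ => fromVal_of F z' (d z')

open Classical in
theorem toVal_eq_sum {z' : C} {b : IdemCat k he}
    (d : DirectSum {z : C // F.obj z = b} fun z => (z.1 ⟶ z')) :
    toVal F b z' d = ∑ z ∈ DFinsupp.support d, homVal _ _ (F.map (d z)) := by
  conv_lhs => rw [← DirectSum.sum_support_of d]
  rw [map_sum]
  exact Finset.sum_congr rfl fun z _ => toVal_of F z (d z)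

variable {F}

theorem IsCovering.fromVal_injective (hF : IsCovering F) (z : C) (b : IdemCat k he) :
    Function.Injective (fromVal F z b) :=
  (homVal_injective _ _).comp (hF.bijective_from z b).1

theorem IsCovering.toVal_injective (hF : IsCovering F) (b : IdemCat k he) (z' : C) :
    Function.Injective (toVal F b z') :=
  (homVal_injective _ _).comp (hF.bijective_to b z').1

theorem IsCovering.homVal_map_injective (hF : IsCovering F) {z z' : C} :
    Function.Injective fun m : z ⟶ z' => homVal _ _ (F.map m) := by
  classical
  intro m n h
  have h' : homVal _ _ (F.map m) = homVal _ _ (F.map n) := h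
  rw [← fromVal_of F (⟨z', rfl⟩ : {z'' : C // F.obj z'' = F.obj z'}) m,
    ← fromVal_of F (⟨z', rfl⟩ : {z'' : C // F.obj z'' = F.obj z'}) n] at h'
  exact DirectSum.of_injective (β := fun z'' : {z'' : C // F.obj z'' = F.obj z'} => (z ⟶ z''.1)) _
    (hF.fromVal_injective _ _ h')

theorem IsCovering.faithful (hF : IsCovering F) : F.Faithful :=
  ⟨fun {_ _ _ _} h => hF.homVal_map_injective (congrArg (homVal _ _) h)⟩

theorem IsCovering.exists_fromVal_eq (hF : IsCovering F) (z : C) (b : IdemCat k he) {a : A}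
    (ha : a ∈ peirceSpace k (e b.vertex) (e (F.obj z).vertex)) : ∃ d, fromVal F z b d = a := by
  obtain ⟨d, hd⟩ := (hF.bijective_from z b).2 ⟨a, ha⟩
  exact ⟨d, congrArg (homVal _ _) hd⟩

end CoverValues

/-! ### Lifting walks along a covering -/

section Lifting

variable {k : Type w} [Field k] {A : Type*} [Ring A] [Algebra k A]
  {V : Type u} [Fintype V] {e : V → A} {he : IsBasicDecomposition e}
  {C : Type*} [Category* C]

/-- The fibre of `F` over a vertex. -/
abbrev Fibre (F : C ⥤ IdemCat k he) (x : V) : Type _ := {z : C // F.obj z = (⟨x⟩ : IdemCat k he)}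

theorem Fibre.target_eq {F : C ⥤ IdemCat k he} {x y : V} {z : Fibre F x} {z' : Fibre F y}
    (h : z.1 = z'.1) : x = y := by
  have := z.2.symm.trans ((congrArg F.obj h).trans z'.2)
  exact congrArg IdemCat.vertex this

theorem Fibre.homVal_map_mem {F : C ⥤ IdemCat k he} {x y : V} {z : Fibre F x} {z' : Fibre F y}
    (m : z.1 ⟶ z'.1) : homVal _ _ (F.map m) ∈ peirceSpace k (e y) (e x) := by
  have h := homVal_mem (F.map m)
  rwa [congrArg IdemCat.vertex z.2, congrArg IdemCat.vertex z'.2] at h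

variable [Quiver.{v} V]

/-- The bijection between fibres given by a walk, if each arrow gives a bijection. -/
def walkEquiv {F : C ⥤ IdemCat k he} (σ : ∀ ⦃x y : V⦄, (x ⟶ y) → Fibre F x ≃ Fibre F y) {x : V} :
    ∀ {y : V}, Walk x y → (Fibre F x ≃ Fibre F y)
  | _, .nil => Equiv.refl _
  | _, .cons c a => (walkEquiv σ c).trans (σ a)
  | _, .consInv c a => (walkEquiv σ c).trans (σ a).symm

variable {F : C ⥤ IdemCat k he} (σ : ∀ ⦃x y : V⦄, (x ⟶ y) → Fibre F x ≃ Fibre F y)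

theorem walkEquiv_comp {x y z : V} (c : Walk x y) (d : Walk y z) :
    walkEquiv σ (c.comp d) = (walkEquiv σ c).trans (walkEquiv σ d) := by
  induction d with
  | nil => rfl
  | cons d a ih => rw [Walk.comp, walkEquiv, ih]; rfl
  | consInv d a ih => rw [Walk.comp, walkEquiv, ih]; rfl

/-- The elements `f a` lift to morphisms of `C` along the bijections `σ a`. -/
def IsLiftSystem (f : ∀ ⦃x y : V⦄, (x ⟶ y) → A)
    (σ : ∀ ⦃x y : V⦄, (x ⟶ y) → Fibre F x ≃ Fibre F y) : Prop :=
  ∀ ⦃x y : V⦄ (a : x ⟶ y) (z : Fibre F x), ∃ m : z.1 ⟶ (σ a z).1, homVal _ _ (F.map m) = f a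

variable {σ} {f : ∀ ⦃x y : V⦄, (x ⟶ y) → A}

theorem IsLiftSystem.exists_path (h : IsLiftSystem f σ) {x y : V} (p : Quiver.Path x y)
    (z : Fibre F x) : ∃ m : z.1 ⟶ (walkEquiv σ (Walk.ofPath p) z).1,
      homVal _ _ (F.map m) = evalPath e f p := by
  induction p with
  | nil =>
    refine ⟨𝟙 z.1, ?_⟩
    change homVal _ _ (F.map (𝟙 z.1)) = e x
    rw [F.map_id, homVal_id, z.2]
  | cons p a ih =>
    obtain ⟨m, hm⟩ := ih
    obtain ⟨n, hn⟩ := h a (walkEquiv σ (Walk.ofPath p) z)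
    refine ⟨m ≫ n, ?_⟩
    change homVal _ _ (F.map (m ≫ n)) = f a * evalPath e f p
    rw [F.map_comp, homVal_comp, hm, hn]

variable [Preadditive C] [Linear k C] [F.Additive] [F.Linear k]

-- The component at `z'` of the lifted value collects exactly the paths whose lift from `z` ends at
-- `z'`.
open Classical in
theorem IsLiftSystem.exists_fromVal (h : IsLiftSystem f σ) {x y : V} (r : PathSpace k x y)
    (z : Fibre F x) : ∃ d : DirectSum (Fibre F y) fun z' => (z.1 ⟶ z'.1),
      fromVal F z.1 ⟨y⟩ d = evalLin k e f x y r ∧ ∀ z' : Fibre F y, homVal _ _ (F.map (d z')) =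
        evalLin k e f x y (coordProj k (fun p => walkEquiv σ (Walk.ofPath p) z = z') r) := by
  induction r using Finsupp.induction_linear with
  | zero => exact ⟨0, by simp, fun z' => by simp⟩
  | add r s hr hs =>
    obtain ⟨d, h₁, h₂⟩ := hr
    obtain ⟨d', h₁', h₂'⟩ := hs
    refine ⟨d + d', by rw [map_add, map_add, h₁, h₁'], fun z' => ?_⟩
    rw [DirectSum.add_apply, F.map_add, map_add, h₂, h₂', map_add, map_add]
  | single p c =>
    obtain ⟨m, hm⟩ := h.exists_path p z
    have hc : homVal _ _ (F.map (c • m)) = evalLin k e f x y (Finsupp.single p c) := by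
      rw [F.map_smul, map_smul, hm, evalLin, Finsupp.linearCombination_single]
    refine ⟨DirectSum.of (fun z' : Fibre F y => (z.1 ⟶ z'.1)) (walkEquiv σ (Walk.ofPath p) z) (c • m),
      ?_, fun z' => ?_⟩
    · rw [fromVal_of, hc]
    · by_cases hz : walkEquiv σ (Walk.ofPath p) z = z'
      · subst hz
        rw [DirectSum.of_eq_same, coordProj_single_pos
          (s := fun p' => walkEquiv σ (Walk.ofPath p') z = walkEquiv σ (Walk.ofPath p) z) rfl, hc]
      · rw [DirectSum.of_eq_of_ne _ _ _ (Ne.symm hz), coordProj_single_neg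
          (s := fun p => walkEquiv σ (Walk.ofPath p) z = z') hz, F.map_zero, map_zero,
          map_zero]

/-- A combination of paths whose value lifts to a morphism `z ⟶ z'` may be replaced by its part
consisting of the paths that lift to paths from `z` to `z'`. -/
theorem IsLiftSystem.evalLin_coordProj (h : IsLiftSystem f σ) (hF : IsCovering F) {x y : V}
    {r : PathSpace k x y} {z : Fibre F x} {z' : Fibre F y} {m : z.1 ⟶ z'.1}
    (hm : evalLin k e f x y r = homVal _ _ (F.map m)) :
    evalLin k e f x y (coordProj k (fun p => walkEquiv σ (Walk.ofPath p) z = z') r) =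
      homVal _ _ (F.map m) := by
  classical
  obtain ⟨d, h₁, h₂⟩ := h.exists_fromVal r z
  -- The decomposition of a value over the fibre is unique, so it is concentrated at `z'`.
  have : d = DirectSum.of (fun z' : Fibre F y => (z.1 ⟶ z'.1)) z' m := by
    apply hF.fromVal_injective
    rw [h₁, fromVal_of, hm]
  rw [← h₂, this, DirectSum.of_eq_same]

theorem IsLiftSystem.evalLin_coordProj_eq_zero (h : IsLiftSystem f σ) (hF : IsCovering F) {x y : V}
    {r : PathSpace k x y} (hr : evalLin k e f x y r = 0) (z : Fibre F x) (z' : Fibre F y) :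
    evalLin k e f x y (coordProj k (fun p => walkEquiv σ (Walk.ofPath p) z = z') r) = 0 := by
  have := h.evalLin_coordProj hF (r := r) (z := z) (z' := z') (m := 0)
    (by rw [hr, F.map_zero, map_zero])
  rwa [F.map_zero, map_zero] at this

/-- Homotopic walks give the same bijection between fibres. -/
theorem IsLiftSystem.walkEquiv_eq (h : IsLiftSystem f σ) (hF : IsCovering F) {I : PathIdeal k V}
    (hI : ∀ ⦃x y : V⦄ (r : PathSpace k x y), r ∈ I.sub x y ↔ evalLin k e f x y r = 0) {x y : V}
    {c d : Walk x y} (hcd : I.Homotopic c d) : walkEquiv σ c = walkEquiv σ d := by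
  induction hcd with
  | refl c => rfl
  | symm _ ih => exact ih.symm
  | trans _ _ ih₁ ih₂ => exact ih₁.trans ih₂
  | comp _ _ ih₁ ih₂ => rw [walkEquiv_comp, walkEquiv_comp, ih₁, ih₂]
  | cons_consInv a => exact Equiv.self_trans_symm (σ a)
  | consInv_cons a => exact Equiv.symm_trans_self (σ a)
  | relation r hr p q hp hq =>
    refine Equiv.ext fun z => ?_
    -- The part of the relation formed by paths with a given lifted end point is again a relation,
    -- so by minimality all its paths lift to the same end point.
    have := hr.all_of_coordProj_mem (s := fun q => walkEquiv σ (Walk.ofPath q) z =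
      walkEquiv σ (Walk.ofPath p) z)
      ((hI _).2 (h.evalLin_coordProj_eq_zero hF ((hI _).1 hr.mem) z _)) hp hq rfl
    exact this.symm

end Lifting

/-! ### The group of a Galois covering and its fibres -/

section GroupAction

variable {k : Type w} [Field k] {A : Type*} [Ring A] [Algebra k A]
  {V : Type u} [Fintype V] {e : V → A} {he : IsBasicDecomposition e}
  {C : Type*} [Category* C] [Preadditive C] [Linear k C] {G : Type*} [Group G]
  {act : G → C ⥤ C} {F : C ⥤ IdemCat k he} [F.Additive]

/-- The action of the group of a Galois covering on a fibre. -/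
def IsGaloisCovering.fibreAct (hG : IsGaloisCovering k act F) (g : G) {x : V} (z : Fibre F x) :
    Fibre F x :=
  ⟨(act g).obj z.1, (Functor.congr_obj (hG.invariant g) z.1).trans z.2⟩

theorem IsGaloisCovering.fibreAct_mul (hG : IsGaloisCovering k act F) (g h : G) {x : V}
    (z : Fibre F x) : hG.fibreAct (g * h) z = hG.fibreAct g (hG.fibreAct h z) :=
  Subtype.ext (Functor.congr_obj (hG.act_mul g h) z.1)

theorem IsGaloisCovering.fibreAct_one (hG : IsGaloisCovering k act F) {x : V} (z : Fibre F x) :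
    hG.fibreAct 1 z = z :=
  Subtype.ext (Functor.congr_obj hG.act_one z.1)

/-- Each fibre is a regular `G`-set: the action is free on objects and transitive on fibres. -/
theorem IsGaloisCovering.fibreAct_bijective (hG : IsGaloisCovering k act F) {x : V}
    (z : Fibre F x) : Function.Bijective fun g : G => hG.fibreAct g z := by
  refine ⟨fun g h hgh => ?_, fun z' => ?_⟩
  · have hgh' : hG.fibreAct g z = hG.fibreAct h z := hgh
    have : hG.fibreAct (h⁻¹ * g) z = z := by
      rw [hG.fibreAct_mul, hgh', ← hG.fibreAct_mul, inv_mul_cancel, hG.fibreAct_one]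
    exact (inv_mul_eq_one.1 (hG.free _ _ (congrArg Subtype.val this))).symm
  · obtain ⟨g, hg⟩ := hG.transitive z.1 z'.1 (z.2.trans z'.2.symm)
    exact ⟨g, Subtype.ext hg⟩

theorem IsGaloisCovering.exists_equivariant (hG : IsGaloisCovering k act F) {x y : V}
    (z : Fibre F x) (z' : Fibre F y) : ∃ s : Fibre F x ≃ Fibre F y, s z = z' ∧
      ∀ (g : G) (z : Fibre F x), s (hG.fibreAct g z) = hG.fibreAct g (s z) := by
  let o := Equiv.ofBijective _ (hG.fibreAct_bijective z)
  let o' := Equiv.ofBijective _ (hG.fibreAct_bijective z')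
  have ho : ∀ g, (o.symm.trans o') (hG.fibreAct g z) = hG.fibreAct g z' := fun g =>
    congrArg o' (o.symm_apply_apply g)
  refine ⟨o.symm.trans o', ?_, fun g t => ?_⟩
  · have := ho 1
    rwa [hG.fibreAct_one, hG.fibreAct_one] at this
  · obtain ⟨h, rfl⟩ := o.surjective t
    change (o.symm.trans o') (hG.fibreAct g (hG.fibreAct h z)) =
      hG.fibreAct g ((o.symm.trans o') (hG.fibreAct h z))
    rw [← hG.fibreAct_mul, ho, ho, hG.fibreAct_mul]

variable [Quiver.{v} V]

theorem IsGaloisCovering.walkEquiv_fibreAct (hG : IsGaloisCovering k act F)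
    {σ : ∀ ⦃x y : V⦄, (x ⟶ y) → Fibre F x ≃ Fibre F y}
    (hσ : ∀ (g : G) ⦃x y : V⦄ (a : x ⟶ y) (z : Fibre F x),
      σ a (hG.fibreAct g z) = hG.fibreAct g (σ a z)) (g : G) {x y : V} (c : Walk x y)
    (z : Fibre F x) : walkEquiv σ c (hG.fibreAct g z) = hG.fibreAct g (walkEquiv σ c z) := by
  induction c with
  | nil => rfl
  | cons c a ih =>
    change σ a (walkEquiv σ c _) = hG.fibreAct g (σ a (walkEquiv σ c z))
    rw [ih, hσ]
  | consInv c a ih =>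
    change (σ a).symm (walkEquiv σ c _) = hG.fibreAct g ((σ a).symm (walkEquiv σ c z))
    rw [ih, Equiv.symm_apply_eq, hσ, Equiv.apply_symm_apply]

variable [IsAlgClosed k] [FiniteDimensional k A]

/-- Each arrow can be represented by an element of `A` that lifts to a morphism of the covering. -/
theorem IsGaloisCovering.exists_lift_arrow (hG : IsGaloisCovering k act F)
    (hQ : IsOrdinaryQuiver k V (IdemCat k he) (IdemCat.ob k he)) (hb : HasNoDoubleBypass V)
    {x y : V} (a : x ⟶ y) : ∃ (n : A) (s : Fibre F x ≃ Fibre F y),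
      n ∈ peirceSpace k (e y) (e x) ∧ n ∉ radSqVal k he x y ∧
      (∀ z, ∃ m : z.1 ⟶ (s z).1, homVal _ _ (F.map m) = n) ∧
      ∀ (g : G) (z : Fibre F x), s (hG.fibreAct g z) = hG.fibreAct g (s z) := by
  classical
  obtain ⟨⟨n, hn, hnrad⟩, -⟩ := (hQ.exists_sub_smul_mem_radSqVal hb (x := x) (y := y) (m := 0)
    (Submodule.zero_mem _) (Submodule.zero_mem _)).2 ⟨a⟩
  obtain ⟨z₀, hz₀⟩ := hG.covering.fibre_nonempty ⟨x⟩
  obtain ⟨d, hd⟩ := hG.covering.exists_fromVal_eq z₀ ⟨y⟩ (a := n) (by rwa [hz₀])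
  -- The components over the fibre add up to an element outside the square of the radical, so one of
  -- them is outside.
  have hex : ∃ z' : Fibre F y, homVal _ _ (F.map (d z')) ∉ radSqVal k he x y := by
    by_contra! h
    refine hnrad ?_
    rw [← hd, fromVal_eq_sum]
    exact Submodule.sum_mem _ fun z' _ => h z'
  obtain ⟨z', hz'⟩ := hex
  obtain ⟨s, hs, hequiv⟩ := hG.exists_equivariant ⟨z₀, hz₀⟩ z'
  refine ⟨_, s, ?_, hz', fun z => ?_, hequiv⟩
  · exact Fibre.homVal_map_mem (z := ⟨z₀, hz₀⟩) (d z')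
  -- The `G`-translates of that one component lift the same element from all other points, with end
  -- points given by the equivariant bijection.
  · obtain ⟨g, rfl⟩ := (hG.fibreAct_bijective ⟨z₀, hz₀⟩).2 z
    have e : s (hG.fibreAct g ⟨z₀, hz₀⟩) = hG.fibreAct g z' := by rw [hequiv, hs]
    change ∃ m : (hG.fibreAct g ⟨z₀, hz₀⟩).1 ⟶ (s (hG.fibreAct g ⟨z₀, hz₀⟩)).1, _
    rw [e]
    exact ⟨(act g).map (d z'), homVal_map_of_eq (hG.invariant g) (d z')⟩

theorem IsGaloisCovering.exists_isLiftSystem (hG : IsGaloisCovering k act F)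
    (hQ : IsOrdinaryQuiver k V (IdemCat k he) (IdemCat.ob k he)) (hb : HasNoDoubleBypass V) :
    ∃ (I : PathIdeal k V) (f : ∀ ⦃x y : V⦄, (x ⟶ y) → A)
      (σ : ∀ ⦃x y : V⦄, (x ⟶ y) → Fibre F x ≃ Fibre F y),
      IsGeneratingSystem he I f ∧ IsLiftSystem f σ ∧
      ∀ (g : G) ⦃x y : V⦄ (a : x ⟶ y) (z : Fibre F x),
        σ a (hG.fibreAct g z) = hG.fibreAct g (σ a z) := by
  choose f σ hf hrad hlift hequiv using
    fun (x y : V) (a : x ⟶ y) => hG.exists_lift_arrow hQ hb a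
  exact ⟨evalKer k he (f := f) hf, f, σ, ⟨hf, hrad, fun x y r => Iff.rfl⟩, hlift,
    fun g x y a z => hequiv x y a g z⟩

/-- The presentation with ideal `I₀` can be chosen so that the arrows lift to the covering. -/
theorem IsGaloisCovering.exists_isLiftSystem_of_isHomotopyMinimal [CharZero k]
    (hG : IsGaloisCovering k act F) (hfin : ∀ x y : V, Finite (Quiver.Path x y))
    (hQ : IsOrdinaryQuiver k V (IdemCat k he) (IdemCat.ob k he)) (hb : HasNoDoubleBypass V)
    {I₀ : PathIdeal k V} {φ₀ : BoundCat I₀ ⥤ IdemCat k he} (hφ₀ : IsPresentation I₀ φ₀)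
    (hmin : IsHomotopyMinimal he I₀) :
    ∃ (f : ∀ ⦃x y : V⦄, (x ⟶ y) → A) (σ : ∀ ⦃x y : V⦄, (x ⟶ y) → Fibre F x ≃ Fibre F y),
      IsGeneratingSystem he I₀ f ∧ IsLiftSystem f σ ∧
      ∀ (g : G) ⦃x y : V⦄ (a : x ⟶ y) (z : Fibre F x),
        σ a (hG.fibreAct g z) = hG.fibreAct g (σ a z) := by
  have hlin := hG.linear
  obtain ⟨f₀, h₀⟩ := hφ₀.exists_isGeneratingSystem hb
  obtain ⟨I, f, σ, h, hlift, hσ⟩ := hG.exists_isLiftSystem hQ hb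
  obtain ⟨t, τ, ht, hτ, hIτ, -, hmem⟩ := hmin.exists_homotopicTail hfin hQ hb h₀ h
  let s : ∀ ⦃x y : V⦄, (x ⟶ y) → PathSpace k x y := fun x y a =>
    t x y • (Finsupp.single a.toPath 1 + τ x y)
  refine ⟨fun x y a => evalLin k e f x y (s a), σ, ⟨fun x y a => evalLin_mem he h.peirce _, ?_, ?_⟩,
    ?_, hσ⟩
  · intro x y a hmem'
    rw [map_smul, map_add, evalLin_single, evalPath_toPath h.peirce] at hmem'
    rw [Submodule.smul_mem_iff _ (ht x y)] at hmem'
    refine h.notMem a ((Submodule.add_mem_iff_left _ ?_).1 hmem')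
    exact evalLin_mem_of_support _ _ fun p hp => evalPath_mem_radSqVal hb he h.peirce p (hτ x y p hp)
  · intro x y r
    rw [hmem, h.mem_iff, unipotent, dilatation, subst_subst, evalLin_subst he h.peirce]
    have : (fun (x y : V) (a : x ⟶ y) => evalLin k e f x y
        (subst (fun x y a => Finsupp.single a.toPath 1 + τ x y) x y
          (t x y • Finsupp.single a.toPath 1))) = fun x y a => evalLin k e f x y (s a) := by
      funext x y a
      rw [map_smul, subst_toPath]
    rw [this]
  · intro x y a z
    -- The tail is homotopic for `I`, so each path occurring in the new value lifts to the same end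
    -- point as the arrow. This is why the fibre bijections need not change.
    have hs : ∀ q, s a q ≠ 0 → walkEquiv σ (Walk.ofPath q) z = σ a z := by
      intro q hq
      by_cases h₁ : a.toPath = q
      · rw [← h₁]
        rfl
      · have : τ x y q ≠ 0 := by
          intro h0
          refine hq ?_
          rw [Finsupp.smul_apply, Finsupp.add_apply, Finsupp.single_eq_of_ne (Ne.symm h₁), h0,
            zero_add, smul_zero]
        exact (congrArg (· z) (hlift.walkEquiv_eq hG.covering h.mem_iff (hIτ a q this))).symm
    classical
    obtain ⟨d, -, hd⟩ := hlift.exists_fromVal (s a) z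
    refine ⟨d (σ a z), ?_⟩
    rw [hd, coordProj_eq_self hs]

end GroupAction

/-! ### Lifting functors along coverings -/

section LiftFunctor

variable {k : Type w} [Field k] {A : Type*} [Ring A] [Algebra k A]
  {V : Type u} [Fintype V] {e : V → A} {he : IsBasicDecomposition e}
  {C : Type*} [Category* C] [Preadditive C] {D : Type*} [Category* D]
  {F : C ⥤ IdemCat k he} [F.Additive] {P : D ⥤ IdemCat k he}

/-- A functor lifts along a covering if its values on objects and on morphisms do. -/
theorem IsCovering.exists_lift (hF : IsCovering F) (o : D → C)
    (ho : ∀ d, F.obj (o d) = P.obj d)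
    (hex : ∀ {c d : D} (h : c ⟶ d), ∃ m : o c ⟶ o d, homVal _ _ (F.map m) = homVal _ _ (P.map h)) :
    ∃ L : D ⥤ C, (∀ d, L.obj d = o d) ∧ L ⋙ F = P := by
  -- Lifts are unique, since a covering is injective on values, so arbitrary choices are functorial.
  choose lm hlm using fun (c d : D) (h : c ⟶ d) => hex h
  let L : D ⥤ C :=
    { obj := o
      map := fun {c d} h => lm c d h
      map_id := fun c => hF.homVal_map_injective <| by
        simp only
        rw [hlm, F.map_id, P.map_id, homVal_id, homVal_id, ho]
      map_comp := fun h h' => hF.homVal_map_injective <| by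
        simp only
        rw [hlm, F.map_comp, P.map_comp, homVal_comp, homVal_comp, hlm, hlm] }
  exact ⟨L, fun _ => rfl, idemCat_functor_ext ho fun h => hlm _ _ h⟩

variable [Preadditive D] {L : D ⥤ C}

theorem IsCovering.lift_additive [P.Additive] (hF : IsCovering F) (hL : L ⋙ F = P) :
    L.Additive where
  map_add {c d m n} := hF.homVal_map_injective <| by
    have h : ∀ m : c ⟶ d, homVal _ _ (F.map (L.map m)) = homVal _ _ (P.map m) :=
      fun m => homVal_map_of_eq hL m
    simp only [F.map_add, map_add, h, P.map_add]

theorem IsCovering.lift_linear [Linear k C] [Linear k D] [F.Linear k] [P.Linear k]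
    (hF : IsCovering F) (hL : L ⋙ F = P) : L.Linear k where
  map_smul {c d} m r := hF.homVal_map_injective <| by
    have h : ∀ m : c ⟶ d, homVal _ _ (F.map (L.map m)) = homVal _ _ (P.map m) :=
      fun m => homVal_map_of_eq hL m
    simp only [F.map_smul, map_smul, h, P.map_smul]

variable [L.Additive] [P.Additive]

/-- The fibre of `P` over `F b` is partitioned by `L` into its fibres over the points above `F b`,
so the decomposition along `P` refines that along `F`. The map for `L` is the block at `b`. -/
theorem IsCovering.coverMapFrom_lift_bijective (hF : IsCovering F) (hL : L ⋙ F = P)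
    (hP : ∀ x b, Function.Bijective (coverMapFrom P x b)) (x : D) (b : C) :
    Function.Bijective (coverMapFrom L x b) := by
  classical
  have hval : ∀ {c d : D} (m : c ⟶ d), homVal _ _ (P.map m) = homVal _ _ (F.map (L.map m)) :=
    fun m => (homVal_map_of_eq hL m).symm
  have hobj : ∀ y, P.obj y = F.obj (L.obj y) := fun y => (Functor.congr_obj hL y).symm
  have hof : ∀ (y : {y : D // L.obj y = b}) (m : x ⟶ y.1),
      coverMapFrom L x b (DirectSum.of (fun y : {y : D // L.obj y = b} => (x ⟶ y.1)) y m) =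
        L.map m ≫ eqToHom y.2 := fun y m => by
    rw [coverMapFrom, DirectSum.toAddMonoid_of]
    rfl
  have hPinj : Function.Injective (fromVal P x (F.obj b)) :=
    (homVal_injective _ _).comp (hP x (F.obj b)).1
  constructor
  · let ι : {y : D // L.obj y = b} → {y : D // P.obj y = F.obj b} := fun y =>
      ⟨y.1, (hobj y.1).trans (congrArg F.obj y.2)⟩
    -- Extension by zero from the block at `b`, so that injectivity for `P` can be used.
    let j : (DirectSum {y : D // L.obj y = b} fun y => (x ⟶ y.1)) →+
        (DirectSum {y : D // P.obj y = F.obj b} fun y => (x ⟶ y.1)) :=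
      DirectSum.toAddMonoid fun y =>
        DirectSum.of (fun y : {y : D // P.obj y = F.obj b} => (x ⟶ y.1)) (ι y)
    have h₁ : (fromVal P x (F.obj b)).comp j = ((homVal (F.obj (L.obj x)) (F.obj b)).toAddMonoidHom.comp
        F.mapAddHom).comp (coverMapFrom L x b) := by
      refine DirectSum.addHom_ext fun y m => ?_
      simp only [AddMonoidHom.comp_apply, j, DirectSum.toAddMonoid_of, hof]
      refine (fromVal_of P (ι y) m).trans ((hval m).trans ?_)
      change _ = homVal _ _ (F.map (L.map m ≫ eqToHom y.2))
      rw [F.map_comp, eqToHom_map, homVal_comp_eqToHom]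
    have h₂ : ∀ d y, j d (ι y) = d y := by
      intro d y
      induction d using DirectSum.induction_on with
      | zero => rw [map_zero]; rfl
      | add d d' hd hd' => rw [map_add, DirectSum.add_apply, DirectSum.add_apply, hd, hd']
      | of y' m =>
        simp only [j, DirectSum.toAddMonoid_of]
        by_cases h : y' = y
        · subst h
          rw [DirectSum.of_eq_same, DirectSum.of_eq_same]
        · rw [DirectSum.of_eq_of_ne _ _ _ (Ne.symm h)]
          exact DirectSum.of_eq_of_ne (β := fun y : {y : D // P.obj y = F.obj b} => (x ⟶ y.1))
            (ι y') (ι y) m fun h' => h (Subtype.ext (congrArg Subtype.val h').symm)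
    refine (injective_iff_map_eq_zero _).2 fun d hd => ?_
    have hj : j d = 0 := by
      apply hPinj
      have := DFunLike.congr_fun h₁ d
      simp only [AddMonoidHom.comp_apply, hd, map_zero] at this
      rw [this, map_zero]
    refine DFinsupp.ext fun y => ?_
    rw [← h₂ d y, hj]
    rfl
  · intro m
    -- `T` regroups a decomposition along `P` by the images under `L`; `R` keeps only the summands
    -- lying over `b`.
    let T : (DirectSum {y : D // P.obj y = F.obj b} fun y => (x ⟶ y.1)) →+
        (DirectSum {z : C // F.obj z = F.obj b} fun z => (L.obj x ⟶ z.1)) :=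
      DirectSum.toAddMonoid fun y =>
        (DirectSum.of (fun z : {z : C // F.obj z = F.obj b} => (L.obj x ⟶ z.1))
          ⟨L.obj y.1, (hobj y.1).symm.trans y.2⟩).comp L.mapAddHom
    let R : (DirectSum {y : D // P.obj y = F.obj b} fun y => (x ⟶ y.1)) →+
        (DirectSum {y : D // L.obj y = b} fun y => (x ⟶ y.1)) :=
      DirectSum.toAddMonoid fun y => if h : L.obj y.1 = b then
        DirectSum.of (fun y : {y : D // L.obj y = b} => (x ⟶ y.1)) ⟨y.1, h⟩ else 0
    have h₁ : (fromVal F (L.obj x) (F.obj b)).comp T = fromVal P x (F.obj b) := by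
      refine DirectSum.addHom_ext fun y m => ?_
      simp only [AddMonoidHom.comp_apply, T, DirectSum.toAddMonoid_of]
      rw [fromVal_of, fromVal_of]
      exact (hval m).symm
    have h₂ : ∀ d, T d ⟨b, rfl⟩ = coverMapFrom L x b (R d) := by
      intro d
      induction d using DirectSum.induction_on with
      | zero => rw [map_zero, map_zero, map_zero]; rfl
      | add d d' hd hd' => rw [map_add, DirectSum.add_apply, map_add, map_add, hd, hd']
      | of y m =>
        obtain ⟨y, hy⟩ := y
        simp only [T, R, DirectSum.toAddMonoid_of, AddMonoidHom.comp_apply]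
        by_cases h : L.obj y = b
        · subst h
          rw [dif_pos rfl, DirectSum.of_eq_same, hof]
          exact (Category.comp_id _).symm
        · rw [dif_neg h, DirectSum.of_eq_of_ne _ _ _ fun h' => h (congrArg Subtype.val h').symm]
          exact (map_zero _).symm
    obtain ⟨d, hd⟩ := (hP x (F.obj b)).2 (eqToHom (hobj x) ≫ F.map m)
    have hTd : T d = DirectSum.of (fun z : {z : C // F.obj z = F.obj b} => (L.obj x ⟶ z.1))
        ⟨b, rfl⟩ m := by
      apply hF.fromVal_injective
      have := DFunLike.congr_fun h₁ d
      rw [AddMonoidHom.comp_apply] at this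
      rw [this, fromVal_of]
      exact (congrArg (homVal _ _) hd).trans (homVal_eqToHom_comp _ _)
    exact ⟨R d, by rw [← h₂, hTd, DirectSum.of_eq_same]⟩

theorem IsCovering.coverMapTo_lift_bijective (hF : IsCovering F) (hL : L ⋙ F = P)
    (hP : ∀ b x, Function.Bijective (coverMapTo P b x)) (b : C) (x : D) :
    Function.Bijective (coverMapTo L b x) := by
  classical
  have hval : ∀ {c d : D} (m : c ⟶ d), homVal _ _ (P.map m) = homVal _ _ (F.map (L.map m)) :=
    fun m => (homVal_map_of_eq hL m).symm
  have hobj : ∀ y, P.obj y = F.obj (L.obj y) := fun y => (Functor.congr_obj hL y).symm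
  have hof : ∀ (y : {y : D // L.obj y = b}) (m : y.1 ⟶ x),
      coverMapTo L b x (DirectSum.of (fun y : {y : D // L.obj y = b} => (y.1 ⟶ x)) y m) =
        eqToHom y.2.symm ≫ L.map m := fun y m => by
    rw [coverMapTo, DirectSum.toAddMonoid_of]
    rfl
  have hPinj : Function.Injective (toVal P (F.obj b) x) :=
    (homVal_injective _ _).comp (hP (F.obj b) x).1
  constructor
  · let ι : {y : D // L.obj y = b} → {y : D // P.obj y = F.obj b} := fun y =>
      ⟨y.1, (hobj y.1).trans (congrArg F.obj y.2)⟩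
    let j : (DirectSum {y : D // L.obj y = b} fun y => (y.1 ⟶ x)) →+
        (DirectSum {y : D // P.obj y = F.obj b} fun y => (y.1 ⟶ x)) :=
      DirectSum.toAddMonoid fun y =>
        DirectSum.of (fun y : {y : D // P.obj y = F.obj b} => (y.1 ⟶ x)) (ι y)
    have h₁ : (toVal P (F.obj b) x).comp j = ((homVal (F.obj b) (F.obj (L.obj x))).toAddMonoidHom.comp
        F.mapAddHom).comp (coverMapTo L b x) := by
      refine DirectSum.addHom_ext fun y m => ?_
      simp only [AddMonoidHom.comp_apply, j, DirectSum.toAddMonoid_of, hof]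
      refine (toVal_of P (ι y) m).trans ((hval m).trans ?_)
      change _ = homVal _ _ (F.map (eqToHom y.2.symm ≫ L.map m))
      rw [F.map_comp, eqToHom_map, homVal_eqToHom_comp]
    have h₂ : ∀ d y, j d (ι y) = d y := by
      intro d y
      induction d using DirectSum.induction_on with
      | zero => rw [map_zero]; rfl
      | add d d' hd hd' => rw [map_add, DirectSum.add_apply, DirectSum.add_apply, hd, hd']
      | of y' m =>
        simp only [j, DirectSum.toAddMonoid_of]
        by_cases h : y' = y
        · subst h
          rw [DirectSum.of_eq_same, DirectSum.of_eq_same]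
        · rw [DirectSum.of_eq_of_ne _ _ _ (Ne.symm h)]
          exact DirectSum.of_eq_of_ne (β := fun y : {y : D // P.obj y = F.obj b} => (y.1 ⟶ x))
            (ι y') (ι y) m fun h' => h (Subtype.ext (congrArg Subtype.val h').symm)
    refine (injective_iff_map_eq_zero _).2 fun d hd => ?_
    have hj : j d = 0 := by
      apply hPinj
      have := DFunLike.congr_fun h₁ d
      simp only [AddMonoidHom.comp_apply, hd, map_zero] at this
      rw [this, map_zero]
    refine DFinsupp.ext fun y => ?_
    rw [← h₂ d y, hj]
    rfl
  · intro m
    let T : (DirectSum {y : D // P.obj y = F.obj b} fun y => (y.1 ⟶ x)) →+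
        (DirectSum {z : C // F.obj z = F.obj b} fun z => (z.1 ⟶ L.obj x)) :=
      DirectSum.toAddMonoid fun y =>
        (DirectSum.of (fun z : {z : C // F.obj z = F.obj b} => (z.1 ⟶ L.obj x))
          ⟨L.obj y.1, (hobj y.1).symm.trans y.2⟩).comp L.mapAddHom
    let R : (DirectSum {y : D // P.obj y = F.obj b} fun y => (y.1 ⟶ x)) →+
        (DirectSum {y : D // L.obj y = b} fun y => (y.1 ⟶ x)) :=
      DirectSum.toAddMonoid fun y => if h : L.obj y.1 = b then
        DirectSum.of (fun y : {y : D // L.obj y = b} => (y.1 ⟶ x)) ⟨y.1, h⟩ else 0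
    have h₁ : (toVal F (F.obj b) (L.obj x)).comp T = toVal P (F.obj b) x := by
      refine DirectSum.addHom_ext fun y m => ?_
      simp only [AddMonoidHom.comp_apply, T, DirectSum.toAddMonoid_of]
      rw [toVal_of, toVal_of]
      exact (hval m).symm
    have h₂ : ∀ d, T d ⟨b, rfl⟩ = coverMapTo L b x (R d) := by
      intro d
      induction d using DirectSum.induction_on with
      | zero => rw [map_zero, map_zero, map_zero]; rfl
      | add d d' hd hd' => rw [map_add, DirectSum.add_apply, map_add, map_add, hd, hd']
      | of y m =>
        obtain ⟨y, hy⟩ := y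
        simp only [T, R, DirectSum.toAddMonoid_of, AddMonoidHom.comp_apply]
        by_cases h : L.obj y = b
        · subst h
          rw [dif_pos rfl, DirectSum.of_eq_same, hof]
          exact (Category.id_comp _).symm
        · rw [dif_neg h, DirectSum.of_eq_of_ne _ _ _ fun h' => h (congrArg Subtype.val h').symm]
          exact (map_zero _).symm
    obtain ⟨d, hd⟩ := (hP (F.obj b) x).2 (F.map m ≫ eqToHom (hobj x).symm)
    have hTd : T d = DirectSum.of (fun z : {z : C // F.obj z = F.obj b} => (z.1 ⟶ L.obj x))
        ⟨b, rfl⟩ m := by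
      apply hF.toVal_injective
      have := DFunLike.congr_fun h₁ d
      rw [AddMonoidHom.comp_apply] at this
      rw [this, toVal_of]
      exact (congrArg (homVal _ _) hd).trans (homVal_comp_eqToHom _ _)
    exact ⟨R d, by rw [← h₂, hTd, DirectSum.of_eq_same]⟩

end LiftFunctor

/-! ### Walk classes and paths of the universal cover -/

section UniversalCoverPaths

variable {k : Type w} [Field k] {V : Type u} [Quiver.{v} V] {I : PathIdeal k V} {x₀ : V}

theorem WalkClass.mk_eq_iff {x y : V} {c d : Walk x y} :
    WalkClass.mk I c = WalkClass.mk I d ↔ I.Homotopic c d :=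
  ⟨fun h => Quotient.exact (s := I.homotopySetoid x y) h,
    fun h => Quotient.sound (s := I.homotopySetoid x y) h⟩

theorem WalkClass.mk_comp {x y z : V} (c : Walk x y) (d : Walk y z) :
    WalkClass.mk I (c.comp d) = (WalkClass.mk I c).comp (WalkClass.mk I d) := rfl

theorem WalkClass.inv_comp {x y : V} (c : WalkClass I x y) :
    c.inv.comp c = WalkClass.mk I Walk.nil := by
  obtain ⟨c, rfl⟩ := Quotient.exists_rep c
  exact WalkClass.mk_eq_iff.2 (.inv_comp I c)

theorem WalkClass.comp_left_cancel {x y z : V} (c : WalkClass I x y) {d d' : WalkClass I y z} :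
    c.comp d = c.comp d' ↔ d = d' := by
  refine ⟨fun h => ?_, congrArg _⟩
  have := congrArg (WalkClass.comp c.inv) h
  rwa [← WalkClass.comp_assoc, ← WalkClass.comp_assoc, WalkClass.inv_comp, WalkClass.nil_comp,
    WalkClass.nil_comp] at this

theorem WalkClass.comp_right_cancel {x y z : V} {c c' : WalkClass I x y} (d : WalkClass I y z) :
    c.comp d = c'.comp d ↔ c = c' := by
  refine ⟨fun h => ?_, fun h => h ▸ rfl⟩
  have := congrArg (fun w => WalkClass.comp w d.inv) h
  simpa only [WalkClass.comp_assoc, WalkClass.comp_inv, WalkClass.comp_nil] using this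

theorem univCover_mk_eq_iff {t : V} {w w' : WalkClass I x₀ t} :
    (⟨t, w⟩ : UnivCover I x₀) = ⟨t, w'⟩ ↔ w = w' := by
  refine ⟨fun h => ?_, fun h => h ▸ rfl⟩
  injection h

/-- The end of a lifted path is determined by its source and the homotopy class of the path. -/
theorem comp_mapPath_univProj {c d : UnivCover I x₀} (q : Quiver.Path c d) :
    c.cls.comp (WalkClass.mk I (Walk.ofPath ((univProj I x₀).mapPath q))) = d.cls := by
  induction q with
  | nil => exact WalkClass.comp_nil _
  | cons q a ih =>
    have h := congrArg (fun w => WalkClass.comp w (WalkClass.mk I (Walk.nil.cons a.1))) ih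
    exact ((WalkClass.comp_assoc _ _ _).symm.trans h).trans a.2

/-- Paths lift to the universal cover, with given source. -/
theorem exists_path_from {s t : V} (p : Quiver.Path s t) (w : WalkClass I x₀ s) :
    ∃ (w' : WalkClass I x₀ t) (q : Quiver.Path (⟨s, w⟩ : UnivCover I x₀) ⟨t, w'⟩),
      (univProj I x₀).mapPath q = p := by
  induction p with
  | nil => exact ⟨w, Quiver.Path.nil, rfl⟩
  | cons p a ih =>
    obtain ⟨w', q, hq⟩ := ih
    refine ⟨w'.comp (WalkClass.mk I (Walk.nil.cons a)), q.cons ⟨a, rfl⟩, ?_⟩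
    rw [Prefunctor.mapPath_cons, hq]
    rfl

/-- Paths lift to the universal cover, with given target. -/
theorem exists_path_to {s t : V} (p : Quiver.Path s t) (w : WalkClass I x₀ t) :
    ∃ (w' : WalkClass I x₀ s) (q : Quiver.Path (⟨s, w'⟩ : UnivCover I x₀) ⟨t, w⟩),
      (univProj I x₀).mapPath q = p := by
  induction p with
  | nil => exact ⟨w, Quiver.Path.nil, rfl⟩
  | cons p a ih =>
    obtain ⟨w', q, hq⟩ := ih (w.comp (WalkClass.mk I (Walk.nil.consInv a)))
    refine ⟨w', q.cons ⟨a, ?_⟩, ?_⟩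
    · change (w.comp _).comp _ = w
      rw [WalkClass.comp_assoc, ← WalkClass.mk_comp]
      exact (congrArg w.comp (WalkClass.mk_eq_iff.2 (.consInv_cons a))).trans (WalkClass.comp_nil w)
    · rw [Prefunctor.mapPath_cons, hq]
      rfl

/-- Such a set of paths is empty or a single homotopy class, so homogeneity applies. -/
theorem PathIdeal.coordProj_mem {s t : V} {R : PathSpace k s t} (hR : R ∈ I.sub s t)
    {S : Quiver.Path s t → Prop}
    (hS : ∀ p, S p → ∀ q, S q ↔ I.Homotopic (Walk.ofPath p) (Walk.ofPath q)) :
    coordProj k S R ∈ I.sub s t := by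
  by_cases h : ∃ p, S p
  · obtain ⟨p, hp⟩ := h
    have : S = I.pathSetoid s t p := funext fun q => propext (hS p hp q)
    rw [this]
    exact I.homogeneousFor_self s t R hR p
  · rw [coordProj_eq_zero fun q _ hq => h ⟨q, hq⟩]
    exact Submodule.zero_mem _

theorem FundGroup.cls_inv (g : FundGroup I x₀) : (g⁻¹).cls = g.cls.inv := rfl

theorem FundGroup.cls_mul (g h : FundGroup I x₀) : (g * h).cls = h.cls.comp g.cls := rfl

theorem FundGroup.eq_one_of_deckFunctor_obj_eq {g : FundGroup I x₀}
    {c : BoundCat (univIdeal I x₀)} (h : (deckFunctor I x₀ g).obj c = c) : g = 1 := by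
  have h₁ : g.cls.inv.comp c.vertex.cls = c.vertex.cls :=
    univCover_mk_eq_iff.1 (congrArg BoundCat.vertex h)
  rw [← WalkClass.nil_comp c.vertex.cls, ← WalkClass.comp_assoc, WalkClass.comp_right_cancel,
    WalkClass.comp_nil] at h₁
  exact inv_eq_one.1 (congrArg FundGroup.mk h₁)

theorem exists_deckQuiver_obj_eq {t : V} (w w' : WalkClass I x₀ t) :
    ∃ g : FundGroup I x₀, (deckQuiver I x₀ g).obj ⟨t, w⟩ = ⟨t, w'⟩ := by
  -- Deck transformations prepend the inverse of the closed walk, hence the inverse of the walk from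
  -- `w'` back along `w`.
  refine ⟨(⟨w'.comp w.inv⟩ : FundGroup I x₀)⁻¹, univCover_mk_eq_iff.2 ?_⟩
  change (⟨w'.comp w.inv⟩ : FundGroup I x₀)⁻¹.cls.inv.comp w = w'
  rw [← FundGroup.cls_inv, inv_inv, WalkClass.comp_assoc, WalkClass.inv_comp, WalkClass.comp_nil]

end UniversalCoverPaths

/-! ### The universal cover as a covering of `A` -/

section UniversalCover

variable {k : Type w} [Field k] {A : Type*} [Ring A] [Algebra k A]
  {V : Type u} [Quiver.{v} V] [Fintype V] {e : V → A} {he : IsBasicDecomposition e}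
  {I : PathIdeal k V} {f : ∀ ⦃x y : V⦄, (x ⟶ y) → A}

/-- The functor from the universal cover to `A` given by a generating system. -/
def IsGeneratingSystem.coverEval (h : IsGeneratingSystem he I f) (x₀ : V) :
    BoundCat (univIdeal I x₀) ⥤ IdemCat k he :=
  univFunctor I x₀ ⋙ evalFunctor he h.peirce I h.le_ker

/-- The class of a combination of paths as a morphism. -/
def BoundCat.homMk {W : Type*} [Quiver W] {J : PathIdeal k W} {x y : W} (r : PathSpace k x y) :
    (⟨x⟩ : BoundCat J) ⟶ ⟨y⟩ :=
  (J.sub x y).mkQ r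

theorem BoundCat.exists_homMk_eq {W : Type*} [Quiver W] {J : PathIdeal k W} {x y : W}
    (m : (⟨x⟩ : BoundCat J) ⟶ ⟨y⟩) : ∃ r, BoundCat.homMk r = m :=
  Submodule.mkQ_surjective _ m

theorem IsGeneratingSystem.coverEval_homMk (h : IsGeneratingSystem he I f) {x₀ : V}
    {c d : UnivCover I x₀} (r : PathSpace k c d) :
    homVal _ _ ((h.coverEval x₀).map (BoundCat.homMk r)) =
      evalLin k e f c.target d.target (pathPush k (univProj I x₀) c d r) := rfl

instance boundFunctor_additive {W : Type*} [Quiver W] {V : Type*} [Quiver V] (φ : W ⥤q V) (J : PathIdeal k W)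
    (I : PathIdeal k V) (h : ∀ x y : W, J.sub x y ≤ (I.pullback φ).sub x y) :
    (boundFunctor φ J I h).Additive :=
  ⟨fun {_ _ m n} => map_add (Submodule.mapQ _ _ _ _) m n⟩

instance boundFunctor_linear {W : Type*} [Quiver W] {V : Type*} [Quiver V] (φ : W ⥤q V) (J : PathIdeal k W)
    (I : PathIdeal k V) (h : ∀ x y : W, J.sub x y ≤ (I.pullback φ).sub x y) :
    (boundFunctor φ J I h).Linear k :=
  ⟨fun {_ _} m c => map_smul (Submodule.mapQ _ _ _ _) c m⟩

instance (x₀ : V) : (univFunctor I x₀).Additive :=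
  boundFunctor_additive _ _ _ _

instance (x₀ : V) : (univFunctor I x₀).Linear k :=
  boundFunctor_linear _ _ _ _

instance (hf : IsPeirceSystem k e f) (hI : ∀ x y, I.sub x y ≤ LinearMap.ker (evalLin k e f x y)) :
    (evalFunctor he hf I hI).Additive :=
  ⟨fun {_ _ m n} => Subtype.ext (map_add (Submodule.liftQ _ _ _) m n)⟩

instance (hf : IsPeirceSystem k e f) (hI : ∀ x y, I.sub x y ≤ LinearMap.ker (evalLin k e f x y)) :
    (evalFunctor he hf I hI).Linear k :=
  ⟨fun {_ _} m c => Subtype.ext (map_smul (Submodule.liftQ _ _ _) c m)⟩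

instance (h : IsGeneratingSystem he I f) (x₀ : V) : (h.coverEval x₀).Additive :=
  inferInstanceAs (univFunctor I x₀ ⋙ evalFunctor he h.peirce I h.le_ker).Additive

instance (h : IsGeneratingSystem he I f) (x₀ : V) : (h.coverEval x₀).Linear k :=
  inferInstanceAs ((univFunctor I x₀ ⋙ evalFunctor he h.peirce I h.le_ker).Linear k)

theorem IsGeneratingSystem.eq_zero_of_coverEval (h : IsGeneratingSystem he I f) {x₀ : V}
    {c d : BoundCat (univIdeal I x₀)} {m : c ⟶ d}
    (hm : homVal _ _ ((h.coverEval x₀).map m) = 0) : m = 0 := by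
  obtain ⟨r, rfl⟩ := BoundCat.exists_homMk_eq m
  rw [h.coverEval_homMk] at hm
  exact (Submodule.Quotient.mk_eq_zero _).2 ((h.mem_iff _).2 hm)

theorem IsGeneratingSystem.exists_evalLin_eq_coverEval (h : IsGeneratingSystem he I f) {x₀ : V}
    {c d : UnivCover I x₀} (m : (⟨c⟩ : BoundCat (univIdeal I x₀)) ⟶ ⟨d⟩) :
    ∃ r : PathSpace k c.target d.target,
      evalLin k e f c.target d.target r = homVal _ _ ((h.coverEval x₀).map m) ∧
      ∀ p, r p ≠ 0 → c.cls.comp (WalkClass.mk I (Walk.ofPath p)) = d.cls := by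
  classical
  obtain ⟨r, rfl⟩ := BoundCat.exists_homMk_eq m
  refine ⟨_, (h.coverEval_homMk r).symm, fun p hp => ?_⟩
  obtain ⟨q, -, rfl⟩ := Finset.mem_image.1
    (Finsupp.mapDomain_support (Finsupp.mem_support_iff.2 hp))
  exact comp_mapPath_univProj q

/-- The summands are supported in distinct homotopy classes, so homogeneity of the ideal makes them
vanish separately. -/
theorem IsGeneratingSystem.evalLin_eq_zero_of_sum (h : IsGeneratingSystem he I f) {s t : V}
    {Y : Type*} (T : Finset Y) (r : Y → PathSpace k s t) (S : Y → Quiver.Path s t → Prop)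
    (hrS : ∀ y p, r y p ≠ 0 → S y p) (hdisj : ∀ y y' p, S y p → S y' p → y = y')
    (hS : ∀ y p, S y p → ∀ q, S y q ↔ I.Homotopic (Walk.ofPath p) (Walk.ofPath q))
    (hsum : ∑ y ∈ T, evalLin k e f s t (r y) = 0) {y : Y} (hy : y ∈ T) :
    evalLin k e f s t (r y) = 0 := by
  have hmem : ∑ y ∈ T, r y ∈ I.sub s t := by rwa [h.mem_iff, map_sum]
  have := PathIdeal.coordProj_mem hmem (hS y)
  rw [map_sum, Finset.sum_eq_single_of_mem y hy, coordProj_eq_self (hrS y), h.mem_iff] at this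
  · exact this
  · intro y' _ hne
    exact coordProj_eq_zero fun q hq hq' => hne (hdisj _ _ q (hrS y' q hq) hq')

/-- With the source fixed, distinct end points in the universal cover correspond to distinct
homotopy classes of paths, so a vanishing sum vanishes term by term. -/
theorem IsGeneratingSystem.fromVal_injective (h : IsGeneratingSystem he I f) {x₀ : V}
    (c : BoundCat (univIdeal I x₀)) (b : IdemCat k he) :
    Function.Injective (fromVal (h.coverEval x₀) c b) := by
  classical
  refine (injective_iff_map_eq_zero _).2 fun d hd => ?_
  have hex : ∀ y : {y // (h.coverEval x₀).obj y = b}, ∃ r : PathSpace k c.vertex.target b.vertex,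
      evalLin k e f _ _ r = homVal _ _ ((h.coverEval x₀).map (d y)) ∧ ∀ p, r p ≠ 0 →
        (⟨b.vertex, c.vertex.cls.comp (WalkClass.mk I (Walk.ofPath p))⟩ : UnivCover I x₀) =
          y.1.vertex := by
    rintro ⟨⟨⟨t, w⟩⟩, rfl⟩
    obtain ⟨r, hr, hr'⟩ := h.exists_evalLin_eq_coverEval (d ⟨⟨⟨t, w⟩⟩, rfl⟩)
    exact ⟨r, hr, fun p hp => univCover_mk_eq_iff.2 (hr' p hp)⟩
  choose r hr hr' using hex
  rw [fromVal_eq_sum] at hd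
  refine DFinsupp.ext fun y => ?_
  by_contra hy
  refine hy (h.eq_zero_of_coverEval ?_)
  rw [← hr]
  refine h.evalLin_eq_zero_of_sum (DFinsupp.support d) r (fun y p =>
    (⟨b.vertex, c.vertex.cls.comp (WalkClass.mk I (Walk.ofPath p))⟩ : UnivCover I x₀) =
      y.1.vertex) hr' ?_ ?_ ?_ (DFinsupp.mem_support_toFun d y |>.2 hy)
  · intro y y' p h₁ h₂
    exact Subtype.ext (BoundCat.ext (h₁.symm.trans h₂))
  · intro y p h₁ q
    rw [← h₁, univCover_mk_eq_iff, WalkClass.comp_left_cancel, WalkClass.mk_eq_iff]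
    exact ⟨.symm, .symm⟩
  · rw [← hd]
    exact Finset.sum_congr rfl fun y _ => hr y

theorem IsGeneratingSystem.toVal_injective (h : IsGeneratingSystem he I f) {x₀ : V}
    (b : IdemCat k he) (c : BoundCat (univIdeal I x₀)) :
    Function.Injective (toVal (h.coverEval x₀) b c) := by
  classical
  refine (injective_iff_map_eq_zero _).2 fun d hd => ?_
  have hex : ∀ y : {y // (h.coverEval x₀).obj y = b}, ∃ r : PathSpace k b.vertex c.vertex.target,
      evalLin k e f _ _ r = homVal _ _ ((h.coverEval x₀).map (d y)) ∧ ∀ p, r p ≠ 0 →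
        (⟨b.vertex, c.vertex.cls.comp (WalkClass.mk I (Walk.ofPath p)).inv⟩ : UnivCover I x₀) =
          y.1.vertex := by
    rintro ⟨⟨⟨t, w⟩⟩, rfl⟩
    obtain ⟨r, hr, hr'⟩ := h.exists_evalLin_eq_coverEval (d ⟨⟨⟨t, w⟩⟩, rfl⟩)
    refine ⟨r, hr, fun p hp => univCover_mk_eq_iff.2 ?_⟩
    rw [← hr' p hp, WalkClass.comp_assoc]
    exact (congrArg w.comp (WalkClass.comp_inv _)).trans (WalkClass.comp_nil w)
  choose r hr hr' using hex
  rw [toVal_eq_sum] at hd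
  refine DFinsupp.ext fun y => ?_
  by_contra hy
  refine hy (h.eq_zero_of_coverEval ?_)
  rw [← hr]
  refine h.evalLin_eq_zero_of_sum (DFinsupp.support d) r (fun y p =>
    (⟨b.vertex, c.vertex.cls.comp (WalkClass.mk I (Walk.ofPath p)).inv⟩ : UnivCover I x₀) =
      y.1.vertex) hr' ?_ ?_ ?_ (DFinsupp.mem_support_toFun d y |>.2 hy)
  · intro y y' p h₁ h₂
    exact Subtype.ext (BoundCat.ext (h₁.symm.trans h₂))
  · intro y p h₁ q
    rw [← h₁, univCover_mk_eq_iff, WalkClass.comp_left_cancel, ← WalkClass.mk_eq_iff]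
    constructor
    · intro hinv
      have := congrArg (WalkClass.comp (WalkClass.mk I (Walk.ofPath q))) hinv
      rw [WalkClass.comp_inv] at this
      have := congrArg (WalkClass.comp · (WalkClass.mk I (Walk.ofPath p))) this
      rwa [WalkClass.comp_assoc, WalkClass.inv_comp, WalkClass.nil_comp, WalkClass.comp_nil] at this
    · intro hpq
      rw [hpq]
  · rw [← hd]
    exact Finset.sum_congr rfl fun y _ => hr y

open Classical in
theorem IsGeneratingSystem.exists_fromVal_coverEval_eq (h : IsGeneratingSystem he I f) {x₀ : V}
    (c : UnivCover I x₀) {t : V} (R : PathSpace k c.target t) :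
    ∃ d, fromVal (h.coverEval x₀) ⟨c⟩ ⟨t⟩ d = evalLin k e f c.target t R := by
  induction R using Finsupp.induction_linear with
  | zero => exact ⟨0, by rw [map_zero, map_zero]⟩
  | add R R' hR hR' =>
    obtain ⟨d, hd⟩ := hR
    obtain ⟨d', hd'⟩ := hR'
    exact ⟨d + d', by rw [map_add, map_add, hd, hd']⟩
  | single p a =>
    obtain ⟨w, q, hq⟩ := exists_path_from p c.cls
    refine ⟨DirectSum.of (fun y : {y // (h.coverEval x₀).obj y = ⟨t⟩} => (⟨c⟩ ⟶ y.1))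
      ⟨⟨⟨t, w⟩⟩, rfl⟩ (BoundCat.homMk (Finsupp.single q a)), ?_⟩
    refine (fromVal_of (h.coverEval x₀) _ _).trans ((h.coverEval_homMk _).trans ?_)
    rw [pathPush, Finsupp.lmapDomain_apply, Finsupp.mapDomain_single, hq]
    rfl

open Classical in
theorem IsGeneratingSystem.exists_toVal_coverEval_eq (h : IsGeneratingSystem he I f) {x₀ : V}
    (c : UnivCover I x₀) {s : V} (R : PathSpace k s c.target) :
    ∃ d, toVal (h.coverEval x₀) ⟨s⟩ ⟨c⟩ d = evalLin k e f s c.target R := by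
  induction R using Finsupp.induction_linear with
  | zero => exact ⟨0, by rw [map_zero, map_zero]⟩
  | add R R' hR hR' =>
    obtain ⟨d, hd⟩ := hR
    obtain ⟨d', hd'⟩ := hR'
    exact ⟨d + d', by rw [map_add, map_add, hd, hd']⟩
  | single p a =>
    obtain ⟨w, q, hq⟩ := exists_path_to p c.cls
    refine ⟨DirectSum.of (fun y : {y // (h.coverEval x₀).obj y = ⟨s⟩} => (y.1 ⟶ ⟨c⟩))
      ⟨⟨⟨s, w⟩⟩, rfl⟩ (BoundCat.homMk (Finsupp.single q a)), ?_⟩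
    refine (toVal_of (h.coverEval x₀) _ _).trans ((h.coverEval_homMk _).trans ?_)
    rw [pathPush, Finsupp.lmapDomain_apply, Finsupp.mapDomain_single, hq]
    rfl

variable [IsAlgClosed k] [FiniteDimensional k A]

theorem IsGeneratingSystem.coverMapFrom_bijective (h : IsGeneratingSystem he I f)
    (hQ : IsOrdinaryQuiver k V (IdemCat k he) (IdemCat.ob k he)) (hb : HasNoDoubleBypass V)
    {x₀ : V} (c : BoundCat (univIdeal I x₀)) (b : IdemCat k he) :
    Function.Bijective (coverMapFrom (h.coverEval x₀) c b) := by
  refine ⟨fun d d' hd => h.fromVal_injective c b (congrArg (homVal _ _) hd), fun m => ?_⟩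
  obtain ⟨R, hR⟩ := exists_evalLin_eq hQ hb h.peirce h.notMem (homVal_mem m)
  obtain ⟨d, hd⟩ := h.exists_fromVal_coverEval_eq c.vertex (t := b.vertex) R
  exact ⟨d, homVal_injective _ _ (hd.trans hR)⟩

theorem IsGeneratingSystem.coverMapTo_bijective (h : IsGeneratingSystem he I f)
    (hQ : IsOrdinaryQuiver k V (IdemCat k he) (IdemCat.ob k he)) (hb : HasNoDoubleBypass V)
    {x₀ : V} (b : IdemCat k he) (c : BoundCat (univIdeal I x₀)) :
    Function.Bijective (coverMapTo (h.coverEval x₀) b c) := by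
  refine ⟨fun d d' hd => h.toVal_injective b c (congrArg (homVal _ _) hd), fun m => ?_⟩
  obtain ⟨R, hR⟩ := exists_evalLin_eq hQ hb h.peirce h.notMem (homVal_mem m)
  obtain ⟨d, hd⟩ := h.exists_toVal_coverEval_eq c.vertex (s := b.vertex) R
  exact ⟨d, homVal_injective _ _ (hd.trans hR)⟩

end UniversalCover

/-! ### The action of walk classes on fibres -/

section WalkClassAction

variable {k : Type w} [Field k] {A : Type*} [Ring A] [Algebra k A]
  {V : Type u} [Quiver.{v} V] [Fintype V] {e : V → A} {he : IsBasicDecomposition e}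
  {I : PathIdeal k V} {f : ∀ ⦃x y : V⦄, (x ⟶ y) → A}
  {C : Type*} [Category* C] {F : C ⥤ IdemCat k he}
  {σ : ∀ ⦃x y : V⦄, (x ⟶ y) → Fibre F x ≃ Fibre F y}

variable (I σ) in
/-- Homotopic walks give the same bijection between fibres. -/
def IsHomotopyInvariant : Prop :=
  ∀ ⦃x y : V⦄ ⦃c d : Walk x y⦄, I.Homotopic c d → walkEquiv σ c = walkEquiv σ d

/-- The bijection between fibres given by a homotopy class of walks. -/
def IsHomotopyInvariant.classEquiv (hI : IsHomotopyInvariant I σ) {x y : V}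
    (c : WalkClass I x y) : Fibre F x ≃ Fibre F y :=
  Quotient.liftOn c (walkEquiv σ) fun _ _ h => hI h

theorem IsHomotopyInvariant.classEquiv_mk (hI : IsHomotopyInvariant I σ) {x y : V} (c : Walk x y) :
    hI.classEquiv (WalkClass.mk I c) = walkEquiv σ c := rfl

theorem IsHomotopyInvariant.classEquiv_comp (hI : IsHomotopyInvariant I σ) {x y z : V}
    (c : WalkClass I x y) (d : WalkClass I y z) (t : Fibre F x) :
    hI.classEquiv (c.comp d) t = hI.classEquiv d (hI.classEquiv c t) := by
  obtain ⟨c, rfl⟩ := Quotient.exists_rep c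
  obtain ⟨d, rfl⟩ := Quotient.exists_rep d
  exact congrArg (· t) (walkEquiv_comp σ c d)

theorem IsHomotopyInvariant.classEquiv_inv (hI : IsHomotopyInvariant I σ) {x y : V}
    (c : WalkClass I x y) (t : Fibre F x) :
    hI.classEquiv c.inv (hI.classEquiv c t) = t := by
  rw [← hI.classEquiv_comp, WalkClass.comp_inv]
  rfl

/-- The point of the covering over a vertex of the universal cover. -/
def IsHomotopyInvariant.point (hI : IsHomotopyInvariant I σ) {x₀ : V} (z₀ : Fibre F x₀)
    (c : UnivCover I x₀) : Fibre F c.target :=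
  hI.classEquiv c.cls z₀

variable [Preadditive C] [Linear k C] [F.Additive] [F.Linear k]

theorem IsLiftSystem.isHomotopyInvariant (hl : IsLiftSystem f σ) (hF : IsCovering F)
    (h : IsGeneratingSystem he I f) : IsHomotopyInvariant I σ :=
  fun _ _ _ _ hcd => hl.walkEquiv_eq hF h.mem_iff hcd

/-- All paths occurring in a morphism of the universal cover have the same homotopy class relative
to its ends, so their lifts share an end point and add up to one morphism. -/
theorem IsHomotopyInvariant.exists_map_eq_coverEval (hI : IsHomotopyInvariant I σ)
    (hl : IsLiftSystem f σ) (h : IsGeneratingSystem he I f) {x₀ : V} (z₀ : Fibre F x₀)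
    {c d : BoundCat (univIdeal I x₀)} (m : c ⟶ d) :
    ∃ n : (hI.point z₀ c.vertex).1 ⟶ (hI.point z₀ d.vertex).1,
      homVal _ _ (F.map n) = homVal _ _ ((h.coverEval x₀).map m) := by
  classical
  obtain ⟨r, hr, hrs⟩ := h.exists_evalLin_eq_coverEval m
  obtain ⟨b, -, hb⟩ := hl.exists_fromVal r (hI.point z₀ c.vertex)
  refine ⟨b (hI.point z₀ d.vertex), ?_⟩
  rw [hb, coordProj_eq_self, hr]
  intro p hp
  rw [← hI.classEquiv_mk]
  exact (hI.classEquiv_comp _ _ _).symm.trans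
    (congrArg (fun w => hI.classEquiv w z₀) (hrs p hp))

variable [IsAlgClosed k] [FiniteDimensional k A]

/-- The value is a combination of paths, of which only those lifting to paths from `z` to `z'`
count. If there were none, the value would be zero. -/
theorem IsLiftSystem.exists_path_of_ne_zero (hl : IsLiftSystem f σ) (hF : IsCovering F)
    (hQ : IsOrdinaryQuiver k V (IdemCat k he) (IdemCat.ob k he)) (hb : HasNoDoubleBypass V)
    (h : IsGeneratingSystem he I f) {x y : V} {z : Fibre F x} {z' : Fibre F y} {m : z.1 ⟶ z'.1}
    (hm : m ≠ 0) : ∃ p : Quiver.Path x y, walkEquiv σ (Walk.ofPath p) z = z' := by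
  obtain ⟨R, hR⟩ := exists_evalLin_eq hQ hb h.peirce h.notMem (Fibre.homVal_map_mem m)
  by_contra! hp
  have h₁ := hl.evalLin_coordProj hF hR
  rw [coordProj_eq_zero fun p _ => hp p, map_zero] at h₁
  refine hm (hF.homVal_map_injective ?_)
  simp only
  rw [← h₁, F.map_zero, map_zero]

/-- Connectedness joins the base point to any object by nonzero morphisms, each of which is
followed, forwards or backwards, by a path. -/
theorem IsHomotopyInvariant.exists_point_eq (hI : IsHomotopyInvariant I σ)
    (hl : IsLiftSystem f σ) (hF : IsCovering F)
    (hQ : IsOrdinaryQuiver k V (IdemCat k he) (IdemCat.ob k he)) (hb : HasNoDoubleBypass V)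
    (h : IsGeneratingSystem he I f) (hC : IsConnectedKCat C) {x₀ : V} (z₀ : Fibre F x₀) (z : C) :
    ∃ c : UnivCover I x₀, (hI.point z₀ c).1 = z := by
  induction hC.2 z₀.1 z with
  | refl => exact ⟨⟨x₀, WalkClass.mk I Walk.nil⟩, rfl⟩
  | @tail z' z'' _ hstep ih =>
    obtain ⟨c, rfl⟩ := ih
    let t : Fibre F (F.obj z'').vertex := ⟨z'', rfl⟩
    rcases hstep with ⟨m, hm⟩ | ⟨m, hm⟩
    · obtain ⟨p, hp⟩ := hl.exists_path_of_ne_zero hF hQ hb h (z := hI.point z₀ c) (z' := t) hm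
      refine ⟨⟨_, c.cls.comp (WalkClass.mk I (Walk.ofPath p))⟩, ?_⟩
      exact congrArg Subtype.val
        ((hI.classEquiv_comp c.cls (WalkClass.mk I (Walk.ofPath p)) z₀).trans hp)
    · obtain ⟨p, hp⟩ := hl.exists_path_of_ne_zero hF hQ hb h (z := t) (z' := hI.point z₀ c) hm
      refine ⟨⟨_, c.cls.comp (WalkClass.mk I (Walk.ofPath p)).inv⟩, ?_⟩
      have h₁ : hI.classEquiv (WalkClass.mk I (Walk.ofPath p)).inv (hI.point z₀ c) = t := by
        rw [← hp]
        exact hI.classEquiv_inv (WalkClass.mk I (Walk.ofPath p)) t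
      exact congrArg Subtype.val
        ((hI.classEquiv_comp c.cls (WalkClass.mk I (Walk.ofPath p)).inv z₀).trans h₁)

end WalkClassAction

/-! ### The deck transformations -/

section Deck

variable {k : Type w} [Field k] {A : Type*} [Ring A] [Algebra k A]
  {V : Type u} [Quiver.{v} V] [Fintype V] {e : V → A} {he : IsBasicDecomposition e}
  {I : PathIdeal k V} {f : ∀ ⦃x y : V⦄, (x ⟶ y) → A}

theorem IsGeneratingSystem.coverEval_faithful (h : IsGeneratingSystem he I f) (x₀ : V) :
    (h.coverEval x₀).Faithful :=
  ⟨fun {_ _ m n} hmn => sub_eq_zero.1 (h.eq_zero_of_coverEval (by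
    rw [Functor.map_sub, hmn, sub_self, map_zero]))⟩

theorem IsGeneratingSystem.deckFunctor_comp_coverEval (h : IsGeneratingSystem he I f) (x₀ : V)
    (g : FundGroup I x₀) : deckFunctor I x₀ g ⋙ h.coverEval x₀ = h.coverEval x₀ := by
  refine idemCat_functor_ext (fun _ => rfl) fun {c d} m => ?_
  obtain ⟨r, rfl⟩ := BoundCat.exists_homMk_eq m
  change evalLin k e f _ _ (pathPush k (univProj I x₀) _ _
    (pathPush k (deckQuiver I x₀ g) c.vertex d.vertex r)) =
    evalLin k e f _ _ (pathPush k (univProj I x₀) _ _ r)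
  have : pathPush k (univProj I x₀) _ _ (pathPush k (deckQuiver I x₀ g) c.vertex d.vertex r) =
      pathPush k (univProj I x₀) c.vertex d.vertex r := by
    simp only [pathPush, Finsupp.lmapDomain_apply, ← Finsupp.mapDomain_comp]
    congr 1
    funext p
    exact (Prefunctor.mapPath_comp_apply (deckQuiver I x₀ g) (univProj I x₀) p).symm
  rw [this]
  rfl

/-- Deck transformations disappear after the faithful functor to `A`, so identities between them
need checking on objects only. -/
theorem IsGeneratingSystem.deckFunctor_one (h : IsGeneratingSystem he I f) (x₀ : V) :
    deckFunctor I x₀ 1 = 𝟭 _ := by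
  have := h.coverEval_faithful x₀
  refine functor_eq_of_comp_faithful (h.coverEval x₀) (fun c => ?_)
    (h.deckFunctor_comp_coverEval x₀ 1)
  exact congrArg BoundCat.mk (univCover_mk_eq_iff.2 (WalkClass.nil_comp c.vertex.cls))

theorem IsGeneratingSystem.deckFunctor_mul (h : IsGeneratingSystem he I f) (x₀ : V)
    (g g' : FundGroup I x₀) :
    deckFunctor I x₀ (g * g') = deckFunctor I x₀ g' ⋙ deckFunctor I x₀ g := by
  have := h.coverEval_faithful x₀
  refine functor_eq_of_comp_faithful (h.coverEval x₀) (fun c => ?_) ?_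
  · refine congrArg BoundCat.mk (univCover_mk_eq_iff.2 ?_)
    change (g * g').cls.inv.comp c.vertex.cls = g.cls.inv.comp (g'.cls.inv.comp c.vertex.cls)
    rw [← FundGroup.cls_inv, mul_inv_rev, FundGroup.cls_mul, WalkClass.comp_assoc]
    rfl
  · rw [Functor.assoc, h.deckFunctor_comp_coverEval, h.deckFunctor_comp_coverEval,
      h.deckFunctor_comp_coverEval]

variable {C : Type*} [Category* C] [Preadditive C] [Linear k C] {G : Type*} [Group G]
  {act : G → C ⥤ C} {F : C ⥤ IdemCat k he} [F.Additive]
  {σ : ∀ ⦃x y : V⦄, (x ⟶ y) → Fibre F x ≃ Fibre F y}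

theorem IsGaloisCovering.classEquiv_fibreAct (hG : IsGaloisCovering k act F)
    (hI : IsHomotopyInvariant I σ)
    (hσ : ∀ (g : G) ⦃x y : V⦄ (a : x ⟶ y) (z : Fibre F x),
      σ a (hG.fibreAct g z) = hG.fibreAct g (σ a z)) (g : G) {x y : V} (c : WalkClass I x y)
    (z : Fibre F x) : hI.classEquiv c (hG.fibreAct g z) = hG.fibreAct g (hI.classEquiv c z) := by
  obtain ⟨c, rfl⟩ := Quotient.exists_rep c
  exact hG.walkEquiv_fibreAct hσ g c z

/-- The morphism from the fundamental group to the group of a Galois covering, given by the action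
of closed walks on the fibre. -/
theorem IsGaloisCovering.exists_monoidHom (hG : IsGaloisCovering k act F)
    (hI : IsHomotopyInvariant I σ)
    (hσ : ∀ (g : G) ⦃x y : V⦄ (a : x ⟶ y) (z : Fibre F x),
      σ a (hG.fibreAct g z) = hG.fibreAct g (σ a z)) {x₀ : V} (z₀ : Fibre F x₀) :
    ∃ π : FundGroup I x₀ →* G, ∀ γ, hG.fibreAct (π γ) (hI.classEquiv γ.cls z₀) = z₀ := by
  -- The image of `γ` is the element of `G` that brings the end of the lift of `γ` back to the base
  -- point. Regularity of the fibre makes it unique, hence multiplicative.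
  choose π hπ using fun γ : FundGroup I x₀ => (hG.fibreAct_bijective (hI.classEquiv γ.cls z₀)).2 z₀
  refine ⟨MonoidHom.mk' π fun γ δ => (hG.fibreAct_bijective _).1 ((hπ (γ * δ)).trans ?_), hπ⟩
  change _ = hG.fibreAct (π γ * π δ) (hI.classEquiv (δ.cls.comp γ.cls) z₀)
  have hδ : hG.fibreAct (π δ) (hI.classEquiv δ.cls z₀) = z₀ := hπ δ
  have hγ : hG.fibreAct (π γ) (hI.classEquiv γ.cls z₀) = z₀ := hπ γ
  rw [hG.fibreAct_mul, hI.classEquiv_comp, ← hG.classEquiv_fibreAct hI hσ, hδ, hγ]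

/-- The inverse of `γ` carries the base point to its translate by `π γ`, and walks commute with the
action of `G`; so the deck action covers the action of `G` through `π`. -/
theorem IsGaloisCovering.point_deck (hG : IsGaloisCovering k act F)
    (hI : IsHomotopyInvariant I σ)
    (hσ : ∀ (g : G) ⦃x y : V⦄ (a : x ⟶ y) (z : Fibre F x),
      σ a (hG.fibreAct g z) = hG.fibreAct g (σ a z)) {x₀ : V} {z₀ : Fibre F x₀}
    {π : FundGroup I x₀ →* G} (hπ : ∀ γ, hG.fibreAct (π γ) (hI.classEquiv γ.cls z₀) = z₀)
    (γ : FundGroup I x₀) (c : UnivCover I x₀) :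
    hI.point z₀ ((deckQuiver I x₀ γ).obj c) = hG.fibreAct (π γ) (hI.point z₀ c) := by
  have h₁ : hI.classEquiv γ.cls.inv z₀ = hG.fibreAct (π γ) z₀ := by
    conv_lhs => rw [← hπ γ]
    rw [hG.classEquiv_fibreAct hI hσ, hI.classEquiv_inv]
  change hI.classEquiv (γ.cls.inv.comp c.cls) z₀ = _
  rw [hI.classEquiv_comp, h₁, hG.classEquiv_fibreAct hI hσ]
  rfl

theorem IsGaloisCovering.monoidHom_surjective (hG : IsGaloisCovering k act F)
    (hI : IsHomotopyInvariant I σ) {x₀ : V} {z₀ : Fibre F x₀}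
    (hpt : ∀ z : C, ∃ c : UnivCover I x₀, (hI.point z₀ c).1 = z)
    {π : FundGroup I x₀ →* G} (hπ : ∀ γ, hG.fibreAct (π γ) (hI.classEquiv γ.cls z₀) = z₀) :
    Function.Surjective π := by
  intro g
  -- A walk from the base point to its translate by the inverse of `g` is closed in `Q`, and its
  -- class maps to `g`.
  obtain ⟨⟨t, w⟩, hc⟩ := hpt (hG.fibreAct g⁻¹ z₀).1
  obtain rfl : t = x₀ := Fibre.target_eq hc
  refine ⟨⟨w⟩, (hG.fibreAct_bijective _).1 ((hπ ⟨w⟩).trans ?_)⟩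
  have hw : hI.classEquiv w z₀ = hG.fibreAct g⁻¹ z₀ := Subtype.ext hc
  simp only
  rw [hw, ← hG.fibreAct_mul, mul_inv_cancel, hG.fibreAct_one]

/-- The lift of the universal cover to a Galois covering is a Galois covering. -/
theorem IsGaloisCovering.isGaloisCovering_lift (hG : IsGaloisCovering k act F)
    (h : IsGeneratingSystem he I f) (hI : IsHomotopyInvariant I σ)
    (hσ : ∀ (g : G) ⦃x y : V⦄ (a : x ⟶ y) (z : Fibre F x),
      σ a (hG.fibreAct g z) = hG.fibreAct g (σ a z)) {x₀ : V} {z₀ : Fibre F x₀}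
    {π : FundGroup I x₀ →* G} (hπ : ∀ γ, hG.fibreAct (π γ) (hI.classEquiv γ.cls z₀) = z₀)
    {L : BoundCat (univIdeal I x₀) ⥤ C} [L.Additive] (hL : L ⋙ F = h.coverEval x₀)
    (hobj : ∀ c, L.obj c = (hI.point z₀ c.vertex).1) (hcov : IsCovering L) :
    IsGaloisCovering k (fun n : π.ker => deckFunctor I x₀ n) L where
  linear := by
    have := hG.linear
    exact hG.covering.lift_linear hL
  act_additive _ := boundFunctor_additive _ _ _ _
  act_linear _ := boundFunctor_linear _ _ _ _
  act_one := h.deckFunctor_one x₀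
  act_mul g g' := h.deckFunctor_mul x₀ g.1 g'.1
  free g _ hg := Subtype.ext (FundGroup.eq_one_of_deckFunctor_obj_eq hg)
  covering := hcov
  invariant g := by
    have := hG.covering.faithful
    refine functor_eq_of_comp_faithful F (fun c => ?_) ?_
    · rw [Functor.comp_obj, hobj, hobj]
      refine (congrArg Subtype.val (hG.point_deck hI hσ hπ g.1 c.vertex)).trans ?_
      rw [MonoidHom.mem_ker.1 g.2, hG.fibreAct_one]
    · rw [Functor.assoc, hL, h.deckFunctor_comp_coverEval]
  transitive := by
    rintro ⟨⟨t, w⟩⟩ ⟨⟨t', w'⟩⟩ hcd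
    rw [hobj, hobj] at hcd
    obtain rfl : t = t' := Fibre.target_eq hcd
    -- Two vertices over the same point differ by a deck transformation; its image in `G` fixes that
    -- point, so by freeness it lies in the kernel.
    obtain ⟨g, hg⟩ := exists_deckQuiver_obj_eq w w'
    refine ⟨⟨g, MonoidHom.mem_ker.2 ((hG.fibreAct_bijective (hI.point z₀ ⟨t, w⟩)).1 ?_)⟩,
      congrArg BoundCat.mk hg⟩
    simp only
    rw [hG.fibreAct_one]
    refine (hG.point_deck hI hσ hπ g ⟨t, w⟩).symm.trans ?_
    refine Eq.trans ?_ (Subtype.ext hcd).symm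
    exact Subtype.ext (congrArg (fun c => (hI.point z₀ c).1) hg)

end Deck

end

/-! ### The source of `Γ` and the factorization of Galois coverings -/

theorem theoremB {k : Type*} [Field k] [IsAlgClosed k] [CharZero k]
    {A : Type*} [Ring A] [Algebra k A] [FiniteDimensional k A]
    {V : Type*} [Fintype V] [Quiver V] {e : V → A} (he : IsBasicDecomposition e)
    (hconn : IsConnectedKCat (IdemCat k he))
    (hQ : IsOrdinaryQuiver k V (IdemCat k he) (IdemCat.ob k he))
    (hbypass : HasNoDoubleBypass V) :
    (∃! R : WalkRel V, IsGammaSource k he R) ∧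
    ∀ (I₀ : PathIdeal k V) (φ₀ : BoundCat I₀ ⥤ IdemCat k he), IsPresentation I₀ φ₀ →
      IsGammaSource k he I₀.homotopyRel →
      ∀ (x₀ : V) {G : Type*} [Group G] {C' : Type*} [Category* C'] [Preadditive C'] [Linear k C']
        (act : G → C' ⥤ C') (F : C' ⥤ IdemCat k he) [F.Additive],
        IsLocallyBounded k C' → IsConnectedKCat C' → IsGaloisCovering k act F →
        ∃ (θ : BoundCat I₀ ⥤ IdemCat k he) (N : Subgroup (FundGroup I₀ x₀))
          (F' : BoundCat (univIdeal I₀ x₀) ⥤ C') (_ : F'.Additive) (π : FundGroup I₀ x₀ →* G),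
          IsPresentation I₀ θ ∧ (∀ x, θ.obj x = φ₀.obj x) ∧
          N.Normal ∧
          IsGaloisCovering k (fun n : N => deckFunctor I₀ x₀ n) F' ∧
          univFunctor I₀ x₀ ⋙ θ = F' ⋙ F ∧
          Function.Surjective π ∧ π.ker = N := by
  have hfin : ∀ x y : V, Finite (Quiver.Path x y) :=
    HasNoDoubleBypass.finite_path (fun x y => (hQ x y).1) hbypass
  obtain ⟨I₁, φ₁, hφ₁, hmin₁⟩ := exists_isHomotopyMinimal hfin hQ hbypass
  have huniq : ∀ R, IsGammaSource k he R → R = I₁.homotopyRel := fun R hR =>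
    hR.eq_of_isHomotopyMinimal hfin hQ hbypass hφ₁ hmin₁
  refine ⟨⟨I₁.homotopyRel, hmin₁.isGammaSource hφ₁, huniq⟩, ?_⟩
  intro I₀ φ₀ hφ₀ hsource x₀ G _ C' _ _ _ act F _ _ hC' hG
  have hlin := hG.linear
  -- By uniqueness of the source, the given ideal also has minimal homotopy relation, so its
  -- presentation can be changed, keeping the ideal, to one whose arrows lift to the covering.
  obtain ⟨f, σ, h, hl, hσ⟩ := hG.exists_isLiftSystem_of_isHomotopyMinimal hfin hQ hbypass hφ₀
    (hmin₁.of_eq (huniq _ hsource).symm)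
  have hI := hl.isHomotopyInvariant hG.covering h
  obtain ⟨z, hz⟩ := hG.covering.fibre_nonempty ⟨x₀⟩
  let z₀ : Fibre F x₀ := ⟨z, hz⟩
  have hpt := hI.exists_point_eq hl hG.covering hQ hbypass h hC' z₀
  -- The lift sends the class of a walk to the end of the lifted walk starting at the chosen point.
  obtain ⟨L, hobj, hL⟩ := hG.covering.exists_lift (P := h.coverEval x₀)
    (fun c => (hI.point z₀ c.vertex).1) (fun c => (hI.point z₀ c.vertex).2)
    (hI.exists_map_eq_coverEval hl h z₀)
  have hadd := hG.covering.lift_additive hL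
  have hcov : IsCovering L :=
    { fibre_nonempty := fun z => by
        obtain ⟨c, hc⟩ := hpt z
        exact ⟨⟨c⟩, (hobj ⟨c⟩).trans hc⟩
      bijective_from := hG.covering.coverMapFrom_lift_bijective hL
        (h.coverMapFrom_bijective hQ hbypass)
      bijective_to := hG.covering.coverMapTo_lift_bijective hL
        (h.coverMapTo_bijective hQ hbypass) }
  obtain ⟨π, hπ⟩ := hG.exists_monoidHom hI hσ z₀
  exact ⟨evalFunctor he h.peirce I₀ h.le_ker, π.ker, L, hadd, π, h.isPresentation hQ hbypass,
    fun x => (hφ₀.obj_eq x.vertex).symm, π.normal_ker,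
    hG.isGaloisCovering_lift h hI hσ hπ hL hobj hcov, hL.symm,
    hG.monoidHom_surjective hI hpt hπ, rfl⟩
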